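/- **Setting.** Fix a linearly ordered infinite set of non-fresh constants and the set $\{\alpha_0<\alpha_1<\dots\}$ of fresh constants, all of which follow the non-fresh ones. An EER schema $\mathcal C$ consists of finitely many entities (with is-a clauses), relationships among $n\ge 2$ entities (with is-a clauses that carry permutations of the components) and attributes of entities or relationships (possibly functional, possibly mandatory), together with participation clauses $\ge 1$ and $\le 1$ of an entity as component $c$ of a relationship whose $c$-th entity it is. Its relational schema $\mathcal R$ has a unary predicate for each entity, an $n$-ary one for each $n$-ary relationship, and for each attribute a predicate whose arity is one more than that of the predicate of its owner. Predicates are linearly ordered. The conceptual dependencies $\Sigma$ of $\mathcal C$ are: - inclusion dependencies (IDs): $a[1..n]\subseteq p[1..n]$ for an attribute $a$ with $n$-ary owner $p$, and also $p[1..n]\subseteq a[1..n]$ if it is mandatory; $r[i]\subseteq e_i[1]$ for the $i$-th entity $e_i$ of $r$; $e_1[1]\subseteq e_2[1]$ and $r_1[1..n]\subseteq r_2[j_1..j_n]$ for is-a; $e[1]\subseteq r[c]$ for participation $\ge1$; - key dependencies (KDs): $key(a)=\{1..n\}$ for a functional attribute with $n$-ary owner; $key(r)=\{c\}$ for participation $\le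 1$ as component $c$. A database is a finite set $D$ of facts over $\mathcal R$. Its join graph has the facts as nodes and joins two facts iff they share a constant; $\kappa(D)$ is the number of facts in a largest connected component. **Chase.** $chase_\Sigma(D)$ is obtained from $D$ (level $0$) by repeating the following. As long as two distinct facts of a relation agree on a key, merge such a pair: argument by argument, replace both constants everywhere by the one that comes first in the order; the chase fails (does not exist) if two distinct non-fresh constants would have to be merged; collapsing facts get the lowest of their levels. Then, if some ID $r[\bar X]\subseteq s[\bar Y]$ and some fact $r(t)$ have no $s(t')$ with $t'[\bar Y]=t[\bar X]$, add one $s(t')$ with $t'[\bar Y]=t[\bar X]$ and with new fresh constants, following all previous ones, in the other positions, at the level of $r(t)$ plus $1$. Pairs for KDs are chosen by lowest minimum level, then lexicographically; for IDs, full-width IDs come first, then facts of lowest level, then lexicographic order. $chase_\Sigma(D)$ consists of the facts that are eventually permanently present, with their final levels. **Chase with equality.** $chase_{eq}(\Sigma,D)$ is built in the same way, except that $eq(c,c)$ is added at level $0$ for each constant $c$ of $D$, and at the level of the new fact for each new fresh constant $c$; KDs and IDs are tested up to $eq$; and instead of merging two facts $r(t),r(t')$, the missing atoms $eq(t_i,t'_i)$,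 $eq(t'_i,t_i)$ and those that follow by transitivity are added, at the lower of the levels of the two facts (failure if distinct non-fresh constants become equal). A conjunctive query $q$ of arity $n$ over $\mathcal R$ has a head $q(X_1,\dots,X_n)$ with distinct variables that occur in the body, and a body that is a finite list of atoms over $\mathcal R$ with variables and non-fresh constants. Its fresh-free answers over a set $I$ of atoms are the tuples $t$ of non-fresh constants such that some homomorphism (identity on non-fresh constants) sends the body to atoms of $I$ and the head to $t$. The query $q_{eq}$ is obtained from $q$ by replacing every occurrence of a term $u$ in the body by a new variable $X$ and adding the atom $eq(X,u)$ to the body. **Statement.** For all $\mathcal C$ (with its $\mathcal R$ and $\Sigma$) and every conjunctive query $q$ over $\mathcal R$ there is a function $\delta_M:\mathbb N\to\mathbb N$ such that for every database $D$ over $\mathcal R$ for which $chase_\Sigma(D)$ exists, with $\delta=\delta_M(\kappa(D))$: 1. for every fresh-free answer $t$ to $q$ over $chase_\Sigma(D)$ there is a homomorphism $\mu$ sending the body of $q$ to facts of $chase_\Sigma(D)$ of level at most $\delta$ and the head of $q$ to $t$; 2. with the same $\delta$, for every fresh-free answer $t$ to $q$ over $chase_{eq}(\Sigma,D)$ there is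 a homomorphism $\mu$ sending the body of $q$ to atoms of $chase_{eq}(\Sigma,D)$ of level at most $\delta$ and the head of $q$ to $t$; 3. with the same $\delta$, the same holds for $q_{eq}$ over $chase_{eq}(\Sigma,D)$. -/

import Mathlib

/-! ## Relational schemata, constants, facts, dependencies -/

/-- A relational schema: predicate symbols, each with an arity. -/
structure RelSchema where
  Pred : Type
  arity : Pred → ℕ

/-- The schema extended by the binary predicate `eq` (the symbol `none`). -/
def RelSchema.withEq (S : RelSchema) : RelSchema where
  Pred := Option S.Pred
  arity
    | some p => S.arity p
    | none => 2

/-- Constants: the non-fresh constants `Dom` followed (in the order) by the fresh constants,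
which are indexed by `ℕ`. -/
abbrev Const (Dom : Type*) := Dom ⊕ₗ ℕ

namespace Const

/-- A non-fresh constant. -/
def dom {Dom : Type*} (d : Dom) : Const Dom := toLex (Sum.inl d)

/-- A fresh constant. -/
def fresh {Dom : Type*} (k : ℕ) : Const Dom := toLex (Sum.inr k)

end Const

/-- `p(x₁, …, xₙ)` with arguments in `K`: a fact when `K` is a set of constants, an atom of a query
when `K` is a set of terms. -/
@[ext]
structure RelAtom (S : RelSchema) (K : Type*) where
  pred : S.Pred
  args : Fin (S.arity pred) → K

namespace RelAtom

/-- Apply a map to all arguments. -/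
def map {S : RelSchema} {K L : Type*} (σ : K → L) (f : RelAtom S K) : RelAtom S L :=
  ⟨f.pred, fun i => σ (f.args i)⟩

/-- The same atom over the schema extended by `eq`. -/
def toEq {S : RelSchema} {K : Type*} (f : RelAtom S K) : RelAtom S.withEq K :=
  ⟨some f.pred, f.args⟩

/-- Facts are ordered lexicographically: first the predicate, then the arguments. -/
def key {S : RelSchema} {K : Type*} (f : RelAtom S K) : S.Pred ×ₗ List K :=
  toLex (f.pred, List.ofFn f.args)

end RelAtom

/-- The inclusion dependency `src[srcPos] ⊆ tgt[tgtPos]`. -/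
structure InclDep (S : RelSchema) where
  src : S.Pred
  tgt : S.Pred
  width : ℕ
  srcPos : Fin width → Fin (S.arity src)
  tgtPos : Fin width → Fin (S.arity tgt)

namespace InclDep

/-- Every attribute of the source occurs exactly once on the left, every attribute of the target
exactly once on the right. -/
def FullWidth {S : RelSchema} (σ : InclDep S) : Prop :=
  Function.Bijective σ.srcPos ∧ Function.Bijective σ.tgtPos

/-- Lexicographic encoding, used to sort inclusion dependencies. -/
def key {S : RelSchema} (σ : InclDep S) : S.Pred ×ₗ S.Pred ×ₗ List ℕ ×ₗ List ℕ :=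
  toLex (σ.src, toLex (σ.tgt, toLex
    (List.ofFn fun i => (σ.srcPos i : ℕ), List.ofFn fun i => (σ.tgtPos i : ℕ))))

end InclDep

/-- The key dependency `key(rel) = attrs`. -/
structure KeyDep (S : RelSchema) where
  rel : S.Pred
  attrs : Finset (Fin (S.arity rel))

/-- Lexicographic encoding, used to sort key dependencies. -/
def KeyDep.key {S : RelSchema} (κ : KeyDep S) : S.Pred ×ₗ List ℕ :=
  toLex (κ.rel, ((List.finRange (S.arity κ.rel)).filter (· ∈ κ.attrs)).map Fin.val)

/-! ## Extended Entity-Relationship schemata and conceptual dependencies -/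

/-- An Extended Entity-Relationship schema. -/
structure EERSchema where
  /-- entity symbols -/
  Ent : Type
  /-- relationship symbols -/
  Rel : Type
  /-- attribute symbols -/
  Att : Type
  /-- the is-a clause of an entity definition -/
  entIsa : Ent → Set Ent
  /-- the number of components of a relationship -/
  relArity : Rel → ℕ
  two_le_relArity : ∀ R, 2 ≤ relArity R
  /-- the entities among which a relationship is defined -/
  among : (R : Rel) → Fin (relArity R) → Ent
  /-- the is-a clause of a relationship definition: `⟨R', j⟩ ∈ relIsa R` says that `R` is-a `R'`,
  component `i` of `R` corresponding to component `j i` of `R'` -/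
  relIsa : (R : Rel) → Set ((R' : Rel) × (Fin (relArity R) ≃ Fin (relArity R')))
  /-- the clause `participates(≥ 1)` of an entity definition -/
  partMin : Ent → Set ((R : Rel) × Fin (relArity R))
  partMin_among : ∀ E, ∀ x ∈ partMin E, among x.1 x.2 = E
  /-- the clause `participates(≤ 1)` of an entity definition -/
  partMax : Ent → Set ((R : Rel) × Fin (relArity R))
  partMax_among : ∀ E, ∀ x ∈ partMax E, among x.1 x.2 = E
  /-- the entity or relationship with which an attribute is associated -/
  owner : Att → Ent ⊕ Rel
  /-- functional attributes -/
  functional : Set Att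
  /-- mandatory attributes -/
  mandatory : Set Att

namespace EERSchema

variable (C : EERSchema)

/-- The arity of the predicate of an entity (`1`) or a relationship. -/
def baseArity : C.Ent ⊕ C.Rel → ℕ
  | Sum.inl _ => 1
  | Sum.inr R => C.relArity R

/-- The associated relational schema: one predicate for each entity, relationship and attribute;
the predicate of an attribute has one argument more than that of its owner. -/
def schema : RelSchema where
  Pred := (C.Ent ⊕ C.Rel) ⊕ C.Att
  arity
    | Sum.inl x => C.baseArity x
    | Sum.inr A => C.baseArity (C.owner A) + 1

/-- The predicate of an entity. -/
def ent (E : C.Ent) : C.schema.Pred := Sum.inl (Sum.inl E)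

/-- The predicate of a relationship. -/
def rel (R : C.Rel) : C.schema.Pred := Sum.inl (Sum.inr R)

/-- The predicate of an attribute. -/
def att (A : C.Att) : C.schema.Pred := Sum.inr A

/-- The predicate of the entity or relationship that owns an attribute. -/
def ownerPred (A : C.Att) : C.schema.Pred := Sum.inl (C.owner A)

/-- The only attribute of the predicate of an entity. -/
def entPos (E : C.Ent) : Fin (C.schema.arity (C.ent E)) := (0 : Fin 1)

/-- Component `i` of a relationship as an attribute of its predicate. -/
def relPos (R : C.Rel) (i : Fin (C.relArity R)) : Fin (C.schema.arity (C.rel R)) := i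

/-- Attribute `i ≤ n` of the predicate of arity `n + 1` of an attribute whose owner has arity
`n`. -/
def attPos (A : C.Att) (i : Fin (C.schema.arity (C.ownerPred A))) :
    Fin (C.schema.arity (C.att A)) :=
  Fin.castSucc i

/-- The inclusion dependencies of an EER schema. -/
inductive IsInclDep : InclDep C.schema → Prop
  /-- `a[1,…,n] ⊆ p[1,…,n]` for an attribute of an entity (`n = 1`) or a relationship -/
  | attOwner (A : C.Att) :
      IsInclDep ⟨C.att A, C.ownerPred A, C.schema.arity (C.ownerPred A), C.attPos A, id⟩
  /-- `r[i] ⊆ eᵢ[1]` for the components of a relationship -/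
  | relComp (R : C.Rel) (i : Fin (C.relArity R)) :
      IsInclDep ⟨C.rel R, C.ent (C.among R i), 1, fun _ => C.relPos R i, fun _ => C.entPos _⟩
  /-- `p[1,…,n] ⊆ a[1,…,n]` for a mandatory attribute of an entity or a relationship -/
  | attMandatory (A : C.Att) (h : A ∈ C.mandatory) :
      IsInclDep ⟨C.ownerPred A, C.att A, C.schema.arity (C.ownerPred A), id, C.attPos A⟩
  /-- `e₁[1] ⊆ e₂[1]` for an is-a between entities -/
  | entIsa (E₁ E₂ : C.Ent) (h : E₂ ∈ C.entIsa E₁) :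
      IsInclDep ⟨C.ent E₁, C.ent E₂, 1, fun _ => C.entPos _, fun _ => C.entPos _⟩
  /-- `r₁[1,…,n] ⊆ r₂[j₁,…,jₙ]` for an is-a between relationships -/
  | relIsa (R₁ R₂ : C.Rel) (j : Fin (C.relArity R₁) ≃ Fin (C.relArity R₂))
      (h : ⟨R₂, j⟩ ∈ C.relIsa R₁) :
      IsInclDep ⟨C.rel R₁, C.rel R₂, C.relArity R₁, C.relPos R₁, fun i => C.relPos R₂ (j i)⟩
  /-- `e[1] ⊆ r[c]` for a mandatory participation -/
  | partMin (E : C.Ent) (R : C.Rel) (c : Fin (C.relArity R)) (h : ⟨R, c⟩ ∈ C.partMin E) :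
      IsInclDep ⟨C.ent E, C.rel R, 1, fun _ => C.entPos E, fun _ => C.relPos R c⟩

/-- The key dependencies of an EER schema. -/
inductive IsKeyDep : KeyDep C.schema → Prop
  /-- `key(a) = {1,…,n}` for a functional attribute of an entity (`n = 1`) or a relationship -/
  | attFunctional (A : C.Att) (h : A ∈ C.functional) :
      IsKeyDep ⟨C.att A, Finset.univ.image (C.attPos A)⟩
  /-- `key(r) = {c}` for a participation with maximum cardinality `1` -/
  | partMax (E : C.Ent) (R : C.Rel) (c : Fin (C.relArity R)) (h : ⟨R, c⟩ ∈ C.partMax E) :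
      IsKeyDep ⟨C.rel R, {C.relPos R c}⟩

/-- The set of conceptual dependencies of an EER schema: its inclusion dependencies. -/
def inclDeps : Set (InclDep C.schema) := {σ | C.IsInclDep σ}

/-- The set of conceptual dependencies of an EER schema: its key dependencies. -/
def keyDeps : Set (KeyDep C.schema) := {κ | C.IsKeyDep κ}

end EERSchema

/-! ## The join graph of a database -/

section JoinGraph

variable {S : RelSchema} {K : Type*}

/-- The join graph of a database: its facts, two distinct ones being adjacent iff they share a
constant. -/
def joinGraph (D : Finset (RelAtom S K)) : SimpleGraph D where
  Adj f g := f ≠ g ∧ ∃ i j, f.1.args i = g.1.args j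
  symm := ⟨fun _ _ ⟨hne, i, j, h⟩ => ⟨hne.symm, j, i, h.symm⟩⟩
  loopless := ⟨fun _ h => h.1 rfl⟩

/-- The number of facts of the largest connected part of the join graph. -/
noncomputable def connSize (D : Finset (RelAtom S K)) : ℕ :=
  ⨆ c : (joinGraph D).ConnectedComponent, c.supp.ncard

end JoinGraph

/-! ## Conjunctive queries -/

/-- Terms of a query: variables and non-fresh constants. -/
inductive QTerm (Dom V : Type*) where
  | var (x : V)
  | const (d : Dom)

namespace QTerm

/-- The value of a term under an assignment of constants to the variables. -/
def eval {Dom V : Type*} (μ : V → Const Dom) : QTerm Dom V → Const Dom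
  | var x => μ x
  | const d => Const.dom d

/-- Rename the variables. -/
def rename {Dom V W : Type*} (f : V → W) : QTerm Dom V → QTerm Dom W
  | var x => var (f x)
  | const d => const d

end QTerm

/-- A conjunctive query of arity `n`: the head is a sequence of distinct variables, each of which
occurs in the body. -/
structure ConjQuery (S : RelSchema) (Dom V : Type*) (n : ℕ) where
  head : Fin n → V
  head_injective : Function.Injective head
  body : List (RelAtom S (QTerm Dom V))
  range_restricted : ∀ i, ∃ A ∈ body, ∃ j, A.args j = QTerm.var (head i)

namespace ConjQuery

variable {S : RelSchema} {Dom V : Type*} {n : ℕ}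

/-- The homomorphism given by `μ` sends the body of `q` to facts of `I` and its head to `t`. -/
def Sends (q : ConjQuery S Dom V n) (μ : V → Const Dom) (I : Set (RelAtom S (Const Dom)))
    (t : Fin n → Const Dom) : Prop :=
  (∀ A ∈ q.body, A.map (QTerm.eval μ) ∈ I) ∧ ∀ i, μ (q.head i) = t i

/-- The answers to `q` over `I` whose tuples contain no fresh constants. -/
def freshFreeAnswers (q : ConjQuery S Dom V n) (I : Set (RelAtom S (Const Dom))) :
    Set (Fin n → Const Dom) :=
  {t | (∃ μ, q.Sends μ I t) ∧ ∀ i, ∃ d, t i = Const.dom d}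

/-- A query over `S` as a query over `S` extended by `eq`. -/
def toEq (q : ConjQuery S Dom V n) : ConjQuery S.withEq Dom V n where
  head := q.head
  head_injective := q.head_injective
  body := q.body.map RelAtom.toEq
  range_restricted i := by
    obtain ⟨A, hA, j, hj⟩ := q.range_restricted i
    exact ⟨A.toEq, List.mem_map_of_mem hA, j, hj⟩

/-- The places of a query: the argument positions of its body atoms. -/
abbrev Place (q : ConjQuery S Dom V n) : Type :=
  (k : Fin q.body.length) × Fin (S.arity (q.body.get k).pred)

/-- The `k`-th body atom, with a new variable at each place. -/
def maquillageAtom (q : ConjQuery S Dom V n) (k : Fin q.body.length) :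
    RelAtom S.withEq (QTerm Dom (V ⊕ q.Place)) :=
  ⟨some (q.body.get k).pred, fun j => QTerm.var (Sum.inr ⟨k, j⟩)⟩

/-- The atom `eq(X, u)`, where `X` is the new variable for the `j`-th argument `u` of the `k`-th
body atom. -/
def maquillageEq (q : ConjQuery S Dom V n) (k : Fin q.body.length)
    (j : Fin (S.arity (q.body.get k).pred)) : RelAtom S.withEq (QTerm Dom (V ⊕ q.Place)) :=
  ⟨none, (![QTerm.var (Sum.inr ⟨k, j⟩), ((q.body.get k).args j).rename Sum.inl] :
    Fin 2 → QTerm Dom (V ⊕ q.Place))⟩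

/-- The equality maquillage of a query: every occurrence of a term `u` in the body is replaced by a
new variable `X`, and the atom `eq(X, u)` is added to the body. -/
def maquillage (q : ConjQuery S Dom V n) : ConjQuery S.withEq Dom (V ⊕ q.Place) n where
  head i := Sum.inl (q.head i)
  head_injective := Sum.inl_injective.comp q.head_injective
  body := (List.finRange q.body.length).map q.maquillageAtom ++
    (List.finRange q.body.length).flatMap fun k =>
      (List.finRange (S.arity (q.body.get k).pred)).map (q.maquillageEq k)
  range_restricted i := by
    obtain ⟨A, hA, j, hj⟩ := q.range_restricted i
    obtain ⟨k, rfl⟩ := List.get_of_mem hA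
    refine ⟨q.maquillageEq k j, ?_, (1 : Fin 2), ?_⟩
    · simp only [List.mem_append, List.mem_flatMap, List.mem_map]
      exact Or.inr ⟨k, List.mem_finRange k, j, List.mem_finRange j, rfl⟩
    · change ((q.body.get k).args j).rename Sum.inl = _
      rw [hj]
      rfl

end ConjQuery

/-! ## The chase

All chases are sequences of states. A state assigns to every fact its level, the level of a fact
that is absent being `⊤`, and keeps the index of the next unused fresh constant. -/

section Chase

variable {S : RelSchema} {Dom : Type*}

/-- The first index after those of all fresh constants of `D`. -/
noncomputable def firstFresh (D : Finset (RelAtom S (Const Dom))) : ℕ :=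
  sInf {m | ∀ f ∈ D, ∀ i k, f.args i = Const.fresh k → k < m}

open Classical in
/-- The tuple that the inclusion dependency `σ` generates from the tuple `t`: `t[srcPos]` at the
attributes `tgtPos`, and new fresh constants elsewhere. -/
noncomputable def InclDep.newTuple (σ : InclDep S) (t : Fin (S.arity σ.src) → Const Dom)
    (next : ℕ) : Fin (S.arity σ.tgt) → Const Dom :=
  fun j => if h : ∃ i, σ.tgtPos i = j then t (σ.srcPos h.choose) else Const.fresh (next + j)

/-- A key dependency together with two tuples of its relation. -/
structure KDTrigger (S : RelSchema) (Dom : Type*) where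
  dep : KeyDep S
  fst : Fin (S.arity dep.rel) → Const Dom
  snd : Fin (S.arity dep.rel) → Const Dom

namespace KDTrigger

/-- The first fact of the pair. -/
def fact₁ (τ : KDTrigger S Dom) : RelAtom S (Const Dom) := ⟨τ.dep.rel, τ.fst⟩

/-- The second fact of the pair. -/
def fact₂ (τ : KDTrigger S Dom) : RelAtom S (Const Dom) := ⟨τ.dep.rel, τ.snd⟩

/-- The level of a pair of facts: the lower of their levels. -/
noncomputable def level (τ : KDTrigger S Dom) (lev : RelAtom S (Const Dom) → ℕ∞) : ℕ∞ :=
  min (lev τ.fact₁) (lev τ.fact₂)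

/-- Pairs of facts are considered by level, then lexicographically, then key dependencies
lexicographically. -/
noncomputable def rank (τ : KDTrigger S Dom) (lev : RelAtom S (Const Dom) → ℕ∞) :
    ℕ∞ ×ₗ (S.Pred ×ₗ List (Const Dom)) ×ₗ (S.Pred ×ₗ List (Const Dom)) ×ₗ (S.Pred ×ₗ List ℕ) :=
  toLex (τ.level lev, toLex (τ.fact₁.key, toLex (τ.fact₂.key, τ.dep.key)))

/-- `τ` comes first among the triggers that satisfy `P`. -/
def First [LinearOrder S.Pred] [LinearOrder Dom] (lev : RelAtom S (Const Dom) → ℕ∞)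
    (P : KDTrigger S Dom → Prop) (τ : KDTrigger S Dom) : Prop :=
  P τ ∧ ∀ τ', P τ' → τ.rank lev ≤ τ'.rank lev

end KDTrigger

/-- An inclusion dependency together with a tuple of its source relation. -/
structure IDTrigger (S : RelSchema) (Dom : Type*) where
  dep : InclDep S
  tup : Fin (S.arity dep.src) → Const Dom

namespace IDTrigger

/-- The fact to which the dependency is applied. -/
def fact (τ : IDTrigger S Dom) : RelAtom S (Const Dom) := ⟨τ.dep.src, τ.tup⟩

/-- The fact that is generated. -/
noncomputable def newFact (τ : IDTrigger S Dom) (next : ℕ) : RelAtom S (Const Dom) :=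
  ⟨τ.dep.tgt, τ.dep.newTuple τ.tup next⟩

open Classical in
/-- Full-width dependencies are considered first; then facts are considered by level, then
lexicographically, then inclusion dependencies lexicographically. -/
noncomputable def rank (τ : IDTrigger S Dom) (lev : RelAtom S (Const Dom) → ℕ∞) :
    ℕ ×ₗ ℕ∞ ×ₗ (S.Pred ×ₗ List (Const Dom)) ×ₗ (S.Pred ×ₗ S.Pred ×ₗ List ℕ ×ₗ List ℕ) :=
  toLex (if τ.dep.FullWidth then 0 else 1, toLex (lev τ.fact, toLex (τ.fact.key, τ.dep.key)))

/-- `τ` comes first among the triggers that satisfy `P`. -/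
def First [LinearOrder S.Pred] [LinearOrder Dom] (lev : RelAtom S (Const Dom) → ℕ∞)
    (P : IDTrigger S Dom → Prop) (τ : IDTrigger S Dom) : Prop :=
  P τ ∧ ∀ τ', P τ' → τ.rank lev ≤ τ'.rank lev

end IDTrigger

/-! ### The chase -/

/-- A state of the chase. -/
structure ChaseState (S : RelSchema) (Dom : Type*) where
  lev : RelAtom S (Const Dom) → ℕ∞
  next : ℕ

namespace ChaseState

open Classical in
/-- The initial state: the facts of `D`, at level `0`. -/
noncomputable def init (D : Finset (RelAtom S (Const Dom))) : ChaseState S Dom where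
  lev f := if f ∈ D then 0 else ⊤
  next := firstFresh D

/-- The fact `f` is present. -/
def Has (s : ChaseState S Dom) (f : RelAtom S (Const Dom)) : Prop := s.lev f ≠ ⊤

/-- The key dependency chase rule is applicable: two distinct facts agree on the key. -/
def KDApplicable [LinearOrder S.Pred] [LinearOrder Dom] (K : Set (KeyDep S))
    (s : ChaseState S Dom) (τ : KDTrigger S Dom) : Prop :=
  τ.dep ∈ K ∧ s.Has τ.fact₁ ∧ s.Has τ.fact₂ ∧ τ.fact₁.key < τ.fact₂.key ∧
    ∀ i ∈ τ.dep.attrs, τ.fst i = τ.snd i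

/-- The inclusion dependency chase rule is applicable. -/
def IDApplicable (I : Set (InclDep S)) (s : ChaseState S Dom) (τ : IDTrigger S Dom) : Prop :=
  τ.dep ∈ I ∧ s.Has τ.fact ∧
    ¬ ∃ u, s.Has ⟨τ.dep.tgt, u⟩ ∧ ∀ i, u (τ.dep.tgtPos i) = τ.tup (τ.dep.srcPos i)

end ChaseState

open Classical in
/-- Merge two constants: replace both by the first of them in the order of constants, where the
non-fresh constants precede the fresh ones; fail if they are distinct non-fresh constants. -/
noncomputable def combine [LinearOrder Dom] (a b : Const Dom) :
    Option (Const Dom → Const Dom) :=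
  if a = b then some id
  else if (∃ c d, a = Const.dom c ∧ b = Const.dom d) then none
  else some fun c => if c = a ∨ c = b then min a b else c

/-- The replacement of constants that makes two tuples equal, position by position; it fails if it
would have to identify distinct non-fresh constants. -/
noncomputable def unifier [LinearOrder Dom] {m : ℕ} (t u : Fin m → Const Dom) :
    Option (Const Dom → Const Dom) :=
  (List.finRange m).foldlM
    (fun σ i => (combine (σ (t i)) (σ (u i))).map fun ρ => ρ ∘ σ) id

namespace ChaseState

/-- Replace constants everywhere; a fact into which several facts collapse gets the lowest of their
levels. -/
noncomputable def replace (s : ChaseState S Dom) (σ : Const Dom → Const Dom) :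
    ChaseState S Dom where
  lev f := ⨅ g : {g : RelAtom S (Const Dom) // g.map σ = f}, s.lev g
  next := s.next

open Classical in
/-- Apply the inclusion dependency chase rule. -/
noncomputable def applyID (s : ChaseState S Dom) (τ : IDTrigger S Dom) : ChaseState S Dom where
  lev f := if f = τ.newFact s.next then s.lev τ.fact + 1 else s.lev f
  next := s.next + S.arity τ.dep.tgt

open Classical in
/-- One step of the chase; `none` is failure. -/
noncomputable def step [LinearOrder S.Pred] [LinearOrder Dom] (I : Set (InclDep S))
    (K : Set (KeyDep S)) (s : ChaseState S Dom) : Option (ChaseState S Dom) :=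
  if h : ∃ τ, KDTrigger.First s.lev (s.KDApplicable K) τ then
    (unifier h.choose.fst h.choose.snd).map s.replace
  else if h : ∃ τ, IDTrigger.First s.lev (s.IDApplicable I) τ then
    some (s.applyID h.choose)
  else some s

end ChaseState

/-- The states of the chase of `D` (`none` from the failure on). -/
noncomputable def chaseSeq [LinearOrder S.Pred] [LinearOrder Dom] (I : Set (InclDep S))
    (K : Set (KeyDep S)) (D : Finset (RelAtom S (Const Dom))) : ℕ → Option (ChaseState S Dom)
  | 0 => some (ChaseState.init D)
  | n + 1 => (chaseSeq I K D n).bind (ChaseState.step I K)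

/-- The chase of `D` exists: it does not fail. -/
def ChaseExists [LinearOrder S.Pred] [LinearOrder Dom] (I : Set (InclDep S))
    (K : Set (KeyDep S)) (D : Finset (RelAtom S (Const Dom))) : Prop :=
  ∀ n, chaseSeq I K D n ≠ none

/-- The part of the chase up to level `ℓ`: the facts that from some moment on are present at a fixed
level which is at most `ℓ`. -/
def chaseUpTo [LinearOrder S.Pred] [LinearOrder Dom] (I : Set (InclDep S))
    (K : Set (KeyDep S)) (D : Finset (RelAtom S (Const Dom))) (ℓ : ℕ) : Set (RelAtom S (Const Dom)) :=
  {f | ∃ k : ℕ, k ≤ ℓ ∧ ∀ᶠ n in Filter.atTop, ∃ s, chaseSeq I K D n = some s ∧ s.lev f = k}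

/-- The chase: the facts of all levels. -/
def chase [LinearOrder S.Pred] [LinearOrder Dom] (I : Set (InclDep S))
    (K : Set (KeyDep S)) (D : Finset (RelAtom S (Const Dom))) : Set (RelAtom S (Const Dom)) :=
  ⋃ ℓ, chaseUpTo I K D ℓ

/-! ### The chase with equality atoms -/

/-- A state of the chase with equality: the levels of the facts, the levels of the atoms
`eq(a, b)`, and the next unused fresh constant. -/
structure EqChaseState (S : RelSchema) (Dom : Type*) where
  lev : RelAtom S (Const Dom) → ℕ∞
  eqLev : Const Dom → Const Dom → ℕ∞
  next : ℕ

namespace EqChaseState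

/-- The level of an atom of the extended schema. -/
def atomLev (s : EqChaseState S Dom) : RelAtom S.withEq (Const Dom) → ℕ∞
  | ⟨some p, a⟩ => s.lev ⟨p, a⟩
  | ⟨none, a⟩ => s.eqLev (a (0 : Fin 2)) (a (1 : Fin 2))

open Classical in
/-- The initial state: the facts of `D` and the atoms `eq(c, c)` for the constants `c` of `D`, at
level `0`. -/
noncomputable def init (D : Finset (RelAtom S (Const Dom))) : EqChaseState S Dom where
  lev f := if f ∈ D then 0 else ⊤
  eqLev a b := if a = b ∧ ∃ f ∈ D, ∃ i, f.args i = a then 0 else ⊤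
  next := firstFresh D

/-- The fact `f` is present. -/
def Has (s : EqChaseState S Dom) (f : RelAtom S (Const Dom)) : Prop := s.lev f ≠ ⊤

/-- The atom `eq(a, b)` is present. -/
def HasEq (s : EqChaseState S Dom) (a b : Const Dom) : Prop := s.eqLev a b ≠ ⊤

/-- The key dependency rule is applicable: two facts are equal on the key with respect to `eq`, but
not yet on all positions. -/
def KDApplicable [LinearOrder S.Pred] [LinearOrder Dom] (K : Set (KeyDep S))
    (s : EqChaseState S Dom) (τ : KDTrigger S Dom) : Prop :=
  τ.dep ∈ K ∧ s.Has τ.fact₁ ∧ s.Has τ.fact₂ ∧ τ.fact₁.key < τ.fact₂.key ∧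
    (∀ i ∈ τ.dep.attrs, s.HasEq (τ.fst i) (τ.snd i)) ∧ ∃ i, ¬ s.HasEq (τ.fst i) (τ.snd i)

/-- The inclusion dependency rule is applicable. -/
def IDApplicable (I : Set (InclDep S)) (s : EqChaseState S Dom) (τ : IDTrigger S Dom) : Prop :=
  τ.dep ∈ I ∧ s.Has τ.fact ∧
    ¬ ∃ u, s.Has ⟨τ.dep.tgt, u⟩ ∧ ∀ i, s.HasEq (τ.tup (τ.dep.srcPos i)) (u (τ.dep.tgtPos i))

/-- The equalities after an application of the key dependency rule: the present ones together with
those between corresponding arguments of the two facts, closed under transitivity. -/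
def MergedEq (s : EqChaseState S Dom) (τ : KDTrigger S Dom) : Const Dom → Const Dom → Prop :=
  Relation.TransGen fun a b =>
    s.HasEq a b ∨ ∃ i, (a = τ.fst i ∧ b = τ.snd i) ∨ (a = τ.snd i ∧ b = τ.fst i)

open Classical in
/-- Apply the key dependency rule: the new `eq` atoms get the lower of the levels of the two
facts. -/
noncomputable def applyKD (s : EqChaseState S Dom) (τ : KDTrigger S Dom) :
    EqChaseState S Dom where
  lev := s.lev
  eqLev a b :=
    if s.HasEq a b then s.eqLev a b
    else if s.MergedEq τ a b then τ.level s.lev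
    else ⊤
  next := s.next

open Classical in
/-- Apply the inclusion dependency rule: the new fact and the atoms `eq(α, α)` for its new fresh
constants `α` get the level of the given fact plus `1`. -/
noncomputable def applyID (s : EqChaseState S Dom) (τ : IDTrigger S Dom) :
    EqChaseState S Dom where
  lev f := if f = τ.newFact s.next then s.lev τ.fact + 1 else s.lev f
  eqLev a b :=
    if a = b ∧ ∃ j ∉ Set.range τ.dep.tgtPos, a = Const.fresh (s.next + j) then s.lev τ.fact + 1
    else s.eqLev a b
  next := s.next + S.arity τ.dep.tgt

/-- An atom `eq(c₁, c₂)` with distinct non-fresh `c₁` and `c₂` is present. -/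
def Clash (s : EqChaseState S Dom) : Prop :=
  ∃ c₁ c₂ : Dom, c₁ ≠ c₂ ∧ s.HasEq (Const.dom c₁) (Const.dom c₂)

open Classical in
/-- One step of the chase with equality; `none` is failure. -/
noncomputable def step [LinearOrder S.Pred] [LinearOrder Dom] (I : Set (InclDep S))
    (K : Set (KeyDep S)) (s : EqChaseState S Dom) : Option (EqChaseState S Dom) :=
  if h : ∃ τ, KDTrigger.First s.lev (s.KDApplicable K) τ then
    if (s.applyKD h.choose).Clash then none else some (s.applyKD h.choose)
  else if h : ∃ τ, IDTrigger.First s.lev (s.IDApplicable I) τ then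
    some (s.applyID h.choose)
  else some s

end EqChaseState

/-- The states of the chase with equality of `D` (`none` from the failure on). -/
noncomputable def eqChaseSeq [LinearOrder S.Pred] [LinearOrder Dom] (I : Set (InclDep S))
    (K : Set (KeyDep S)) (D : Finset (RelAtom S (Const Dom))) : ℕ → Option (EqChaseState S Dom)
  | 0 => some (EqChaseState.init D)
  | n + 1 => (eqChaseSeq I K D n).bind (EqChaseState.step I K)

/-- The part of the chase with equality up to level `ℓ`: the atoms (facts and `eq` atoms) that from
some moment on are present at a fixed level which is at most `ℓ`. -/
def eqChaseUpTo [LinearOrder S.Pred] [LinearOrder Dom] (I : Set (InclDep S))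
    (K : Set (KeyDep S)) (D : Finset (RelAtom S (Const Dom))) (ℓ : ℕ) :
    Set (RelAtom S.withEq (Const Dom)) :=
  {f | ∃ k : ℕ, k ≤ ℓ ∧
    ∀ᶠ n in Filter.atTop, ∃ s, eqChaseSeq I K D n = some s ∧ s.atomLev f = k}

/-- The chase with equality: the atoms of all levels. -/
def eqChase [LinearOrder S.Pred] [LinearOrder Dom] (I : Set (InclDep S))
    (K : Set (KeyDep S)) (D : Finset (RelAtom S (Const Dom))) : Set (RelAtom S.withEq (Const Dom)) :=
  ⋃ ℓ, eqChaseUpTo I K D ℓ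

end Chase

/-! ## Constants -/

namespace Const

variable {Dom : Type*}

/-! The chase works on each connected component of the join graph separately. Label every constant
of `D` by its component, and let a constant that the chase invents inherit the label of the fact it
comes from. Labels remain constant on every atom: a key is nonempty, so two facts that agree on it
have the same label, and merging them only moves constants within that label. Since an ID has
positive width, whether it is satisfied for a fact depends only on facts with the label of that
fact. So, for a set `T` of labels, the part of the chase of `D` with labels in `T` is a chase of the
facts of `D` with labels in `T`, up to a renaming of constants and up to idle steps during which the
chase of `D` works elsewhere. The renaming has to preserve the order, which decides what trigger
fires and what constant survives a merge, and the distinction between fresh and non-fresh constants.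
Levels then agree exactly. The steps of this simulation are `ChaseState.sim_step` and
`EqChaseState.sim_step`.

A homomorphism from a body of `k` atoms to a state of the chase meets at most `k` labels, so it
lives in the chase of at most `κ(D) * k` facts. Up to isomorphisms that also respect the constants
of the query there are finitely many databases of that size (`exists_finite_representatives`).
During the chase of one database only finitely many fresh-free tuples can become answers, and each
does so first through atoms of finite level; this yields a bound for that database
(`LevelRun.Regular.exists_bound`). The value of `δ` is the maximum over the representatives, and
`LevelEmb.sends` carries the bound back to `D`.

Between a state and the limit one argues as follows. Each step comes with a map of constants that
fixes the non-fresh ones, moves no constant upwards, and raises no level. Composing a homomorphism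
with these maps keeps the answer and the bound. Every constant finally stops moving, because fresh
constants can only descend through the well-ordered indices or become non-fresh, and so a limit
homomorphism exists (`exists_stable`, `LevelRun.Regular.sends_upTo`).

These arguments use only the properties collected in `LevelRun.Regular`. Both chases have them, and
`LevelRun.Regular.exists_level_bound` is applied three times. -/

theorem dom_injective : Function.Injective (dom : Dom → Const Dom) :=
  fun _ _ h => Sum.inl_injective (toLex.injective h)

theorem fresh_injective : Function.Injective (fresh : ℕ → Const Dom) :=
  fun _ _ h => Sum.inr_injective (toLex.injective h)

theorem dom_ne_fresh (d : Dom) (k : ℕ) : (dom d : Const Dom) ≠ fresh k :=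
  fun h => Sum.inl_ne_inr (toLex.injective h)

theorem eq_dom_or_eq_fresh (c : Const Dom) : (∃ d, c = dom d) ∨ ∃ k, c = fresh k := by
  rcases h : ofLex c with d | k
  · exact Or.inl ⟨d, ofLex.injective h⟩
  · exact Or.inr ⟨k, ofLex.injective h⟩

variable [LinearOrder Dom]

theorem dom_lt_fresh (d : Dom) (k : ℕ) : (dom d : Const Dom) < fresh k :=
  Sum.Lex.inl_lt_inr d k

theorem fresh_lt_fresh {j k : ℕ} : (fresh j : Const Dom) < fresh k ↔ j < k :=
  Sum.Lex.inr_lt_inr_iff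

theorem fresh_le_fresh {j k : ℕ} : (fresh j : Const Dom) ≤ fresh k ↔ j ≤ k :=
  Sum.Lex.inr_le_inr_iff

end Const

/-! ## Atoms under maps of constants -/

theorem RelAtom.map_congr {S : RelSchema} {K L : Type*} {σ τ : K → L} {f : RelAtom S K}
    (h : ∀ i, σ (f.args i) = τ (f.args i)) : f.map σ = f.map τ := by
  simp only [RelAtom.map, h]

theorem RelAtom.map_eq_self {S : RelSchema} {K : Type*} {σ : K → K} {f : RelAtom S K}
    (h : ∀ i, σ (f.args i) = f.args i) : f.map σ = f := by
  simp only [RelAtom.map, h]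

theorem RelAtom.map_id {S : RelSchema} {K : Type*} (f : RelAtom S K) : f.map id = f := rfl

theorem RelAtom.map_injOn {S : RelSchema} {K L : Type*} {σ : K → L} {W : Set K}
    (h : Set.InjOn σ W) {f g : RelAtom S K} (hf : ∀ i, f.args i ∈ W) (hg : ∀ i, g.args i ∈ W)
    (hfg : f.map σ = g.map σ) : f = g := by
  obtain ⟨p, a⟩ := f
  obtain ⟨p', b⟩ := g
  simp only [RelAtom.map, RelAtom.mk.injEq] at hfg
  obtain ⟨rfl, hab⟩ := hfg
  have hab := eq_of_heq hab
  congr 1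
  funext i
  exact h (hf i) (hg i) (congrFun hab i)

theorem RelAtom.key_injective {S : RelSchema} {K : Type*} :
    Function.Injective (RelAtom.key : RelAtom S K → _) := by
  rintro ⟨p, a⟩ ⟨p', b⟩ h
  have h := toLex.injective h
  simp only [Prod.mk.injEq] at h
  obtain ⟨rfl, hab⟩ := h
  rw [List.ofFn_injective hab]

/-! ### Lexicographic comparison under order-preserving renamings -/

theorem List.map_lt_map_iff_of_strictMonoOn {α β : Type*} [LinearOrder α] [LinearOrder β]
    {ρ : α → β} {W : Set α} (h : StrictMonoOn ρ W) :
    ∀ l l' : List α, (∀ x ∈ l, x ∈ W) → (∀ x ∈ l', x ∈ W) → (l.map ρ < l'.map ρ ↔ l < l')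
  | [], [], _, _ => by simp
  | [], b :: l', _, _ => by simp
  | a :: l, [], _, _ => by simp
  | a :: l, b :: l', hl, hl' => by
    have ha := hl a (by simp)
    have hb := hl' b (by simp)
    have ih := List.map_lt_map_iff_of_strictMonoOn h l l' (fun x hx => hl x (by simp [hx]))
      (fun x hx => hl' x (by simp [hx]))
    rw [List.map_cons, List.map_cons, List.cons_lt_cons_iff, List.cons_lt_cons_iff,
      h.lt_iff_lt ha hb, h.injOn.eq_iff ha hb, ih]

section Order

variable {S : RelSchema} {Dom : Type*} [LinearOrder S.Pred] [LinearOrder Dom]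
  {W : Set (Const Dom)} {ρ : Const Dom → Const Dom}

theorem RelAtom.key_map_lt_iff (h : StrictMonoOn ρ W) {f g : RelAtom S (Const Dom)}
    (hf : ∀ i, f.args i ∈ W) (hg : ∀ i, g.args i ∈ W) :
    (f.map ρ).key < (g.map ρ).key ↔ f.key < g.key := by
  have e : ∀ f : RelAtom S (Const Dom), (f.map ρ).key = toLex (f.pred, (List.ofFn f.args).map ρ) :=
    fun f => by rw [List.map_ofFn]; rfl
  rw [e, e, RelAtom.key, RelAtom.key, Prod.Lex.toLex_lt_toLex, Prod.Lex.toLex_lt_toLex,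
    List.map_lt_map_iff_of_strictMonoOn h]
  · intro x hx
    obtain ⟨i, rfl⟩ := (List.mem_ofFn' _ _).1 hx
    exact hf i
  · intro x hx
    obtain ⟨i, rfl⟩ := (List.mem_ofFn' _ _).1 hx
    exact hg i

end Order

theorem RelAtom.key_map_eq_iff {S : RelSchema} {Dom : Type*} [LinearOrder Dom]
    {W : Set (Const Dom)} {ρ : Const Dom → Const Dom} (h : StrictMonoOn ρ W)
    {f g : RelAtom S (Const Dom)}
    (hf : ∀ i, f.args i ∈ W) (hg : ∀ i, g.args i ∈ W) :
    (f.map ρ).key = (g.map ρ).key ↔ f.key = g.key := by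
  rw [RelAtom.key_injective.eq_iff, RelAtom.key_injective.eq_iff]
  exact ⟨RelAtom.map_injOn h.injOn hf hg, fun e => e ▸ rfl⟩

/-! ## Triggers -/

theorem KeyDep.key_injective {S : RelSchema} :
    Function.Injective (KeyDep.key : KeyDep S → _) := by
  rintro ⟨p, a⟩ ⟨p', b⟩ h
  have h := toLex.injective h
  simp only [Prod.mk.injEq] at h
  obtain ⟨rfl, hab⟩ := h
  congr 1
  have hab := List.map_injective_iff.2 Fin.val_injective hab
  ext i
  have := congrArg (i ∈ ·) hab
  simpa using this

theorem InclDep.key_injective {S : RelSchema} :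
    Function.Injective (InclDep.key : InclDep S → _) := by
  rintro ⟨p, q, w, a, b⟩ ⟨p', q', w', a', b'⟩ h
  simp only [InclDep.key, EmbeddingLike.apply_eq_iff_eq, Prod.mk.injEq] at h
  obtain ⟨rfl, rfl, ha, hb⟩ := h
  have hw : w = w' := by simpa using congrArg List.length ha
  subst hw
  have ha := List.ofFn_injective ha
  have hb := List.ofFn_injective hb
  congr 1
  · funext i; exact Fin.ext (congrFun ha i)
  · funext i; exact Fin.ext (congrFun hb i)

namespace KDTrigger

variable {S : RelSchema} {Dom : Type*}

/-- Apply a map of constants to both tuples. -/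
def map (ρ : Const Dom → Const Dom) (τ : KDTrigger S Dom) : KDTrigger S Dom :=
  ⟨τ.dep, ρ ∘ τ.fst, ρ ∘ τ.snd⟩

theorem ext_facts {τ τ' : KDTrigger S Dom} (h₁ : τ.fact₁ = τ'.fact₁) (h₂ : τ.fact₂ = τ'.fact₂)
    (h : τ.dep = τ'.dep) : τ = τ' := by
  obtain ⟨d, a, b⟩ := τ
  obtain ⟨d', a', b'⟩ := τ'
  obtain rfl : d = d' := h
  simp only [fact₁, fact₂, RelAtom.mk.injEq, heq_eq_eq, true_and] at h₁ h₂
  rw [h₁, h₂]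

/-- The rank contains the keys of both facts and of the dependency, and keys are injective, so there
are no ties. The trigger that `choose` selects in a step is therefore determined. -/
theorem First.unique [LinearOrder S.Pred] [LinearOrder Dom] {lev : RelAtom S (Const Dom) → ℕ∞}
    {P : KDTrigger S Dom → Prop} {τ τ' : KDTrigger S Dom} (h : First lev P τ)
    (h' : First lev P τ') : τ = τ' := by
  have e := le_antisymm (h.2 τ' h'.1) (h'.2 τ h.1)
  simp only [rank, EmbeddingLike.apply_eq_iff_eq, Prod.mk.injEq] at e
  exact ext_facts (RelAtom.key_injective e.2.1) (RelAtom.key_injective e.2.2.1)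
    (KeyDep.key_injective e.2.2.2)

/-- Finitely many present facts and finitely many key dependencies leave finitely many candidates.
Used in contrapositive form: if no trigger is first, none is applicable. -/
theorem exists_first [LinearOrder S.Pred] [LinearOrder Dom] [Finite S.Pred]
    {lev : RelAtom S (Const Dom) → ℕ∞} (hfin : {f | lev f ≠ ⊤}.Finite)
    {P : KDTrigger S Dom → Prop} (hP : ∀ τ, P τ → lev τ.fact₁ ≠ ⊤ ∧ lev τ.fact₂ ≠ ⊤)
    {τ : KDTrigger S Dom} (hτ : P τ) : ∃ τ, First lev P τ := by
  have hK : Finite (KeyDep S) := by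
    have : Function.Injective
        (fun κ : KeyDep S => (⟨κ.rel, κ.attrs⟩ : (p : S.Pred) × Finset (Fin (S.arity p)))) := by
      rintro ⟨p, a⟩ ⟨p', b⟩ h
      simpa using h
    exact Finite.of_injective _ this
  have hset : {τ | P τ}.Finite := by
    refine Set.Finite.of_injOn (f := fun τ : KDTrigger S Dom => (τ.fact₁, τ.fact₂, τ.dep))
      (t := {f | lev f ≠ ⊤} ×ˢ ({f | lev f ≠ ⊤} ×ˢ Set.univ)) ?_ ?_
      (hfin.prod (hfin.prod Set.finite_univ))
    · intro τ h
      exact ⟨(hP τ h).1, (hP τ h).2, trivial⟩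
    · intro τ _ τ' _ h
      simp only [Prod.mk.injEq] at h
      exact ext_facts h.1 h.2.1 h.2.2
  obtain ⟨τ₀, h₀, hmin⟩ := Set.exists_min_image _ (fun τ => τ.rank lev) hset ⟨τ, hτ⟩
  exact ⟨τ₀, h₀, hmin⟩

/-- A rank consists of levels, which the embedding preserves, and of keys, whose lexicographic
comparison only depends on the order of the constants. -/
theorem rank_le_of_map [LinearOrder S.Pred] [LinearOrder Dom] {W : Set (Const Dom)}
    {ρ : Const Dom → Const Dom} (h : StrictMonoOn ρ W) {lev lev' : RelAtom S (Const Dom) → ℕ∞}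
    (hlev : ∀ f : RelAtom S (Const Dom), (∀ i, f.args i ∈ W) → lev (f.map ρ) = lev' f)
    {τ τ' : KDTrigger S Dom} (h₁ : ∀ i, τ.fst i ∈ W) (h₂ : ∀ i, τ.snd i ∈ W)
    (h₁' : ∀ i, τ'.fst i ∈ W) (h₂' : ∀ i, τ'.snd i ∈ W)
    (hle : (τ.map ρ).rank lev ≤ (τ'.map ρ).rank lev) : τ.rank lev' ≤ τ'.rank lev' := by
  have el : ∀ τ : KDTrigger S Dom, (∀ i, τ.fst i ∈ W) → (∀ i, τ.snd i ∈ W) →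
      (τ.map ρ).level lev = τ.level lev' := fun τ h₁ h₂ => by
    rw [level, level, ← hlev τ.fact₁ h₁, ← hlev τ.fact₂ h₂]; rfl
  have ea : ∀ τ : KDTrigger S Dom, (τ.map ρ).fact₁ = τ.fact₁.map ρ := fun _ => rfl
  have eb : ∀ τ : KDTrigger S Dom, (τ.map ρ).fact₂ = τ.fact₂.map ρ := fun _ => rfl
  have ec : ∀ τ : KDTrigger S Dom, (τ.map ρ).dep = τ.dep := fun _ => rfl
  simp only [rank, Prod.Lex.toLex_le_toLex] at hle ⊢
  rw [el τ h₁ h₂, el τ' h₁' h₂', ea, ea, eb, eb, ec, ec,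
    RelAtom.key_map_lt_iff h (f := τ.fact₁) (g := τ'.fact₁) h₁ h₁',
    RelAtom.key_map_lt_iff h (f := τ.fact₂) (g := τ'.fact₂) h₂ h₂',
    RelAtom.key_map_eq_iff h (f := τ.fact₁) (g := τ'.fact₁) h₁ h₁',
    RelAtom.key_map_eq_iff h (f := τ.fact₂) (g := τ'.fact₂) h₂ h₂'] at hle
  exact hle

end KDTrigger

namespace IDTrigger

variable {S : RelSchema} {Dom : Type*}

/-- Apply a map of constants to the tuple. -/
def map (ρ : Const Dom → Const Dom) (τ : IDTrigger S Dom) : IDTrigger S Dom :=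
  ⟨τ.dep, ρ ∘ τ.tup⟩

theorem First.unique [LinearOrder S.Pred] [LinearOrder Dom] {lev : RelAtom S (Const Dom) → ℕ∞}
    {P : IDTrigger S Dom → Prop} {τ τ' : IDTrigger S Dom} (h : First lev P τ)
    (h' : First lev P τ') : τ = τ' := by
  have e := le_antisymm (h.2 τ' h'.1) (h'.2 τ h.1)
  simp only [rank, EmbeddingLike.apply_eq_iff_eq, Prod.mk.injEq] at e
  obtain ⟨d, a⟩ := τ
  obtain ⟨d', a'⟩ := τ'
  obtain rfl : d = d' := InclDep.key_injective e.2.2.2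
  have e' := RelAtom.key_injective e.2.2.1
  simp only [fact, RelAtom.mk.injEq, heq_eq_eq, true_and] at e'
  rw [e']

theorem rank_le_of_map [LinearOrder S.Pred] [LinearOrder Dom] {W : Set (Const Dom)}
    {ρ : Const Dom → Const Dom} (h : StrictMonoOn ρ W) {lev lev' : RelAtom S (Const Dom) → ℕ∞}
    (hlev : ∀ f : RelAtom S (Const Dom), (∀ i, f.args i ∈ W) → lev (f.map ρ) = lev' f)
    {τ τ' : IDTrigger S Dom} (h₁ : ∀ i, τ.tup i ∈ W) (h₁' : ∀ i, τ'.tup i ∈ W)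
    (hle : (τ.map ρ).rank lev ≤ (τ'.map ρ).rank lev) : τ.rank lev' ≤ τ'.rank lev' := by
  have ea : ∀ τ : IDTrigger S Dom, (τ.map ρ).fact = τ.fact.map ρ := fun _ => rfl
  have ec : ∀ τ : IDTrigger S Dom, (τ.map ρ).dep = τ.dep := fun _ => rfl
  simp only [rank, Prod.Lex.toLex_le_toLex] at hle ⊢
  rw [ea, ea, ec, ec, hlev τ.fact h₁, hlev τ'.fact h₁',
    RelAtom.key_map_lt_iff h (f := τ.fact) (g := τ'.fact) h₁ h₁',
    RelAtom.key_map_eq_iff h (f := τ.fact) (g := τ'.fact) h₁ h₁'] at hle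
  exact hle

end IDTrigger

/-! ## Embeddings of levelled sets of atoms -/

section Embedding

variable {S : RelSchema} {Dom : Type*}

/-- The constant `c` occurs in an atom that is present, i.e. of level less than `⊤`. -/
def Active (L : RelAtom S (Const Dom) → ℕ∞) (c : Const Dom) : Prop :=
  ∃ f, L f ≠ ⊤ ∧ ∃ i, f.args i = c

theorem Active.of_mem {L : RelAtom S (Const Dom) → ℕ∞} {f : RelAtom S (Const Dom)} (h : L f ≠ ⊤)
    (i : Fin (S.arity f.pred)) : Active L (f.args i) := ⟨f, h, i, rfl⟩

/-- The constants of a database. -/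
def constsOf (D : Finset (RelAtom S (Const Dom))) : Set (Const Dom) :=
  {c | ∃ f ∈ D, ∃ i, f.args i = c}

theorem constsOf_finite {S : RelSchema} {Dom : Type*} (D : Finset (RelAtom S (Const Dom))) :
    (constsOf D).Finite := by
  have : constsOf D = ⋃ f ∈ D, Set.range f.args := by ext; simp [constsOf]
  rw [this]
  exact D.finite_toSet.biUnion fun f _ => Set.finite_range _

/-- The labels of constants are the same within each present atom. -/
def Labelled {Λ : Type*} (L : RelAtom S (Const Dom) → ℕ∞) (lam : Const Dom → Λ) : Prop :=
  ∀ f, L f ≠ ⊤ → ∀ i j, lam (f.args i) = lam (f.args j)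

theorem Labelled.update {Λ : Type*} {L : RelAtom S (Const Dom) → ℕ∞} {lam lam' : Const Dom → Λ}
    (h : Labelled L lam) (heq : ∀ c, Active L c → lam' c = lam c)
    {N : RelAtom S (Const Dom) → Prop} [DecidablePred N]
    (hN : ∀ f, N f → ∀ i j, lam' (f.args i) = lam' (f.args j)) (ℓ : ℕ∞) :
    Labelled (fun g => if N g then ℓ else L g) lam' := by
  intro f hf i j
  by_cases hn : N f
  · exact hN f hn i j
  · simp only [hn, if_false] at hf
    rw [heq _ (Active.of_mem hf i), heq _ (Active.of_mem hf j), h f hf i j]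

variable [LinearOrder Dom]

/-- `ρ` embeds the constants in `W`: it preserves their order and the distinction between
fresh and non-fresh constants, and fixes the constants in `Q`. -/
structure ConstEmb (Q : Set Dom) (W : Set (Const Dom)) (ρ : Const Dom → Const Dom) : Prop where
  strictMono : StrictMonoOn ρ W
  isDom : ∀ c ∈ W, (∃ d, ρ c = Const.dom d) ↔ ∃ d, c = Const.dom d
  fix : ∀ d ∈ Q, ∀ c ∈ W, ρ c = Const.dom d ↔ c = Const.dom d

/-- `ρ` identifies the atoms with levels `L'` with those atoms with levels `L` whose constants lie
in `P`. -/
structure LevelEmb (Q : Set Dom) (P W : Set (Const Dom)) (ρ : Const Dom → Const Dom)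
    (L L' : RelAtom S (Const Dom) → ℕ∞) : Prop extends ConstEmb Q W ρ where
  mapsTo : ∀ c ∈ W, ρ c ∈ P
  active : ∀ c, Active L' c → c ∈ W
  cover : ∀ c, Active L c → c ∈ P → c ∈ ρ '' W
  lev_eq : ∀ f : RelAtom S (Const Dom), (∀ i, f.args i ∈ W) → L (f.map ρ) = L' f

/-- A level embedding together with bounds for the fresh constants. -/
structure Sim (Q : Set Dom) (P W : Set (Const Dom)) (ρ : Const Dom → Const Dom)
    (L : RelAtom S (Const Dom) → ℕ∞) (m : ℕ) (L' : RelAtom S (Const Dom) → ℕ∞) (m' : ℕ) : Prop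
    extends LevelEmb Q P W ρ L L' where
  lt : ∀ c ∈ W, ∀ k, ρ c = Const.fresh k → k < m
  lt' : ∀ k, Const.fresh k ∈ W → k < m'

namespace LevelEmb

variable {Q : Set Dom} {P W : Set (Const Dom)} {ρ : Const Dom → Const Dom}
  {L L' : RelAtom S (Const Dom) → ℕ∞}

theorem lift_args (h : LevelEmb Q P W ρ L L') {m : ℕ} {t : Fin m → Const Dom}
    (ht : ∀ i, Active L (t i)) (hP : ∀ i, t i ∈ P) : ∃ u, (∀ i, u i ∈ W) ∧ ρ ∘ u = t := by
  choose u hu hut using fun i => h.cover _ (ht i) (hP i)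
  exact ⟨u, hu, funext hut⟩

theorem lift (h : LevelEmb Q P W ρ L L') {f : RelAtom S (Const Dom)} (hf : L f ≠ ⊤)
    (hP : ∀ i, f.args i ∈ P) : ∃ g, (∀ i, g.args i ∈ W) ∧ g.map ρ = f ∧ L' g ≠ ⊤ := by
  obtain ⟨u, hu, hut⟩ := h.lift_args (fun i => Active.of_mem hf i) hP
  obtain ⟨p, a⟩ := f
  have hm : (⟨p, u⟩ : RelAtom S (Const Dom)).map ρ = ⟨p, a⟩ := congrArg (RelAtom.mk p) hut
  exact ⟨⟨p, u⟩, hu, hm, by rw [← h.lev_eq ⟨p, u⟩ hu, hm]; exact hf⟩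

theorem mem_of_ne_top (h : LevelEmb Q P W ρ L L') {f : RelAtom S (Const Dom)} (hf : L' f ≠ ⊤)
    (i : Fin (S.arity f.pred)) : f.args i ∈ W := h.active _ (Active.of_mem hf i)

theorem map_ne_top (h : LevelEmb Q P W ρ L L') {f : RelAtom S (Const Dom)} (hf : L' f ≠ ⊤) :
    L (f.map ρ) ≠ ⊤ := by
  rwa [h.lev_eq f (h.mem_of_ne_top hf)]

open Classical in
-- Except for the merging of constants, every rule gives one level `ℓ` to a set `N` of atoms. Atoms
-- over `W'` that contain a constant outside `W` are absent on both sides before the step, by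
-- `active` and `hnew`, so only the correspondence of `N` and `N'` has to be checked. With `N'`
-- empty this covers the steps at which the smaller chase rests.
theorem update (h : LevelEmb Q P W ρ L L') {P' W' : Set (Const Dom)} {ρ' : Const Dom → Const Dom}
    (emb : ConstEmb Q W' ρ') (hW : W ⊆ W') (hρ : ∀ c ∈ W, ρ' c = ρ c) (maps : ∀ c ∈ W', ρ' c ∈ P')
    (hP : ∀ c, Active L c → c ∈ P' → c ∈ P) (hnew : ∀ c ∈ W', c ∉ W → ¬ Active L (ρ' c))
    {N N' : RelAtom S (Const Dom) → Prop}
    (hN : ∀ f : RelAtom S (Const Dom), (∀ i, f.args i ∈ W') → (N (f.map ρ') ↔ N' f))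
    (hact : ∀ f, N' f → ∀ i, f.args i ∈ W')
    (hcov : ∀ f, N f → ∀ i, f.args i ∈ P' → f.args i ∈ ρ' '' W') (ℓ : ℕ∞) :
    LevelEmb Q P' W' ρ' (fun g => if N g then ℓ else L g) (fun g => if N' g then ℓ else L' g) where
  toConstEmb := emb
  mapsTo := maps
  active := by
    rintro c ⟨f, hf, i, rfl⟩
    by_cases hn : N' f
    · exact hact f hn i
    · simp only [hn, if_false] at hf
      exact hW (h.mem_of_ne_top hf i)
  cover := by
    rintro c ⟨f, hf, i, rfl⟩ hc
    by_cases hn : N f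
    · exact hcov f hn i hc
    · simp only [hn, if_false] at hf
      have ha := Active.of_mem hf i
      obtain ⟨w, hw, hwe⟩ := h.cover _ ha (hP _ ha hc)
      exact ⟨w, hW hw, by rw [hρ w hw, hwe]⟩
  lev_eq := by
    intro f hf
    simp only [hN f hf]
    split_ifs
    · rfl
    by_cases hw : ∀ i, f.args i ∈ W
    · rw [← h.lev_eq f hw, RelAtom.map_congr fun i => hρ _ (hw i)]
    · have h₁ : L' f = ⊤ := by
        by_contra hne
        exact hw (h.mem_of_ne_top hne)
      have h₂ : L (f.map ρ') = ⊤ := by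
        by_contra hne
        push Not at hw
        obtain ⟨i, hi⟩ := hw
        exact hnew _ (hf i) hi (Active.of_mem hne i)
      rw [h₁, h₂]

end LevelEmb

end Embedding

/-! ## New fresh constants -/

section ExtendFresh

variable {Dom : Type*}

/-- Extend a map of constants to the fresh constants from index `m'` on, which are sent to those
from index `m` on. -/
def extendFresh (ρ : Const Dom → Const Dom) (m' m : ℕ) (c : Const Dom) : Const Dom :=
  Sum.elim (fun d => ρ (Const.dom d))
    (fun k => if k < m' then ρ (Const.fresh k) else Const.fresh (m + (k - m'))) (ofLex c)

theorem extendFresh_add (ρ : Const Dom → Const Dom) (m' m j : ℕ) :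
    extendFresh ρ m' m (Const.fresh (m' + j)) = Const.fresh (m + j) := by
  simp [extendFresh, Const.fresh]

theorem extendFresh_of_lt {ρ : Const Dom → Const Dom} {m' m : ℕ} {c : Const Dom}
    (h : ∀ k, c = Const.fresh k → k < m') : extendFresh ρ m' m c = ρ c := by
  rcases c.eq_dom_or_eq_fresh with ⟨d, rfl⟩ | ⟨k, rfl⟩
  · rfl
  · simp [extendFresh, Const.fresh] at h ⊢
    simp [h]

/-- Add the `a` fresh constants from index `m'` on. -/
def addFresh (W : Set (Const Dom)) (m' a : ℕ) : Set (Const Dom) :=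
  {c | c ∈ W ∨ ∃ j < a, c = Const.fresh (m' + j)}

/-- The bounds `m` and `m'` place the new fresh constants after everything in the image and after
everything in `W`, so appending them in the same order keeps the map strictly monotone. -/
theorem ConstEmb.extendFresh [LinearOrder Dom] {Q : Set Dom} {W : Set (Const Dom)}
    {ρ : Const Dom → Const Dom} (h : ConstEmb Q W ρ) {m m' : ℕ}
    (lt : ∀ c ∈ W, ∀ k, ρ c = Const.fresh k → k < m) (lt' : ∀ k, Const.fresh k ∈ W → k < m')
    (a : ℕ) : ConstEmb Q (addFresh W m' a) (extendFresh ρ m' m) := by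
  have hW : ∀ c ∈ W, _root_.extendFresh ρ m' m c = ρ c := fun c hc =>
    extendFresh_of_lt fun k hk => lt' k (hk ▸ hc)
  have lt_of : ∀ c ∈ W, ∀ j, ρ c < Const.fresh (m + j) := by
    intro c hc j
    rcases (ρ c).eq_dom_or_eq_fresh with ⟨d, hd⟩ | ⟨k, hk⟩
    · rw [hd]; exact Const.dom_lt_fresh _ _
    · rw [hk, Const.fresh_lt_fresh]
      exact Nat.lt_add_right _ (lt c hc k hk)
  have lt_of' : ∀ c ∈ W, ∀ j, c < Const.fresh (m' + j) := by
    intro c hc j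
    rcases c.eq_dom_or_eq_fresh with ⟨d, rfl⟩ | ⟨k, rfl⟩
    · exact Const.dom_lt_fresh _ _
    · rw [Const.fresh_lt_fresh]
      exact Nat.lt_add_right _ (lt' k hc)
  refine ⟨?_, ?_, ?_⟩
  · rintro c (hc | ⟨j, -, rfl⟩) c' (hc' | ⟨j', -, rfl⟩) hlt
    · rw [hW c hc, hW c' hc']
      exact h.strictMono hc hc' hlt
    · rw [hW c hc, extendFresh_add]
      exact lt_of c hc j'
    · exact absurd hlt (lt_of' c' hc' j).not_gt
    · rw [extendFresh_add, extendFresh_add]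
      rw [Const.fresh_lt_fresh] at hlt ⊢
      omega
  · rintro c (hc | ⟨j, -, rfl⟩)
    · rw [hW c hc]; exact h.isDom c hc
    · rw [extendFresh_add]
      exact iff_of_false (fun ⟨d, hd⟩ => Const.dom_ne_fresh _ _ hd.symm)
        (fun ⟨d, hd⟩ => Const.dom_ne_fresh _ _ hd.symm)
  · rintro d hd c (hc | ⟨j, -, rfl⟩)
    · rw [hW c hc]; exact h.fix d hd c hc
    · rw [extendFresh_add]
      exact iff_of_false (Const.dom_ne_fresh _ _).symm (Const.dom_ne_fresh _ _).symm

theorem InclDep.newTuple_map {S : RelSchema} (σ : InclDep S) {ρ : Const Dom → Const Dom}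
    {t : Fin (S.arity σ.src) → Const Dom} {m m' : ℕ} (h : ∀ i k, t i = Const.fresh k → k < m') :
    extendFresh ρ m' m ∘ σ.newTuple t m' = σ.newTuple (ρ ∘ t) m := by
  funext j
  simp only [newTuple, Function.comp]
  split_ifs with hj
  · exact extendFresh_of_lt (h _)
  · exact extendFresh_add ρ m' m j

theorem InclDep.newTuple_tgtPos {S : RelSchema} (σ : InclDep S) (hσ : Function.Injective σ.tgtPos)
    (t : Fin (S.arity σ.src) → Const Dom) (m : ℕ) (i : Fin σ.width) :
    σ.newTuple t m (σ.tgtPos i) = t (σ.srcPos i) := by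
  have h : ∃ i', σ.tgtPos i' = σ.tgtPos i := ⟨i, rfl⟩
  rw [newTuple, dif_pos h, hσ h.choose_spec]

theorem InclDep.newTuple_cases {S : RelSchema} (σ : InclDep S)
    (t : Fin (S.arity σ.src) → Const Dom) (m : ℕ) (j : Fin (S.arity σ.tgt)) :
    (∃ i, σ.newTuple t m j = t i) ∨
      (j ∉ Set.range σ.tgtPos ∧ σ.newTuple t m j = Const.fresh (m + j)) := by
  by_cases h : ∃ i, σ.tgtPos i = j
  · exact Or.inl ⟨σ.srcPos h.choose, dif_pos h⟩
  · exact Or.inr ⟨h, dif_neg h⟩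

open Classical in
/-- Give the label `ℓ` to the fresh constants from index `m` on. -/
noncomputable def withLabel {Λ : Type*} (lam : Const Dom → Λ) (m : ℕ) (ℓ : Λ) (c : Const Dom) : Λ :=
  if ∃ j, c = Const.fresh (m + j) then ℓ else lam c

theorem withLabel_of_lt {Λ : Type*} {lam : Const Dom → Λ} {m : ℕ} {ℓ : Λ} {c : Const Dom}
    (h : ∀ k, c = Const.fresh k → k < m) : withLabel lam m ℓ c = lam c := by
  refine if_neg ?_
  rintro ⟨j, hj⟩
  have := h _ hj
  omega

theorem withLabel_add {Λ : Type*} (lam : Const Dom → Λ) (m : ℕ) (ℓ : Λ) (j : ℕ) :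
    withLabel lam m ℓ (Const.fresh (m + j)) = ℓ := if_pos ⟨j, rfl⟩

theorem withLabel_newTuple {S : RelSchema} {Λ : Type*} (σ : InclDep S) {lam : Const Dom → Λ} {m : ℕ}
    {ℓ : Λ} {t : Fin (S.arity σ.src) → Const Dom} (h : ∀ i k, t i = Const.fresh k → k < m)
    (hℓ : ∀ i, lam (t i) = ℓ) (j : Fin (S.arity σ.tgt)) :
    withLabel lam m ℓ (σ.newTuple t m j) = ℓ := by
  rcases σ.newTuple_cases t m j with ⟨i, hi⟩ | ⟨-, hj⟩
  · rw [hi, withLabel_of_lt (h i), hℓ]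
  · rw [hj, withLabel_add]

end ExtendFresh

/-- The properties of conceptual dependencies on which the simulation of chases relies. -/
structure TameDeps {S : RelSchema} (I : Set (InclDep S)) (K : Set (KeyDep S)) : Prop where
  arity_pos : ∀ p, 0 < S.arity p
  width_pos : ∀ σ ∈ I, 0 < σ.width
  tgtPos_injective : ∀ σ ∈ I, Function.Injective σ.tgtPos
  attrs_nonempty : ∀ κ ∈ K, κ.attrs.Nonempty

/-! ## Unifiers -/

section Unifier

variable {Dom : Type*} [LinearOrder Dom]

theorem combine_eq_some {a b : Const Dom} {σ : Const Dom → Const Dom}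
    (h : combine a b = some σ) :
    (a = b ∧ σ = id) ∨ (a ≠ b ∧ (¬ ∃ c d, a = Const.dom c ∧ b = Const.dom d) ∧
      ∀ c, (c = a ∨ c = b) ∧ σ c = min a b ∨ (c ≠ a ∧ c ≠ b) ∧ σ c = c) := by
  unfold combine at h
  split_ifs at h with h₁ h₂
  · exact Or.inl ⟨h₁, (Option.some.inj h).symm⟩
  · refine Or.inr ⟨h₁, h₂, fun c => ?_⟩
    rw [← Option.some.inj h]
    by_cases hc : c = a ∨ c = b
    · exact Or.inl ⟨hc, if_pos hc⟩
    · exact Or.inr ⟨not_or.1 hc, if_neg hc⟩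

theorem foldlM_combine_induction {m : ℕ} {t u : Fin m → Const Dom}
    {M : (Const Dom → Const Dom) → Prop}
    (hstep : ∀ σ i ρ, M σ → combine (σ (t i)) (σ (u i)) = some ρ → M (ρ ∘ σ)) :
    ∀ (l : List (Fin m)) (σ₀ σ : Const Dom → Const Dom), M σ₀ →
      l.foldlM (fun σ i => (combine (σ (t i)) (σ (u i))).map fun ρ => ρ ∘ σ) σ₀ = some σ → M σ
  | [], σ₀, σ, h₀, h => by
    simp only [List.foldlM_nil, Option.pure_def, Option.some.injEq] at h
    exact h ▸ h₀
  | i :: l, σ₀, σ, h₀, h => by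
    rw [List.foldlM_cons, Option.bind_eq_bind, Option.bind_eq_some_iff] at h
    obtain ⟨σ₁, h₁, h₂⟩ := h
    obtain ⟨ρ, hρ, rfl⟩ := Option.map_eq_some_iff.1 h₁
    exact foldlM_combine_induction hstep l _ σ (hstep _ _ _ h₀ hρ) h₂

theorem unifier_induction {m : ℕ} {t u : Fin m → Const Dom} {M : (Const Dom → Const Dom) → Prop}
    (hid : M id) (hstep : ∀ σ i ρ, M σ → combine (σ (t i)) (σ (u i)) = some ρ → M (ρ ∘ σ))
    {σ : Const Dom → Const Dom} (h : unifier t u = some σ) : M σ :=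
  foldlM_combine_induction hstep _ _ _ hid h

/-- Two distinct non-fresh constants are never merged, and a fresh partner comes later in the order,
so the minimum is the non-fresh constant. -/
theorem combine_dom {a b : Const Dom} {σ : Const Dom → Const Dom} (h : combine a b = some σ)
    (d : Dom) : σ (Const.dom d) = Const.dom d := by
  rcases combine_eq_some h with ⟨-, rfl⟩ | ⟨-, hnd, hc⟩
  · rfl
  · rcases hc (Const.dom d) with ⟨h₁, h₂⟩ | ⟨-, h₂⟩
    · rw [h₂]
      rcases h₁ with rfl | rfl
      · rcases b.eq_dom_or_eq_fresh with ⟨e, rfl⟩ | ⟨k, rfl⟩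
        · exact absurd ⟨d, e, rfl, rfl⟩ hnd
        · exact inf_of_le_left (le_of_lt (α := Const Dom) (Const.dom_lt_fresh _ _))
      · rcases a.eq_dom_or_eq_fresh with ⟨e, rfl⟩ | ⟨k, rfl⟩
        · exact absurd ⟨e, d, rfl, rfl⟩ hnd
        · exact inf_of_le_right (le_of_lt (α := Const Dom) (Const.dom_lt_fresh _ _))
    · exact h₂

theorem combine_le {a b : Const Dom} {σ : Const Dom → Const Dom} (h : combine a b = some σ)
    (c : Const Dom) : σ c ≤ c := by
  rcases combine_eq_some h with ⟨-, rfl⟩ | ⟨-, -, hc⟩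
  · exact le_rfl
  · rcases hc c with ⟨rfl | rfl, h₂⟩ | ⟨-, h₂⟩
    · rw [h₂]; exact inf_le_left
    · rw [h₂]; exact inf_le_right
    · exact h₂.le

theorem unifier_dom {m : ℕ} {t u : Fin m → Const Dom} {σ : Const Dom → Const Dom}
    (h : unifier t u = some σ) (d : Dom) : σ (Const.dom d) = Const.dom d := by
  revert d
  refine unifier_induction (M := fun σ => ∀ d, σ (Const.dom d) = Const.dom d) (fun _ => rfl) ?_ h
  intro σ i ρ hσ hρ d
  rw [Function.comp, hσ, combine_dom hρ]

theorem unifier_le {m : ℕ} {t u : Fin m → Const Dom} {σ : Const Dom → Const Dom}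
    (h : unifier t u = some σ) (c : Const Dom) : σ c ≤ c := by
  revert c
  refine unifier_induction (M := fun σ => ∀ c, σ c ≤ c) (fun _ => le_rfl) ?_ h
  intro σ i ρ hσ hρ c
  exact (combine_le hρ _).trans (hσ c)

theorem combine_mem_or {a b : Const Dom} {σ : Const Dom → Const Dom} (h : combine a b = some σ)
    {A : Set (Const Dom)} (ha : a ∈ A) (hb : b ∈ A) (c : Const Dom) :
    (c ∈ A → σ c ∈ A) ∧ (c ∉ A → σ c = c) := by
  rcases combine_eq_some h with ⟨-, rfl⟩ | ⟨-, -, hc⟩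
  · exact ⟨id, fun _ => rfl⟩
  · rcases hc c with ⟨h₁, h₂⟩ | ⟨-, h₂⟩
    · rw [h₂]
      refine ⟨fun _ => ?_, fun hcA => ?_⟩
      · rcases le_total a b with h | h <;> simpa only [h, inf_of_le_left, inf_of_le_right]
      · rcases h₁ with rfl | rfl <;> contradiction
    · rw [h₂]; exact ⟨id, fun _ => rfl⟩

/-- A unifier of tuples over `A` maps `A` into itself and is the identity elsewhere. -/
theorem unifier_mem_or {m : ℕ} {t u : Fin m → Const Dom} {σ : Const Dom → Const Dom}
    (h : unifier t u = some σ) {A : Set (Const Dom)} (ht : ∀ i, t i ∈ A) (hu : ∀ i, u i ∈ A)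
    (c : Const Dom) : (c ∈ A → σ c ∈ A) ∧ (c ∉ A → σ c = c) := by
  revert c
  refine unifier_induction (M := fun σ => ∀ c, (c ∈ A → σ c ∈ A) ∧ (c ∉ A → σ c = c))
    (fun _ => ⟨id, fun _ => rfl⟩) ?_ h
  intro σ i ρ hσ hρ c
  have hρ := combine_mem_or hρ ((hσ _).1 (ht i)) ((hσ _).1 (hu i))
  refine ⟨fun hc => (hρ _).1 ((hσ c).1 hc), fun hc => ?_⟩
  rw [Function.comp, (hσ c).2 hc, (hρ c).2 hc]

/-- A merge keeps the minimum and fails on distinct non-fresh constants. Both are expressed by what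
`ConstEmb` preserves. -/
theorem combine_map {Q : Set Dom} {W : Set (Const Dom)} {ρ : Const Dom → Const Dom}
    (h : ConstEmb Q W ρ) {a b : Const Dom} (ha : a ∈ W) (hb : b ∈ W) {σ : Const Dom → Const Dom}
    (hσ : combine (ρ a) (ρ b) = some σ) :
    ∃ σ', combine a b = some σ' ∧ ∀ c ∈ W, σ' c ∈ W ∧ σ (ρ c) = ρ (σ' c) := by
  rcases combine_eq_some hσ with ⟨hab, rfl⟩ | ⟨hab, hnd, hc⟩
  · refine ⟨id, ?_, fun c hc => ⟨hc, rfl⟩⟩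
    rw [combine, if_pos (h.strictMono.injOn ha hb hab)]
  · have hne : a ≠ b := fun e => hab (e ▸ rfl)
    have hnd' : ¬ ∃ c d, a = Const.dom c ∧ b = Const.dom d := by
      rintro ⟨c, d, hac, hbd⟩
      obtain ⟨c', hc'⟩ := (h.isDom a ha).2 ⟨c, hac⟩
      obtain ⟨d', hd'⟩ := (h.isDom b hb).2 ⟨d, hbd⟩
      exact hnd ⟨c', d', hc', hd'⟩
    have hmin : ρ (min a b) = min (ρ a) (ρ b) := by
      rcases le_total a b with hle | hle
      · rw [inf_of_le_left hle, inf_of_le_left ((h.strictMono.le_iff_le ha hb).2 hle)]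
      · rw [inf_of_le_right hle, inf_of_le_right ((h.strictMono.le_iff_le hb ha).2 hle)]
    have hmem : min a b ∈ W := by
      rcases le_total a b with h | h <;> simpa only [h, inf_of_le_left, inf_of_le_right]
    refine ⟨_, by rw [combine, if_neg hne, if_neg hnd'], fun c hcW => ?_⟩
    have e₁ := h.strictMono.injOn.eq_iff hcW ha
    have e₂ := h.strictMono.injOn.eq_iff hcW hb
    rcases hc (ρ c) with ⟨h₁, h₂⟩ | ⟨⟨h₁, h₁'⟩, h₂⟩
    · rw [e₁, e₂] at h₁
      simp only [if_pos h₁]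
      exact ⟨hmem, by rw [h₂, hmin]⟩
    · rw [Ne, e₁] at h₁
      rw [Ne, e₂] at h₁'
      simp only [h₁, h₁', or_self, if_false]
      exact ⟨hcW, h₂⟩

/-- The two folds run in parallel, with `W` kept invariant. Success on the images forces success on
the originals, so the smaller chase cannot fail at a step at which the larger one succeeds. -/
theorem unifier_map {Q : Set Dom} {W : Set (Const Dom)} {ρ : Const Dom → Const Dom}
    (h : ConstEmb Q W ρ) {m : ℕ} {t u : Fin m → Const Dom} (ht : ∀ i, t i ∈ W)
    (hu : ∀ i, u i ∈ W) {σ : Const Dom → Const Dom} (hσ : unifier (ρ ∘ t) (ρ ∘ u) = some σ) :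
    ∃ σ', unifier t u = some σ' ∧ ∀ c ∈ W, σ' c ∈ W ∧ σ (ρ c) = ρ (σ' c) := by
  suffices H : ∀ (l : List (Fin m)) (σ₀ σ₀' σ : Const Dom → Const Dom),
      (∀ c ∈ W, σ₀' c ∈ W ∧ σ₀ (ρ c) = ρ (σ₀' c)) →
      l.foldlM (fun σ i => (combine (σ ((ρ ∘ t) i)) (σ ((ρ ∘ u) i))).map fun ρ => ρ ∘ σ) σ₀
        = some σ →
      ∃ σ', l.foldlM (fun σ i => (combine (σ (t i)) (σ (u i))).map fun ρ => ρ ∘ σ) σ₀' = some σ' ∧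
        ∀ c ∈ W, σ' c ∈ W ∧ σ (ρ c) = ρ (σ' c) from
    H _ id id σ (fun c hc => ⟨hc, rfl⟩) hσ
  intro l
  induction l with
  | nil =>
    intro σ₀ σ₀' σ h₀ hσ
    simp only [List.foldlM_nil, Option.pure_def, Option.some.injEq] at hσ ⊢
    exact ⟨σ₀', rfl, hσ ▸ h₀⟩
  | cons i l ih =>
    intro σ₀ σ₀' σ h₀ hσ
    rw [List.foldlM_cons, Option.bind_eq_bind, Option.bind_eq_some_iff] at hσ
    obtain ⟨σ₁, h₁, h₂⟩ := hσ
    obtain ⟨τ, hτ, rfl⟩ := Option.map_eq_some_iff.1 h₁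
    simp only [Function.comp, (h₀ _ (ht i)).2, (h₀ _ (hu i)).2] at hτ
    obtain ⟨τ', hτ', hc⟩ := combine_map h (h₀ _ (ht i)).1 (h₀ _ (hu i)).1 hτ
    obtain ⟨σ', hσ', hσc⟩ := ih (τ ∘ σ₀) (τ' ∘ σ₀') σ (fun c hcW => by
      refine ⟨(hc _ (h₀ c hcW).1).1, ?_⟩
      simp only [Function.comp]
      rw [(h₀ c hcW).2, (hc _ (h₀ c hcW).1).2]) h₂
    refine ⟨σ', ?_, hσc⟩
    rw [List.foldlM_cons, hτ', Option.map_some, Option.bind_eq_bind, Option.bind_some]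
    exact hσ'

end Unifier

/-! ## Initial states -/

theorem lt_firstFresh {S : RelSchema} {Dom : Type*} (D : Finset (RelAtom S (Const Dom))) {k : ℕ}
    (h : Const.fresh k ∈ constsOf D) : k < firstFresh D := by
  -- The infimum in `firstFresh` has its intended meaning only for a nonempty set; finiteness of the
  -- fresh constants of `D` provides an element.
  have hne : {m | ∀ f ∈ D, ∀ i k, f.args i = Const.fresh k → k < m}.Nonempty := by
    have hfin : {k : ℕ | Const.fresh k ∈ constsOf D}.Finite :=
      (constsOf_finite D).preimage Const.fresh_injective.injOn
    obtain ⟨b, hb⟩ := hfin.bddAbove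
    refine ⟨b + 1, fun f hf i k hk => Nat.lt_succ_of_le (hb ⟨f, hf, i, hk⟩)⟩
  obtain ⟨f, hf, i, hi⟩ := h
  exact Nat.sInf_mem hne f hf i k hi

/-- `ρ` embeds the database `D'` onto the set of facts `F`. -/
structure DbEmb {S : RelSchema} {Dom : Type*} [LinearOrder Dom] (Q : Set Dom)
    (ρ : Const Dom → Const Dom) (D' : Finset (RelAtom S (Const Dom)))
    (F : Set (RelAtom S (Const Dom))) : Prop extends ConstEmb Q (constsOf D') ρ where
  image : ∀ g, g ∈ F ↔ ∃ f ∈ D', f.map ρ = g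

/-- The facts of `D` whose constants have labels in `T`. -/
def labelled {S : RelSchema} {Dom Λ : Type*} (D : Finset (RelAtom S (Const Dom)))
    (lam : Const Dom → Λ) (T : Set Λ) : Set (RelAtom S (Const Dom)) :=
  {f | f ∈ D ∧ ∀ i, lam (f.args i) ∈ T}

/-- The labels of constants are the same within each fact of the database. -/
def DbLabelled {S : RelSchema} {Dom Λ : Type*} (D : Finset (RelAtom S (Const Dom)))
    (lam : Const Dom → Λ) : Prop :=
  ∀ f ∈ D, ∀ i j, lam (f.args i) = lam (f.args j)

/-! ## Simulation of chases -/

namespace ChaseState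

/-! ### Effect of the chase rules on present facts and active constants -/

section

variable {S : RelSchema} {Dom : Type*}

theorem replace_ne_top {s : ChaseState S Dom} {σ : Const Dom → Const Dom}
    {f : RelAtom S (Const Dom)} : (s.replace σ).lev f ≠ ⊤ ↔ ∃ g, s.lev g ≠ ⊤ ∧ g.map σ = f := by
  simp only [replace, ne_eq, iInf_eq_top, not_forall, Subtype.exists]
  exact ⟨fun ⟨g, h, h'⟩ => ⟨g, h', h⟩, fun ⟨g, h, h'⟩ => ⟨g, h', h⟩⟩

theorem replace_map_le (s : ChaseState S Dom) (σ : Const Dom → Const Dom)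
    (f : RelAtom S (Const Dom)) : (s.replace σ).lev (f.map σ) ≤ s.lev f :=
  iInf_le (fun g : {g : RelAtom S (Const Dom) // g.map σ = f.map σ} => s.lev g) ⟨f, rfl⟩

theorem replace_id (s : ChaseState S Dom) : s.replace id = s := by
  obtain ⟨lev, m⟩ := s
  simp only [replace, mk.injEq, and_true]
  funext f
  refine le_antisymm (iInf_le_of_le ⟨f, rfl⟩ le_rfl) (le_iInf ?_)
  rintro ⟨g, hg⟩
  exact (congrArg lev (show f = g from hg.symm)).le

theorem active_replace {s : ChaseState S Dom} {σ : Const Dom → Const Dom} {c : Const Dom}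
    (h : Active (s.replace σ).lev c) : ∃ c', Active s.lev c' ∧ σ c' = c := by
  obtain ⟨f, hf, i, rfl⟩ := h
  obtain ⟨g, hg, rfl⟩ := replace_ne_top.1 hf
  exact ⟨_, Active.of_mem hg i, rfl⟩

theorem active_applyID {s : ChaseState S Dom} {τ : IDTrigger S Dom} (hτ : s.Has τ.fact)
    {c : Const Dom} (h : Active (s.applyID τ).lev c) :
    Active s.lev c ∨ ∃ j : Fin (S.arity τ.dep.tgt), c = Const.fresh (s.next + j) := by
  obtain ⟨f, hf, i, rfl⟩ := h
  by_cases hn : f = τ.newFact s.next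
  · subst hn
    rcases τ.dep.newTuple_cases τ.tup s.next i with ⟨j, hj⟩ | ⟨-, hj⟩
    · exact Or.inl ⟨_, hτ, j, hj.symm⟩
    · exact Or.inr ⟨i, hj⟩
  · simp only [applyID, hn, if_false] at hf
    exact Or.inl (Active.of_mem hf i)

/-- The new fact would itself witness the dependency. Injectivity of `tgtPos` ensures that each
target position receives the constant that belongs to it. -/
theorem not_has_newFact {I : Set (InclDep S)} {s : ChaseState S Dom} {τ : IDTrigger S Dom}
    (h : s.IDApplicable I τ) (hσ : Function.Injective τ.dep.tgtPos) (m : ℕ) :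
    ¬ s.Has (τ.newFact m) :=
  fun hn => h.2.2 ⟨_, hn, τ.dep.newTuple_tgtPos hσ _ _⟩

end

variable {S : RelSchema} {Dom : Type*} [LinearOrder S.Pred] [LinearOrder Dom]
  {I : Set (InclDep S)} {K : Set (KeyDep S)}

/-! ### Steps of the chase and their invariants -/

theorem step_cases {s s₁ : ChaseState S Dom} (h : step I K s = some s₁) :
    (∃ τ σ, KDTrigger.First s.lev (s.KDApplicable K) τ ∧ unifier τ.fst τ.snd = some σ ∧
      s₁ = s.replace σ) ∨
    (¬ ∃ τ, KDTrigger.First s.lev (s.KDApplicable K) τ) ∧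
      ((∃ τ, IDTrigger.First s.lev (s.IDApplicable I) τ ∧ s₁ = s.applyID τ) ∨ s₁ = s) := by
  unfold step at h
  split_ifs at h with h₁ h₂
  · obtain ⟨σ, hσ, rfl⟩ := Option.map_eq_some_iff.1 h
    exact Or.inl ⟨_, σ, h₁.choose_spec, hσ, rfl⟩
  · exact Or.inr ⟨h₁, Or.inl ⟨_, h₂.choose_spec, (Option.some.inj h).symm⟩⟩
  · exact Or.inr ⟨h₁, Or.inr (Option.some.inj h).symm⟩

theorem step_of_first_KD {s : ChaseState S Dom} {τ : KDTrigger S Dom}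
    (h : KDTrigger.First s.lev (s.KDApplicable K) τ) :
    step I K s = (unifier τ.fst τ.snd).map s.replace := by
  have hex : ∃ τ, KDTrigger.First s.lev (s.KDApplicable K) τ := ⟨τ, h⟩
  rw [step, dif_pos hex, hex.choose_spec.unique h]

theorem step_of_first_ID {s : ChaseState S Dom} {τ : IDTrigger S Dom}
    (hK : ¬ ∃ τ, KDTrigger.First s.lev (s.KDApplicable K) τ)
    (h : IDTrigger.First s.lev (s.IDApplicable I) τ) : step I K s = some (s.applyID τ) := by
  have hex : ∃ τ, IDTrigger.First s.lev (s.IDApplicable I) τ := ⟨τ, h⟩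
  rw [step, dif_neg hK, dif_pos hex, hex.choose_spec.unique h]

/-- This is what carries homomorphisms forward. Merging collapses facts to the lowest of their
levels, so the unifier serves as the map; for other steps the identity does. -/
theorem step_push (tame : TameDeps I K) {s s₁ : ChaseState S Dom} (h : step I K s = some s₁) :
    ∃ σ : Const Dom → Const Dom, (∀ d, σ (Const.dom d) = Const.dom d) ∧ (∀ c, σ c ≤ c) ∧
      ∀ f, s₁.lev (f.map σ) ≤ s.lev f := by
  rcases step_cases h with ⟨τ, σ, -, hσ, rfl⟩ | ⟨-, ⟨τ, hτ, rfl⟩ | rfl⟩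
  · exact ⟨σ, unifier_dom hσ, unifier_le hσ, s.replace_map_le σ⟩
  · refine ⟨id, fun _ => rfl, fun _ => le_rfl, fun f => ?_⟩
    -- The only level that is overwritten is that of an absent fact, so no level rises.
    have hn := not_has_newFact hτ.1 (tame.tgtPos_injective _ hτ.1.1) s.next
    rw [RelAtom.map_id]
    simp only [applyID]
    split_ifs with hf
    · rw [not_not.1 (hf ▸ hn : ¬ s.Has f)]
      exact le_top
    · exact le_rfl
  · exact ⟨id, fun _ => rfl, fun _ => le_rfl, fun f => le_rfl⟩

/-- Basic invariants of the states of the chase of `D`. -/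
structure Inv (D : Finset (RelAtom S (Const Dom))) (s : ChaseState S Dom) : Prop where
  finite : {f | s.lev f ≠ ⊤}.Finite
  fresh_lt : ∀ k, Active s.lev (Const.fresh k) → k < s.next
  dom_mem : ∀ d, Active s.lev (Const.dom d) → Const.dom d ∈ constsOf D

omit [LinearOrder S.Pred] [LinearOrder Dom] in
theorem active_init {D : Finset (RelAtom S (Const Dom))} {c : Const Dom} :
    Active (init D).lev c ↔ c ∈ constsOf D := by
  simp [Active, init, constsOf]

omit [LinearOrder S.Pred] [LinearOrder Dom] in
theorem inv_init (D : Finset (RelAtom S (Const Dom))) : Inv D (init D) where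
  finite := D.finite_toSet.subset fun f hf => by simpa [init] using hf
  fresh_lt k hk := lt_firstFresh D (active_init.1 hk)
  dom_mem d hd := active_init.1 hd

theorem Inv.step {D : Finset (RelAtom S (Const Dom))} {s s₁ : ChaseState S Dom} (hs : Inv D s)
    (h : step I K s = some s₁) : Inv D s₁ := by
  rcases step_cases h with ⟨τ, σ, hτ, hσ, rfl⟩ | ⟨-, ⟨τ, hτ, rfl⟩ | rfl⟩
  · refine ⟨(hs.finite.image (RelAtom.map σ)).subset ?_, ?_, ?_⟩
    · intro f hf
      obtain ⟨g, hg, rfl⟩ := replace_ne_top.1 hf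
      exact ⟨g, hg, rfl⟩
    · intro k hk
      obtain ⟨c, hc, hck⟩ := active_replace hk
      rcases c.eq_dom_or_eq_fresh with ⟨d, rfl⟩ | ⟨j, rfl⟩
      · rw [unifier_dom hσ] at hck
        exact absurd hck (Const.dom_ne_fresh _ _)
      · have := unifier_le hσ (Const.fresh j)
        rw [hck, Const.fresh_le_fresh] at this
        exact this.trans_lt (hs.fresh_lt j hc)
    · intro d hd
      obtain ⟨c, hc, hcd⟩ := active_replace hd
      refine hs.dom_mem d (hcd ▸ (unifier_mem_or hσ (A := {c | Active s.lev c}) ?_ ?_ c).1 hc)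
      · exact Active.of_mem hτ.1.2.1
      · exact Active.of_mem hτ.1.2.2.1
  · refine ⟨(hs.finite.insert (τ.newFact s.next)).subset ?_, ?_, ?_⟩
    · intro f hf
      by_cases hn : f = τ.newFact s.next
      · exact Or.inl hn
      · simp only [applyID, hn, if_false, Set.mem_ofPred_eq] at hf
        exact Or.inr hf
    · intro k hk
      rcases active_applyID hτ.1.2.1 hk with hk | ⟨j, hj⟩
      · exact Nat.lt_add_right _ (hs.fresh_lt k hk)
      · rw [Const.fresh_injective hj]
        exact Nat.add_lt_add_left j.isLt _
    · intro d hd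
      rcases active_applyID hτ.1.2.1 hd with hd | ⟨j, hj⟩
      · exact hs.dom_mem d hd
      · exact absurd hj (Const.dom_ne_fresh _ _)
  · exact hs

/-! ### Transfer of triggers -/

omit [LinearOrder S.Pred] in
-- Levels after a replacement are infima over preimages. By `hP` the preimages of an atom over `ρ ''
-- W` have all their constants in `P`, so the present ones lift to atoms over `W`. The present
-- preimages on the two sides thus correspond, with equal levels.
theorem sim_replace {Q : Set Dom} {P W : Set (Const Dom)} {ρ : Const Dom → Const Dom}
    {s s' : ChaseState S Dom} (h : Sim Q P W ρ s.lev s.next s'.lev s'.next)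
    {σ σ' : Const Dom → Const Dom} (hσ : ∀ c ∈ W, σ' c ∈ W ∧ σ (ρ c) = ρ (σ' c))
    (hP : ∀ c, σ c ∈ P → c ∈ P) :
    Sim Q P W ρ (s.replace σ).lev (s.replace σ).next (s'.replace σ').lev (s'.replace σ').next where
  toConstEmb := h.toConstEmb
  mapsTo := h.mapsTo
  lt := h.lt
  lt' := h.lt'
  active c hc := by
    obtain ⟨c', hc', rfl⟩ := active_replace hc
    exact (hσ c' (h.active _ hc')).1
  cover c hc hcP := by
    obtain ⟨c', hc', rfl⟩ := active_replace hc
    obtain ⟨w, hw, rfl⟩ := h.cover _ hc' (hP _ hcP)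
    exact ⟨σ' w, (hσ w hw).1, ((hσ w hw).2).symm⟩
  lev_eq f hf := by
    have hcomm : ∀ g : RelAtom S (Const Dom), (∀ i, g.args i ∈ W) →
        (g.map ρ).map σ = (g.map σ').map ρ := fun g hg =>
      RelAtom.map_congr (σ := σ ∘ ρ) (τ := ρ ∘ σ') fun i => (hσ _ (hg i)).2
    refine le_antisymm (le_iInf ?_) (le_iInf ?_)
    · rintro ⟨g, rfl⟩
      by_cases hg : s'.lev g = ⊤
      · exact le_top.trans hg.ge
      have hgW := h.mem_of_ne_top hg
      exact iInf_le_of_le ⟨g.map ρ, hcomm g hgW⟩ (h.lev_eq g hgW).le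
    · rintro ⟨g, hgf⟩
      by_cases hg : s.lev g = ⊤
      · exact le_top.trans hg.ge
      have hgP : ∀ i, g.args i ∈ P := by
        obtain ⟨p, a⟩ := g
        obtain ⟨p', b⟩ := f
        simp only [RelAtom.map, RelAtom.mk.injEq] at hgf
        obtain ⟨rfl, hab⟩ := hgf
        intro i
        refine hP _ ?_
        rw [show σ (a i) = ρ (b i) from congrFun (eq_of_heq hab) i]
        exact h.mapsTo _ (hf i)
      obtain ⟨g, hgW, rfl, -⟩ := h.lift hg hgP
      rw [hcomm g hgW] at hgf
      have := RelAtom.map_injOn h.strictMono.injOn (f := g.map σ') (fun i => (hσ _ (hgW i)).1)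
        hf hgf
      exact iInf_le_of_le ⟨g, this⟩ (h.lev_eq g hgW).ge

section Transfer

variable {Q : Set Dom} {P W : Set (Const Dom)} {ρ : Const Dom → Const Dom}
  {s s' : ChaseState S Dom}

theorem kdApplicable_map (h : LevelEmb Q P W ρ s.lev s'.lev) {τ : KDTrigger S Dom}
    (h₁ : ∀ i, τ.fst i ∈ W) (h₂ : ∀ i, τ.snd i ∈ W) :
    s.KDApplicable K (τ.map ρ) ↔ s'.KDApplicable K τ := by
  have e₁ : s.Has (τ.map ρ).fact₁ ↔ s'.Has τ.fact₁ := by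
    rw [Has, Has, ← h.lev_eq τ.fact₁ h₁]; rfl
  have e₂ : s.Has (τ.map ρ).fact₂ ↔ s'.Has τ.fact₂ := by
    rw [Has, Has, ← h.lev_eq τ.fact₂ h₂]; rfl
  have e₃ : (τ.map ρ).fact₁.key < (τ.map ρ).fact₂.key ↔ τ.fact₁.key < τ.fact₂.key :=
    RelAtom.key_map_lt_iff h.strictMono (f := τ.fact₁) (g := τ.fact₂) h₁ h₂
  have e₄ : ∀ i, (τ.map ρ).fst i = (τ.map ρ).snd i ↔ τ.fst i = τ.snd i := fun i =>
    h.strictMono.injOn.eq_iff (h₁ i) (h₂ i)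
  rw [KDApplicable, KDApplicable, e₁, e₂, e₃]
  simp only [e₄]
  rfl

/-- Every competitor in the smaller state is mapped to a competitor in the larger one, so a trigger
that wins above wins below. -/
theorem first_KD_of_map (h : LevelEmb Q P W ρ s.lev s'.lev) {τ : KDTrigger S Dom}
    (h₁ : ∀ i, τ.fst i ∈ W) (h₂ : ∀ i, τ.snd i ∈ W)
    (hτ : KDTrigger.First s.lev (s.KDApplicable K) (τ.map ρ)) :
    KDTrigger.First s'.lev (s'.KDApplicable K) τ := by
  refine ⟨(kdApplicable_map h h₁ h₂).1 hτ.1, fun τ' hτ' => ?_⟩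
  have h₁' := h.mem_of_ne_top hτ'.2.1
  have h₂' := h.mem_of_ne_top hτ'.2.2.1
  exact KDTrigger.rank_le_of_map h.strictMono h.lev_eq h₁ h₂ h₁' h₂'
    (hτ.2 _ ((kdApplicable_map h h₁' h₂').2 hτ'))

omit [LinearOrder S.Pred] in
-- As the width is positive, a witness in the larger state shares a constant with the trigger. Its
-- label then lies in `T`, and it lifts to a witness over `W`: other components cannot satisfy the
-- dependency.
theorem idApplicable_map (tame : TameDeps I K) {Λ : Type*} {lam : Const Dom → Λ} {T : Set Λ}
    (hlam : Labelled s.lev lam) (h : LevelEmb Q {c | lam c ∈ T} W ρ s.lev s'.lev)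
    {τ : IDTrigger S Dom} (h₁ : ∀ i, τ.tup i ∈ W) :
    s.IDApplicable I (τ.map ρ) ↔ s'.IDApplicable I τ := by
  have e₁ : s.Has (τ.map ρ).fact ↔ s'.Has τ.fact := by
    rw [Has, Has, ← h.lev_eq τ.fact h₁]; rfl
  rw [IDApplicable, IDApplicable, e₁]
  refine and_congr_right fun hI => and_congr_right fun _ => not_congr ⟨?_, ?_⟩
  · rintro ⟨u, hu, hui⟩
    have hP : ∀ j, u j ∈ {c | lam c ∈ T} := by
      intro j
      have := hlam _ hu j (τ.dep.tgtPos ⟨0, tame.width_pos _ hI⟩)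
      have e := hui ⟨0, tame.width_pos _ hI⟩
      simp only [Set.mem_ofPred_eq]
      refine this.symm ▸ ?_
      change lam (u (τ.dep.tgtPos ⟨0, tame.width_pos _ hI⟩)) ∈ T
      refine (congrArg (fun c => lam c ∈ T) e).mpr ?_
      exact h.mapsTo _ (h₁ _)
    obtain ⟨v, hv, rfl⟩ : ∃ v : Fin (S.arity τ.dep.tgt) → Const Dom, (∀ i, v i ∈ W) ∧ ρ ∘ v = u :=
      h.lift_args (fun j => Active.of_mem hu j) hP
    refine ⟨v, ?_, fun i => h.strictMono.injOn (hv _) (h₁ _) (hui i)⟩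
    rw [Has, ← h.lev_eq ⟨τ.dep.tgt, v⟩ hv]
    exact hu
  · rintro ⟨u, hu, hui⟩
    exact ⟨ρ ∘ u, h.map_ne_top hu, fun i => congrArg ρ (hui i)⟩

theorem first_ID_of_map (tame : TameDeps I K) {Λ : Type*} {lam : Const Dom → Λ} {T : Set Λ}
    (hlam : Labelled s.lev lam) (h : LevelEmb Q {c | lam c ∈ T} W ρ s.lev s'.lev)
    {τ : IDTrigger S Dom} (h₁ : ∀ i, τ.tup i ∈ W)
    (hτ : IDTrigger.First s.lev (s.IDApplicable I) (τ.map ρ)) :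
    IDTrigger.First s'.lev (s'.IDApplicable I) τ := by
  refine ⟨(idApplicable_map tame hlam h h₁).1 hτ.1, fun τ' hτ' => ?_⟩
  have h₁' := h.mem_of_ne_top hτ'.2.1
  exact IDTrigger.rank_le_of_map h.strictMono h.lev_eq h₁ h₁'
    (hτ.2 _ ((idApplicable_map tame hlam h h₁').2 hτ'))

end Transfer

/-! ### Simulation of a step -/

omit [LinearOrder S.Pred] [LinearOrder Dom] in
theorem lev_applyID (s : ChaseState S Dom) (τ : IDTrigger S Dom)
    [DecidableEq (RelAtom S (Const Dom))] :
    (s.applyID τ).lev = fun f => if f = τ.newFact s.next then s.lev τ.fact + 1 else s.lev f := by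
  funext f
  simp only [applyID]
  congr

section SimStep

variable {Q : Set Dom} {W : Set (Const Dom)} {ρ : Const Dom → Const Dom} {Λ : Type*}
  {lam : Const Dom → Λ} {T : Set Λ} {s s' : ChaseState S Dom}

open Classical in
omit [LinearOrder S.Pred] [LinearOrder Dom] in
theorem labelled_applyID {D : Finset (RelAtom S (Const Dom))} (hs : Inv D s)
    (hlam : Labelled s.lev lam) {τ : IDTrigger S Dom} (hτ : s.Has τ.fact) {ℓ : Λ}
    (hℓ : ∀ i, lam (τ.tup i) = ℓ) :
    Labelled (s.applyID τ).lev (withLabel lam s.next ℓ) := by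
  rw [lev_applyID]
  refine hlam.update (fun c hc => withLabel_of_lt fun k hk => hs.fresh_lt k (hk ▸ hc)) ?_ _
  rintro _ rfl i j
  have := withLabel_newTuple τ.dep (t := τ.tup)
    (fun i k hk => hs.fresh_lt k (hk ▸ Active.of_mem hτ i)) hℓ
  exact (this i).trans (this j).symm

open Classical in
omit [LinearOrder S.Pred] in
-- All arguments of the new fact have a label outside `T`, and arities are positive, so the new fact
-- is not the image of an atom over `W`.
theorem sim_applyID_stutter {D : Finset (RelAtom S (Const Dom))} (hs : Inv D s)
    (arity_pos : ∀ p, 0 < S.arity p)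
    (h : Sim Q {c | lam c ∈ T} W ρ s.lev s.next s'.lev s'.next) {τ : IDTrigger S Dom}
    (hτ : s.Has τ.fact) {ℓ : Λ} (hℓ : ∀ i, lam (τ.tup i) = ℓ) (hT : ℓ ∉ T) :
    Sim Q {c | withLabel lam s.next ℓ c ∈ T} W ρ (s.applyID τ).lev (s.applyID τ).next
      s'.lev s'.next := by
  have hold : ∀ c ∈ W, withLabel lam s.next ℓ (ρ c) = lam (ρ c) := fun c hc =>
    withLabel_of_lt (h.lt c hc)
  have hnew := withLabel_newTuple τ.dep (t := τ.tup)
    (fun i k hk => hs.fresh_lt k (hk ▸ Active.of_mem hτ i)) hℓ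
  refine ⟨?_, fun c hc k hk => Nat.lt_add_right _ (h.lt c hc k hk), h.lt'⟩
  have := h.toLevelEmb.update (P' := {c | withLabel lam s.next ℓ c ∈ T}) h.toConstEmb subset_rfl
    (fun _ _ => rfl) ?_ ?_ (fun c hc hc' => absurd hc hc') (N := fun f => f = τ.newFact s.next)
    (N' := fun _ => False) ?_ (fun _ => False.elim) ?_ (s.lev τ.fact + 1)
  · rw [lev_applyID]
    simpa using this
  · intro c hc
    change withLabel lam s.next ℓ (ρ c) ∈ T
    rw [hold c hc]
    exact h.mapsTo c hc
  · intro c hc hcP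
    change withLabel lam s.next ℓ c ∈ T at hcP
    rwa [withLabel_of_lt fun k hk => hs.fresh_lt k (hk ▸ hc)] at hcP
  · intro f hf
    refine iff_false_intro fun hfe => hT ?_
    obtain ⟨p, a⟩ := f
    obtain ⟨rfl, hab⟩ := (RelAtom.mk.injEq ..).mp hfe
    let j : Fin (S.arity τ.dep.tgt) := ⟨0, arity_pos _⟩
    have e : ρ (a j) = τ.dep.newTuple τ.tup s.next j := congrFun (eq_of_heq hab) j
    rw [← hnew j, ← e, hold _ (hf j)]
    exact h.mapsTo _ (hf j)
  · rintro _ rfl i hi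
    exact absurd ((hnew i) ▸ hi) hT

open Classical in
omit [LinearOrder S.Pred] in
-- Both chases reserve one index for every position of the target, so the offsets agree. `W` also
-- receives the indices of positions filled from the source; these constants occur in no atom on
-- either side and do no harm.
theorem sim_applyID {D : Finset (RelAtom S (Const Dom))} (hs : Inv D s)
    (h : Sim Q {c | lam c ∈ T} W ρ s.lev s.next s'.lev s'.next) {τ : IDTrigger S Dom}
    (hτ : s'.Has τ.fact) {ℓ : Λ} (hT : ℓ ∈ T) :
    Sim Q {c | withLabel lam s.next ℓ c ∈ T} (addFresh W s'.next (S.arity τ.dep.tgt))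
      (extendFresh ρ s'.next s.next) (s.applyID (τ.map ρ)).lev (s.applyID (τ.map ρ)).next
      (s'.applyID τ).lev (s'.applyID τ).next := by
  have hτW : ∀ i, τ.tup i ∈ W := h.mem_of_ne_top hτ
  have hW : ∀ c ∈ W, extendFresh ρ s'.next s.next c = ρ c := fun c hc =>
    extendFresh_of_lt fun k hk => h.lt' k (hk ▸ hc)
  have emb := h.toConstEmb.extendFresh h.lt h.lt' (S.arity τ.dep.tgt)
  have hmap := τ.dep.newTuple_map (ρ := ρ) (m := s.next) (m' := s'.next) (t := τ.tup)
    (fun i k hk => h.lt' k (hk ▸ hτW i))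
  have hnew : (τ.newFact s'.next).map (extendFresh ρ s'.next s.next) =
      (τ.map ρ).newFact s.next := congrArg (RelAtom.mk τ.dep.tgt) hmap
  have hact : ∀ i, (τ.newFact s'.next).args i ∈ addFresh W s'.next (S.arity τ.dep.tgt) := by
    intro i
    rcases τ.dep.newTuple_cases τ.tup s'.next i with ⟨j, hj⟩ | ⟨-, hj⟩
    · exact Or.inl ((show (τ.newFact s'.next).args i = τ.tup j from hj).symm ▸ hτW j)
    · exact Or.inr ⟨i, i.isLt, hj⟩
  refine ⟨?_, ?_, ?_⟩
  · have := h.toLevelEmb.update (P' := {c | withLabel lam s.next ℓ c ∈ T}) emb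
      (fun c hc => Or.inl hc) hW ?_ ?_ ?_ (N := fun f => f = (τ.map ρ).newFact s.next)
      (N' := fun f => f = τ.newFact s'.next) ?_ ?_ ?_ (s.lev (τ.map ρ).fact + 1)
    · rw [lev_applyID, lev_applyID, ← h.lev_eq τ.fact hτW]
      exact this
    · rintro c (hc | ⟨j, -, rfl⟩)
      · change withLabel lam s.next ℓ _ ∈ T
        rw [hW c hc, withLabel_of_lt (h.lt c hc)]
        exact h.mapsTo c hc
      · change withLabel lam s.next ℓ _ ∈ T
        rwa [extendFresh_add, withLabel_add]
    · intro c hc hcP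
      change withLabel lam s.next ℓ c ∈ T at hcP
      rwa [withLabel_of_lt fun k hk => hs.fresh_lt k (hk ▸ hc)] at hcP
    · rintro c (hc | ⟨j, -, rfl⟩) hcW
      · exact absurd hc hcW
      · rw [extendFresh_add]
        exact fun ha => (Nat.le_add_right s.next j).not_gt (hs.fresh_lt _ ha)
    · intro f hf
      rw [← hnew]
      exact ⟨RelAtom.map_injOn emb.strictMono.injOn hf hact, fun e => e ▸ rfl⟩
    · rintro _ rfl i
      exact hact i
    · rintro _ rfl i -
      exact ⟨_, hact i, congrFun hmap i⟩
  · rintro c (hc | ⟨j, hj, rfl⟩) k hk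
    · rw [hW c hc] at hk
      exact Nat.lt_add_right _ (h.lt c hc k hk)
    · rw [extendFresh_add] at hk
      rw [← Const.fresh_injective hk]
      exact Nat.add_lt_add_left hj _
  · rintro k (hk | ⟨j, hj, hjk⟩)
    · exact Nat.lt_add_right _ (h.lt' k hk)
    · rw [Const.fresh_injective hjk]
      exact Nat.add_lt_add_left hj _

/-- The trigger that fires has a single label. If the label is in `T`, the trigger lifts and is
first below as well, so the smaller chase makes the same step; otherwise it rests. One labelling
serves all `T`, because `T` is chosen only when a homomorphism to a late state is known. -/
theorem sim_step [Finite S.Pred] (tame : TameDeps I K) {D : Finset (RelAtom S (Const Dom))}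
    (hs : Inv D s) (hlam : Labelled s.lev lam) {s₁ : ChaseState S Dom}
    (hstep : step I K s = some s₁) :
    ∃ lam' : Const Dom → Λ, Labelled s₁.lev lam' ∧ ∀ (T : Set Λ) W ρ (s' : ChaseState S Dom),
      Sim Q {c | lam c ∈ T} W ρ s.lev s.next s'.lev s'.next →
      ∃ W' ρ' s₁', (s₁' = s' ∨ step I K s' = some s₁') ∧
        Sim Q {c | lam' c ∈ T} W' ρ' s₁.lev s₁.next s₁'.lev s₁'.next := by
  rcases step_cases hstep with ⟨τ, σ, hτ, hσ, rfl⟩ | ⟨hK, ⟨τ, hτ, rfl⟩ | rfl⟩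
  -- The key is nonempty: both facts have the same constant at position `i₀`, and so all their
  -- arguments have one label, which the unifier respects.
  · obtain ⟨i₀, hi₀⟩ := tame.attrs_nonempty _ hτ.1.1
    have h₁ : ∀ i, lam (τ.fst i) = lam (τ.fst i₀) := fun i => hlam _ hτ.1.2.1 i i₀
    have h₂ : ∀ i, lam (τ.snd i) = lam (τ.fst i₀) := fun i =>
      (hlam _ hτ.1.2.2.1 i i₀).trans (congrArg lam (hτ.1.2.2.2.2 i₀ hi₀).symm)
    have hσlam : ∀ c, lam (σ c) = lam c := by
      intro c
      have := unifier_mem_or hσ (A := {c | lam c = lam (τ.fst i₀)}) h₁ h₂ c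
      by_cases hc : lam c = lam (τ.fst i₀)
      · rw [hc]; exact this.1 hc
      · rw [this.2 hc]
    refine ⟨lam, ?_, fun T W ρ s' h => ?_⟩
    · intro f hf i j
      obtain ⟨g, hg, rfl⟩ := replace_ne_top.1 hf
      simp only [RelAtom.map, hσlam]
      exact hlam g hg i j
    have hP : ∀ c, σ c ∈ {c | lam c ∈ T} → c ∈ {c | lam c ∈ T} := fun c hc => by
      simpa only [Set.mem_ofPred_eq, hσlam] using hc
    by_cases hT : lam (τ.fst i₀) ∈ T
    · obtain ⟨u, hu, hut⟩ := h.lift_args (t := τ.fst) (fun i => Active.of_mem hτ.1.2.1 i)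
        (fun i => by simpa only [Set.mem_ofPred_eq, h₁] using hT)
      obtain ⟨v, hv, hvt⟩ := h.lift_args (t := τ.snd) (fun i => Active.of_mem hτ.1.2.2.1 i)
        (fun i => by simpa only [Set.mem_ofPred_eq, h₂] using hT)
      have hmap : KDTrigger.map ρ ⟨τ.dep, u, v⟩ = τ := by
        rw [KDTrigger.map, hut, hvt]
      have hfirst := first_KD_of_map h.toLevelEmb (τ := ⟨τ.dep, u, v⟩) hu hv (hmap ▸ hτ)
      rw [← hut, ← hvt] at hσ
      obtain ⟨σ', hσ', hc⟩ := unifier_map h.toConstEmb hu hv hσ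
      refine ⟨W, ρ, s'.replace σ', Or.inr ?_, sim_replace h hc hP⟩
      rw [step_of_first_KD hfirst, hσ', Option.map_some]
    -- Here `σ` moves only constants with a label outside `T`; on `ρ '' W` it is the identity.
    · refine ⟨W, ρ, s', Or.inl rfl, ?_⟩
      have := sim_replace h (σ := σ) (σ' := id) (fun c hc => ⟨hc, ?_⟩) hP
      · rwa [replace_id] at this
      · refine (unifier_mem_or hσ (A := {c | lam c = lam (τ.fst i₀)}) h₁ h₂ _).2 fun hc' => hT ?_
        rw [← show lam (ρ c) = _ from hc']
        exact h.mapsTo c hc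
  · have hpos := tame.arity_pos τ.dep.src
    have hℓ : ∀ i, lam (τ.tup i) = lam (τ.tup ⟨0, hpos⟩) := fun i => hlam _ hτ.1.2.1 i _
    refine ⟨_, labelled_applyID hs hlam hτ.1.2.1 hℓ, fun T W ρ s' h => ?_⟩
    by_cases hT : lam (τ.tup ⟨0, hpos⟩) ∈ T
    · obtain ⟨d, t⟩ := τ
      obtain ⟨u, hu, rfl⟩ : ∃ u : Fin (S.arity d.src) → Const Dom, (∀ i, u i ∈ W) ∧ ρ ∘ u = t :=
        h.lift_args (fun i => Active.of_mem hτ.1.2.1 i)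
          (fun i => by simpa only [Set.mem_ofPred_eq, hℓ] using hT)
      have hfirst := first_ID_of_map tame hlam h.toLevelEmb (τ := ⟨d, u⟩) hu hτ
      refine ⟨_, _, _, Or.inr (step_of_first_ID ?_ hfirst),
        sim_applyID hs h (τ := ⟨d, u⟩) hfirst.1.2.1 hT⟩
      -- Key dependencies have priority, so the smaller state must have no trigger for them either:
      -- its image would be applicable above, where a first one would then exist.
      rintro ⟨τ', hτ'⟩
      refine hK (KDTrigger.exists_first hs.finite (fun τ h => ⟨h.2.1, h.2.2.1⟩)
        (τ := τ'.map ρ) ?_)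
      exact (kdApplicable_map h.toLevelEmb (h.mem_of_ne_top hτ'.1.2.1)
        (h.mem_of_ne_top hτ'.1.2.2.1)).2 hτ'.1
    · exact ⟨W, ρ, s', Or.inl rfl, sim_applyID_stutter hs tame.arity_pos h hτ.1.2.1 hℓ hT⟩
  · exact ⟨lam, hlam, fun T W ρ s' h => ⟨W, ρ, s', Or.inl rfl, h⟩⟩

end SimStep

omit [LinearOrder S.Pred] in
theorem sim_init {Q : Set Dom} {Λ : Type*} {D D' : Finset (RelAtom S (Const Dom))}
    {lam : Const Dom → Λ} (hlam : DbLabelled D lam) {T : Set Λ}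
    {ρ : Const Dom → Const Dom} (h : DbEmb Q ρ D' (labelled D lam T)) :
    Sim Q {c | lam c ∈ T} (constsOf D') ρ (init D).lev (init D).next
      (init D').lev (init D').next := by
  classical
  have hW : ∀ c ∈ constsOf D', lam (ρ c) ∈ T := by
    rintro _ ⟨f, hf, i, rfl⟩
    exact ((h.image _).2 ⟨f, hf, rfl⟩).2 i
  refine ⟨⟨h.toConstEmb, hW, fun c hc => active_init.1 hc, ?_, ?_⟩, ?_,
    fun k hk => lt_firstFresh D' hk⟩
  · intro c hc hcT
    obtain ⟨f, hf, i, rfl⟩ := active_init.1 hc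
    obtain ⟨g, hg, rfl⟩ := (h.image f).1 ⟨hf, fun j => (hlam f hf j i).symm ▸ hcT⟩
    exact ⟨_, ⟨g, hg, i, rfl⟩, rfl⟩
  · intro f hf
    have : f.map ρ ∈ D ↔ f ∈ D' := by
      refine ⟨fun hfD => ?_, fun hfD => ((h.image _).2 ⟨f, hfD, rfl⟩).1⟩
      obtain ⟨g, hg, hgf⟩ := (h.image (f.map ρ)).1 ⟨hfD, fun i => hW _ (hf i)⟩
      rwa [← RelAtom.map_injOn h.strictMono.injOn (fun i => ⟨g, hg, i, rfl⟩) hf hgf]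
    simp only [init, this]
  · rintro _ ⟨f, hf, i, rfl⟩ k hk
    exact lt_firstFresh D ⟨f.map ρ, ((h.image _).2 ⟨f, hf, rfl⟩).1, i, hk⟩

end ChaseState

/-! ## Atoms of the schema with equality -/

/-- The atom `eq(a, b)`. -/
def eqAtom {S : RelSchema} {K : Type*} (a b : K) : RelAtom S.withEq K :=
  ⟨none, (![a, b] : Fin 2 → K)⟩

theorem RelAtom.withEq_cases {S : RelSchema} {K : Type*} (g : RelAtom S.withEq K) :
    (∃ f : RelAtom S K, g = f.toEq) ∨ ∃ a b, g = eqAtom a b := by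
  obtain ⟨p | p, a⟩ := g
  · refine Or.inr ⟨a (0 : Fin 2), a (1 : Fin 2), ?_⟩
    refine congrArg (RelAtom.mk (S := S.withEq) none) (funext fun i => ?_)
    change Fin 2 at i
    fin_cases i <;> rfl
  · exact Or.inl ⟨⟨p, a⟩, rfl⟩

theorem eqAtom_map {S : RelSchema} {K L : Type*} (σ : K → L) (a b : K) :
    (eqAtom a b : RelAtom S.withEq K).map σ = eqAtom (σ a) (σ b) := by
  refine congrArg (RelAtom.mk (S := S.withEq) none) (funext fun i => ?_)
  change Fin 2 at i
  fin_cases i <;> rfl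

theorem forall_eqAtom_args {S : RelSchema} {K : Type*} {a b : K} {p : K → Prop} :
    (∀ i, p ((eqAtom a b : RelAtom S.withEq K).args i)) ↔ p a ∧ p b :=
  Fin.forall_fin_two

theorem eqAtom_lam {S : RelSchema} {K Λ : Type*} {lam : K → Λ} {a b : K} (h : lam a = lam b)
    (i j : Fin (S.withEq.arity (eqAtom a b : RelAtom S.withEq K).pred)) :
    lam ((eqAtom a b : RelAtom S.withEq K).args i) =
      lam ((eqAtom a b : RelAtom S.withEq K).args j) :=
  have key := forall_eqAtom_args (S := S) (p := fun c => lam c = lam b).2 ⟨h, rfl⟩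
  (key i).trans (key j).symm

theorem eqAtom_inj {S : RelSchema} {K : Type*} {a b a' b' : K} :
    (eqAtom a b : RelAtom S.withEq K) = eqAtom a' b' ↔ a = a' ∧ b = b' := by
  refine ⟨fun h => ?_, fun ⟨h, h'⟩ => by rw [h, h']⟩
  have h := eq_of_heq ((RelAtom.mk.injEq ..).mp h).2
  exact ⟨congrFun h (0 : Fin 2), congrFun h (1 : Fin 2)⟩

theorem toEq_ne_eqAtom {S : RelSchema} {K : Type*} (f : RelAtom S K) (a b : K) :
    f.toEq ≠ eqAtom a b :=
  fun h => Option.some_ne_none _ ((RelAtom.mk.injEq ..).mp h).1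

theorem RelAtom.toEq_injective {S : RelSchema} {K : Type*} :
    Function.Injective (RelAtom.toEq : RelAtom S K → _) := by
  rintro ⟨p, a⟩ ⟨p', b⟩ h
  obtain ⟨h₁, h₂⟩ := (RelAtom.mk.injEq ..).mp h
  obtain rfl := Option.some.inj h₁
  exact congrArg _ (eq_of_heq h₂)

theorem withEq_arity_pos {S : RelSchema} (h : ∀ p, 0 < S.arity p) : ∀ p, 0 < S.withEq.arity p
  | some p => h p
  | none => Nat.two_pos

/-! ## Simulation of chases with equality -/

namespace EqChaseState

/-! ### States with equality atoms as levelled sets of atoms over the extended schema -/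

section

variable {S : RelSchema} {Dom : Type*} {s : EqChaseState S Dom}

theorem active_of_has {f : RelAtom S (Const Dom)} (h : s.Has f) (i : Fin (S.arity f.pred)) :
    Active s.atomLev (f.args i) := ⟨f.toEq, h, i, rfl⟩

theorem active_of_hasEq {a b : Const Dom} (h : s.HasEq a b) :
    Active s.atomLev a ∧ Active s.atomLev b :=
  ⟨⟨eqAtom a b, h, (0 : Fin 2), rfl⟩, ⟨eqAtom a b, h, (1 : Fin 2), rfl⟩⟩

theorem active_iff {c : Const Dom} : Active s.atomLev c ↔
    (∃ f, s.Has f ∧ ∃ i, f.args i = c) ∨ ∃ b, s.HasEq c b ∨ s.HasEq b c := by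
  constructor
  · rintro ⟨g, hg, i, rfl⟩
    rcases g.withEq_cases with ⟨f, rfl⟩ | ⟨a, b, rfl⟩
    · exact Or.inl ⟨f, hg, i, rfl⟩
    · refine Or.inr ?_
      change Fin 2 at i
      fin_cases i
      · exact ⟨b, Or.inl hg⟩
      · exact ⟨a, Or.inr hg⟩
  · rintro (⟨f, hf, i, rfl⟩ | ⟨b, h | h⟩)
    · exact active_of_has hf i
    · exact (active_of_hasEq h).1
    · exact (active_of_hasEq h).2

theorem mergedEq_active {τ : KDTrigger S Dom} (h₁ : s.Has τ.fact₁) (h₂ : s.Has τ.fact₂)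
    {a b : Const Dom} (h : s.MergedEq τ a b) : Active s.atomLev a ∧ Active s.atomLev b := by
  have step : ∀ a b, (s.HasEq a b ∨ ∃ i, (a = τ.fst i ∧ b = τ.snd i) ∨
      (a = τ.snd i ∧ b = τ.fst i)) → Active s.atomLev a ∧ Active s.atomLev b := by
    rintro a b (h | ⟨i, ⟨rfl, rfl⟩ | ⟨rfl, rfl⟩⟩)
    · exact active_of_hasEq h
    · exact ⟨active_of_has h₁ i, active_of_has h₂ i⟩
    · exact ⟨active_of_has h₂ i, active_of_has h₁ i⟩
  induction h with
  | single h => exact step _ _ h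
  | tail _ h ih => exact ⟨ih.1, (step _ _ h).2⟩

theorem hasEq_lam {Λ : Type*} {lam : Const Dom → Λ} (hlam : Labelled s.atomLev lam)
    {a b : Const Dom} (h : s.HasEq a b) : lam a = lam b :=
  hlam (eqAtom a b) h (0 : Fin 2) (1 : Fin 2)

theorem mergedEq_lam {Λ : Type*} {lam : Const Dom → Λ} (hlam : Labelled s.atomLev lam)
    {τ : KDTrigger S Dom} (h : ∀ i, lam (τ.fst i) = lam (τ.snd i)) {a b : Const Dom}
    (hab : s.MergedEq τ a b) : lam a = lam b := by
  have step : ∀ a b, (s.HasEq a b ∨ ∃ i, (a = τ.fst i ∧ b = τ.snd i) ∨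
      (a = τ.snd i ∧ b = τ.fst i)) → lam a = lam b := by
    rintro a b (hab | ⟨i, ⟨rfl, rfl⟩ | ⟨rfl, rfl⟩⟩)
    · exact hasEq_lam hlam hab
    · exact h i
    · exact (h i).symm
  induction hab with
  | single h => exact step _ _ h
  | tail _ h ih => exact ih.trans (step _ _ h)

/-- The atoms that are added by the key dependency rule. -/
def KDNew (s : EqChaseState S Dom) (τ : KDTrigger S Dom) (g : RelAtom S.withEq (Const Dom)) :
    Prop :=
  ∃ a b, g = eqAtom a b ∧ ¬ s.HasEq a b ∧ s.MergedEq τ a b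

/-- The atoms that are added by the inclusion dependency rule. -/
def IDNew (m : ℕ) (τ : IDTrigger S Dom) (g : RelAtom S.withEq (Const Dom)) : Prop :=
  g = (τ.newFact m).toEq ∨
    ∃ j ∉ Set.range τ.dep.tgtPos, g = eqAtom (Const.fresh (m + j)) (Const.fresh (m + j))

theorem kdNew_eqAtom {τ : KDTrigger S Dom} {a b : Const Dom} :
    s.KDNew τ (eqAtom a b) ↔ ¬ s.HasEq a b ∧ s.MergedEq τ a b := by
  constructor
  · rintro ⟨a', b', h, h'⟩
    obtain ⟨rfl, rfl⟩ := eqAtom_inj.1 h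
    exact h'
  · exact fun h => ⟨a, b, rfl, h⟩

open Classical in
-- Brings the rule into the form that `LevelEmb.update` and `Labelled.update` accept: one level for
-- a set of new atoms.
theorem atomLev_applyKD (s : EqChaseState S Dom) (τ : KDTrigger S Dom) :
    (s.applyKD τ).atomLev = fun g => if s.KDNew τ g then τ.level s.lev else s.atomLev g := by
  funext g
  rcases g.withEq_cases with ⟨f, rfl⟩ | ⟨a, b, rfl⟩
  · rw [if_neg]
    · rfl
    · rintro ⟨a, b, h, -⟩
      exact toEq_ne_eqAtom _ _ _ h
  · change (if s.HasEq a b then s.eqLev a b else if s.MergedEq τ a b then τ.level s.lev else ⊤) =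
      if s.KDNew τ (eqAtom a b) then τ.level s.lev else s.eqLev a b
    simp only [kdNew_eqAtom]
    by_cases h₁ : s.HasEq a b
    · simp [h₁]
    · have h₂ : s.eqLev a b = ⊤ := not_not.1 h₁
      simp [h₁, h₂]

open Classical in
theorem atomLev_applyID (s : EqChaseState S Dom) (τ : IDTrigger S Dom) :
    (s.applyID τ).atomLev =
      fun g => if IDNew s.next τ g then s.lev τ.fact + 1 else s.atomLev g := by
  funext g
  rcases g.withEq_cases with ⟨f, rfl⟩ | ⟨a, b, rfl⟩
  · have : IDNew s.next τ f.toEq ↔ f = τ.newFact s.next := by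
      constructor
      · rintro (h | ⟨j, -, h⟩)
        · exact RelAtom.toEq_injective h
        · exact absurd h (toEq_ne_eqAtom _ _ _)
      · exact fun h => Or.inl (h ▸ rfl)
    simp only [this]
    rfl
  · have : IDNew s.next τ (eqAtom a b) ↔
        a = b ∧ ∃ j ∉ Set.range τ.dep.tgtPos, a = Const.fresh (s.next + j) := by
      constructor
      · rintro (h | ⟨j, hj, h⟩)
        · exact absurd h.symm (toEq_ne_eqAtom _ _ _)
        · obtain ⟨rfl, rfl⟩ := eqAtom_inj.1 h
          exact ⟨rfl, j, hj, rfl⟩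
      · rintro ⟨rfl, j, hj, rfl⟩
        exact Or.inr ⟨j, hj, rfl⟩
    simp only [this]
    rfl

theorem hasEq_applyKD {τ : KDTrigger S Dom} {a b : Const Dom} (h₁ : s.Has τ.fact₁) :
    (s.applyKD τ).HasEq a b ↔ s.MergedEq τ a b := by
  have hl : τ.level s.lev ≠ ⊤ := (min_lt_of_left_lt (Ne.lt_top h₁)).ne
  have hm : s.HasEq a b → s.MergedEq τ a b := fun h => Relation.TransGen.single (Or.inl h)
  simp only [HasEq, applyKD] at hm ⊢
  split_ifs <;> simp_all

theorem active_applyKD {τ : KDTrigger S Dom} (h₁ : s.Has τ.fact₁) (h₂ : s.Has τ.fact₂)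
    {c : Const Dom} (h : Active (s.applyKD τ).atomLev c) : Active s.atomLev c := by
  rcases active_iff.1 h with ⟨f, hf, i, rfl⟩ | ⟨b, hb | hb⟩
  · exact active_of_has (s := s) hf i
  · exact (mergedEq_active h₁ h₂ ((hasEq_applyKD h₁).1 hb)).1
  · exact (mergedEq_active h₁ h₂ ((hasEq_applyKD h₁).1 hb)).2

theorem idNew_args {m : ℕ} {τ : IDTrigger S Dom} {g : RelAtom S.withEq (Const Dom)}
    (h : IDNew m τ g) (i : Fin (S.withEq.arity g.pred)) :
    (∃ j, g.args i = τ.tup j) ∨ ∃ j : Fin (S.arity τ.dep.tgt), g.args i = Const.fresh (m + j) := by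
  rcases h with rfl | ⟨j, -, rfl⟩
  · rcases τ.dep.newTuple_cases τ.tup m i with ⟨j, hj⟩ | ⟨-, hj⟩
    · exact Or.inl ⟨j, hj⟩
    · exact Or.inr ⟨i, hj⟩
  · refine Or.inr ⟨j, ?_⟩
    revert i
    rw [forall_eqAtom_args (p := fun c => c = Const.fresh (m + j))]
    exact ⟨rfl, rfl⟩

theorem active_applyID {τ : IDTrigger S Dom} (hτ : s.Has τ.fact)
    {c : Const Dom} (h : Active (s.applyID τ).atomLev c) :
    Active s.atomLev c ∨ ∃ j : Fin (S.arity τ.dep.tgt), c = Const.fresh (s.next + j) := by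
  classical
  obtain ⟨g, hg, i, rfl⟩ := h
  by_cases hn : IDNew s.next τ g
  · rcases idNew_args hn i with ⟨j, hj⟩ | h
    · rw [hj]; exact Or.inl (active_of_has hτ j)
    · exact Or.inr h
  · rw [atomLev_applyID] at hg
    simp only [hn, if_false] at hg
    exact Or.inl (Active.of_mem hg i)

/-- Basic invariants of the states of the chase with equality of `D`. -/
structure Inv (D : Finset (RelAtom S (Const Dom))) (s : EqChaseState S Dom) : Prop where
  finite : {f | s.lev f ≠ ⊤}.Finite
  fresh_lt : ∀ k, Active s.atomLev (Const.fresh k) → k < s.next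
  dom_mem : ∀ d, Active s.atomLev (Const.dom d) → Const.dom d ∈ constsOf D
  refl : ∀ c, Active s.atomLev c → s.HasEq c c
  trans : ∀ a b c, s.HasEq a b → s.HasEq b c → s.HasEq a c

theorem hasEq_init {D : Finset (RelAtom S (Const Dom))} {a b : Const Dom} :
    (init D).HasEq a b ↔ a = b ∧ a ∈ constsOf D := by
  simp [HasEq, init, constsOf]

theorem active_init {D : Finset (RelAtom S (Const Dom))} {c : Const Dom} :
    Active (init D).atomLev c ↔ c ∈ constsOf D := by
  rw [active_iff]
  constructor
  · rintro (⟨f, hf, i, rfl⟩ | ⟨b, h | h⟩)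
    · exact ⟨f, by simpa [Has, init] using hf, i, rfl⟩
    · exact (hasEq_init.1 h).2
    · exact (hasEq_init.1 h).1 ▸ (hasEq_init.1 h).2
  · exact fun h => Or.inr ⟨c, Or.inl (hasEq_init.2 ⟨rfl, h⟩)⟩

theorem inv_init (D : Finset (RelAtom S (Const Dom))) : Inv D (init D) where
  finite := D.finite_toSet.subset fun f hf => by simpa [init] using hf
  fresh_lt k hk := lt_firstFresh D (active_init.1 hk)
  dom_mem d hd := active_init.1 hd
  refl c hc := hasEq_init.2 ⟨rfl, active_init.1 hc⟩
  trans a b c hab hbc := by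
    obtain ⟨rfl, h⟩ := hasEq_init.1 hab
    exact hbc

theorem Inv.not_has_newFact {D : Finset (RelAtom S (Const Dom))} (hs : Inv D s)
    {I : Set (InclDep S)} {τ : IDTrigger S Dom} (h : s.IDApplicable I τ)
    (hσ : Function.Injective τ.dep.tgtPos) (m : ℕ) : ¬ s.Has (τ.newFact m) := by
  refine fun hn => h.2.2 ⟨_, hn, fun i => ?_⟩
  rw [τ.dep.newTuple_tgtPos hσ]
  exact hs.refl _ (active_of_has h.2.1 _)

theorem Inv.applyKD {D : Finset (RelAtom S (Const Dom))} (hs : Inv D s) {τ : KDTrigger S Dom}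
    (h₁ : s.Has τ.fact₁) (h₂ : s.Has τ.fact₂) : Inv D (s.applyKD τ) where
  finite := hs.finite
  fresh_lt k hk := hs.fresh_lt k (active_applyKD h₁ h₂ hk)
  dom_mem d hd := hs.dom_mem d (active_applyKD h₁ h₂ hd)
  refl c hc := (hasEq_applyKD h₁).2
    (Relation.TransGen.single (Or.inl (hs.refl c (active_applyKD h₁ h₂ hc))))
  trans a b c hab hbc := by
    rw [hasEq_applyKD h₁] at hab hbc ⊢
    exact Relation.TransGen.trans hab hbc

theorem hasEq_applyID {τ : IDTrigger S Dom} (hτ : s.Has τ.fact) {a b : Const Dom} :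
    (s.applyID τ).HasEq a b ↔ s.HasEq a b ∨
      (a = b ∧ ∃ j ∉ Set.range τ.dep.tgtPos, a = Const.fresh (s.next + j)) := by
  have hτ : s.lev τ.fact + 1 ≠ ⊤ := by simpa [Has] using hτ
  simp only [HasEq, EqChaseState.applyID]
  split_ifs with h
  · exact iff_of_true hτ (Or.inr h)
  · exact ⟨Or.inl, fun h' => h'.resolve_right h⟩

theorem Inv.applyID {D : Finset (RelAtom S (Const Dom))} (hs : Inv D s) {τ : IDTrigger S Dom}
    (hτ : s.Has τ.fact) : Inv D (s.applyID τ) where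
  finite := by
    refine (hs.finite.insert (τ.newFact s.next)).subset fun f hf => ?_
    by_cases hn : f = τ.newFact s.next
    · exact Or.inl hn
    · simp only [EqChaseState.applyID, hn, if_false, Set.mem_ofPred_eq] at hf
      exact Or.inr hf
  fresh_lt k hk := by
    rcases active_applyID hτ hk with hk | ⟨j, hj⟩
    · exact Nat.lt_add_right _ (hs.fresh_lt k hk)
    · rw [Const.fresh_injective hj]
      exact Nat.add_lt_add_left j.isLt _
  dom_mem d hd := by
    rcases active_applyID hτ hd with hd | ⟨j, hj⟩
    · exact hs.dom_mem d hd
    · exact absurd hj (Const.dom_ne_fresh _ _)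
  refl c hc := by
    rw [hasEq_applyID hτ]
    have old : ∀ c, Active s.atomLev c → s.HasEq c c := hs.refl
    rcases active_iff.1 hc with ⟨f, hf, i, rfl⟩ | ⟨b, hb | hb⟩
    · by_cases hn : f = τ.newFact s.next
      · subst hn
        rcases τ.dep.newTuple_cases τ.tup s.next i with ⟨j, hj⟩ | ⟨hi, hj⟩
        · refine Or.inl (old _ ?_)
          rw [show (τ.newFact s.next).args i = τ.tup j from hj]
          exact active_of_has hτ j
        · exact Or.inr ⟨rfl, i, hi, hj⟩
      · simp only [Has, EqChaseState.applyID, hn, if_false] at hf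
        exact Or.inl (old _ (active_of_has hf i))
    · rcases (hasEq_applyID hτ).1 hb with hb | hb
      · exact Or.inl (old _ (active_of_hasEq hb).1)
      · exact Or.inr ⟨rfl, hb.2⟩
    · rcases (hasEq_applyID hτ).1 hb with hb | ⟨rfl, hb'⟩
      · exact Or.inl (old _ (active_of_hasEq hb).2)
      · exact Or.inr ⟨rfl, hb'⟩
  trans a b c hab hbc := by
    rw [hasEq_applyID hτ] at hab hbc ⊢
    rcases hab with hab | ⟨rfl, hab⟩
    · rcases hbc with hbc | ⟨rfl, hbc⟩
      · exact Or.inl (hs.trans a b c hab hbc)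
      · exact Or.inl hab
    · exact hbc

theorem withLabel_idNew {Λ : Type*} {lam : Const Dom → Λ} {D : Finset (RelAtom S (Const Dom))}
    (hs : Inv D s) {τ : IDTrigger S Dom} (hτ : s.Has τ.fact) {ℓ : Λ}
    (hℓ : ∀ i, lam (τ.tup i) = ℓ) {f : RelAtom S.withEq (Const Dom)} (hf : IDNew s.next τ f)
    (i : Fin (S.withEq.arity f.pred)) : withLabel lam s.next ℓ (f.args i) = ℓ := by
  rcases idNew_args hf i with ⟨j, hj⟩ | ⟨j, hj⟩
  · have ha : Active s.atomLev (τ.tup j) := active_of_has hτ j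
    rw [hj, withLabel_of_lt (fun k hk => hs.fresh_lt k (hk ▸ ha)), hℓ]
  · rw [hj, withLabel_add]

end

variable {S : RelSchema} {Dom : Type*} [LinearOrder S.Pred] [LinearOrder Dom]
  {I : Set (InclDep S)} {K : Set (KeyDep S)}

/-! ### Steps of the chase with equality -/

theorem step_cases {s s₁ : EqChaseState S Dom} (h : step I K s = some s₁) :
    (∃ τ, KDTrigger.First s.lev (s.KDApplicable K) τ ∧ ¬ (s.applyKD τ).Clash ∧
      s₁ = s.applyKD τ) ∨
    (¬ ∃ τ, KDTrigger.First s.lev (s.KDApplicable K) τ) ∧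
      ((∃ τ, IDTrigger.First s.lev (s.IDApplicable I) τ ∧ s₁ = s.applyID τ) ∨ s₁ = s) := by
  unfold step at h
  split_ifs at h with h₁ h₂ h₃
  · exact Or.inl ⟨_, h₁.choose_spec, h₂, (Option.some.inj h).symm⟩
  · exact Or.inr ⟨h₁, Or.inl ⟨_, h₃.choose_spec, (Option.some.inj h).symm⟩⟩
  · exact Or.inr ⟨h₁, Or.inr (Option.some.inj h).symm⟩

theorem step_of_first_KD {s : EqChaseState S Dom} {τ : KDTrigger S Dom}
    (h : KDTrigger.First s.lev (s.KDApplicable K) τ) (hc : ¬ (s.applyKD τ).Clash) :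
    step I K s = some (s.applyKD τ) := by
  have hex : ∃ τ, KDTrigger.First s.lev (s.KDApplicable K) τ := ⟨τ, h⟩
  rw [step, dif_pos hex, hex.choose_spec.unique h, if_neg hc]

theorem step_of_first_ID {s : EqChaseState S Dom} {τ : IDTrigger S Dom}
    (hK : ¬ ∃ τ, KDTrigger.First s.lev (s.KDApplicable K) τ)
    (h : IDTrigger.First s.lev (s.IDApplicable I) τ) : step I K s = some (s.applyID τ) := by
  have hex : ∃ τ, IDTrigger.First s.lev (s.IDApplicable I) τ := ⟨τ, h⟩
  rw [step, dif_neg hK, dif_pos hex, hex.choose_spec.unique h]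

theorem Inv.step {D : Finset (RelAtom S (Const Dom))} {s s₁ : EqChaseState S Dom} (hs : Inv D s)
    (h : step I K s = some s₁) : Inv D s₁ := by
  rcases step_cases h with ⟨τ, hτ, -, rfl⟩ | ⟨-, ⟨τ, hτ, rfl⟩ | rfl⟩
  · exact hs.applyKD hτ.1.2.1 hτ.1.2.2.1
  · exact hs.applyID hτ.1.2.1
  · exact hs

/-- Constants are never replaced here, so no renaming is needed, and an atom that receives a level
was absent before. For the new fact this uses reflexivity of `eq`, for `eq(α, α)` the bound on the
indices of fresh constants. -/
theorem step_push (tame : TameDeps I K) {D : Finset (RelAtom S (Const Dom))}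
    {s s₁ : EqChaseState S Dom} (hs : Inv D s) (h : step I K s = some s₁)
    (g : RelAtom S.withEq (Const Dom)) : s₁.atomLev g ≤ s.atomLev g := by
  classical
  rcases step_cases h with ⟨τ, hτ, -, rfl⟩ | ⟨-, ⟨τ, hτ, rfl⟩ | rfl⟩
  · rw [atomLev_applyKD]
    beta_reduce
    split_ifs with hn
    · obtain ⟨a, b, rfl, hab, -⟩ := hn
      rw [show s.atomLev (eqAtom a b) = ⊤ from not_not.1 hab]
      exact le_top
    · exact le_rfl
  · rw [atomLev_applyID]
    beta_reduce
    split_ifs with hn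
    · suffices hg : s.atomLev g = ⊤ by rw [hg]; exact le_top
      by_contra hg
      rcases hn with rfl | ⟨j, -, rfl⟩
      · exact hs.not_has_newFact hτ.1 (tame.tgtPos_injective _ hτ.1.1) _ hg
      · have := hs.fresh_lt _ (Active.of_mem hg (0 : Fin 2))
        omega
    · exact le_rfl
  · exact le_rfl

/-! ### Transfer of triggers -/

section Transfer

variable {Q : Set Dom} {P W : Set (Const Dom)} {ρ : Const Dom → Const Dom}
  {s s' : EqChaseState S Dom}

omit [LinearOrder S.Pred] in
-- Triggers are ranked by the levels of facts alone, so the embedding has to be restricted to facts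
-- before ranks are compared.
theorem levelEmb_lev (h : LevelEmb Q P W ρ s.atomLev s'.atomLev) :
    LevelEmb Q P W ρ s.lev s'.lev where
  toConstEmb := h.toConstEmb
  mapsTo := h.mapsTo
  active := by
    rintro _ ⟨f, hf, i, rfl⟩
    exact h.active _ (active_of_has hf i)
  cover := by
    rintro _ ⟨f, hf, i, rfl⟩
    exact h.cover _ (active_of_has hf i)
  lev_eq f hf := h.lev_eq f.toEq hf

omit [LinearOrder S.Pred] in
theorem eqLev_map (h : LevelEmb Q P W ρ s.atomLev s'.atomLev) {a b : Const Dom} (ha : a ∈ W)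
    (hb : b ∈ W) : s.eqLev (ρ a) (ρ b) = s'.eqLev a b := by
  have := h.lev_eq (eqAtom a b) (forall_eqAtom_args.2 ⟨ha, hb⟩)
  rwa [eqAtom_map] at this

omit [LinearOrder S.Pred] in
theorem hasEq_map (h : LevelEmb Q P W ρ s.atomLev s'.atomLev) {a b : Const Dom} (ha : a ∈ W)
    (hb : b ∈ W) : s.HasEq (ρ a) (ρ b) ↔ s'.HasEq a b := by
  rw [HasEq, HasEq, eqLev_map h ha hb]

omit [LinearOrder S.Pred] in
theorem clash_of_clash (h : LevelEmb Q P W ρ s.atomLev s'.atomLev) (hc : s'.Clash) : s.Clash := by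
  obtain ⟨c₁, c₂, hne, h₁₂⟩ := hc
  obtain ⟨h₁, h₂⟩ := active_of_hasEq h₁₂
  have h₁ := h.active _ h₁
  have h₂ := h.active _ h₂
  obtain ⟨d₁, hd₁⟩ := (h.isDom _ h₁).2 ⟨c₁, rfl⟩
  obtain ⟨d₂, hd₂⟩ := (h.isDom _ h₂).2 ⟨c₂, rfl⟩
  refine ⟨d₁, d₂, ?_, ?_⟩
  · rintro rfl
    exact hne (Const.dom_injective (h.strictMono.injOn h₁ h₂ (hd₁.trans hd₂.symm)))
  · rw [← hd₁, ← hd₂]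
    exact (hasEq_map h h₁ h₂).2 h₁₂

theorem kdApplicable_map (h : LevelEmb Q P W ρ s.atomLev s'.atomLev) {τ : KDTrigger S Dom}
    (h₁ : ∀ i, τ.fst i ∈ W) (h₂ : ∀ i, τ.snd i ∈ W) :
    s.KDApplicable K (τ.map ρ) ↔ s'.KDApplicable K τ := by
  have e₁ : s.Has (τ.map ρ).fact₁ ↔ s'.Has τ.fact₁ := by
    rw [Has, Has, ← (levelEmb_lev h).lev_eq τ.fact₁ h₁]; rfl
  have e₂ : s.Has (τ.map ρ).fact₂ ↔ s'.Has τ.fact₂ := by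
    rw [Has, Has, ← (levelEmb_lev h).lev_eq τ.fact₂ h₂]; rfl
  have e₃ : (τ.map ρ).fact₁.key < (τ.map ρ).fact₂.key ↔ τ.fact₁.key < τ.fact₂.key :=
    RelAtom.key_map_lt_iff h.strictMono (f := τ.fact₁) (g := τ.fact₂) h₁ h₂
  have e₄ : ∀ i, s.HasEq ((τ.map ρ).fst i) ((τ.map ρ).snd i) ↔ s'.HasEq (τ.fst i) (τ.snd i) :=
    fun i => hasEq_map h (h₁ i) (h₂ i)
  rw [KDApplicable, KDApplicable, e₁, e₂, e₃]
  simp only [e₄]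
  rfl

theorem first_KD_of_map (h : LevelEmb Q P W ρ s.atomLev s'.atomLev) {τ : KDTrigger S Dom}
    (h₁ : ∀ i, τ.fst i ∈ W) (h₂ : ∀ i, τ.snd i ∈ W)
    (hτ : KDTrigger.First s.lev (s.KDApplicable K) (τ.map ρ)) :
    KDTrigger.First s'.lev (s'.KDApplicable K) τ := by
  have hl := levelEmb_lev h
  refine ⟨(kdApplicable_map h h₁ h₂).1 hτ.1, fun τ' hτ' => ?_⟩
  have h₁' := hl.mem_of_ne_top hτ'.2.1
  have h₂' := hl.mem_of_ne_top hτ'.2.2.1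
  exact KDTrigger.rank_le_of_map h.strictMono hl.lev_eq h₁ h₂ h₁' h₂'
    (hτ.2 _ ((kdApplicable_map h h₁' h₂').2 hτ'))

variable {Λ : Type*} {lam : Const Dom → Λ} {T : Set Λ}

omit [LinearOrder S.Pred] in
theorem idApplicable_map (tame : TameDeps I K)
    (hlam : Labelled s.atomLev lam) (h : LevelEmb Q {c | lam c ∈ T} W ρ s.atomLev s'.atomLev)
    {τ : IDTrigger S Dom} (h₁ : ∀ i, τ.tup i ∈ W) :
    s.IDApplicable I (τ.map ρ) ↔ s'.IDApplicable I τ := by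
  have hl := levelEmb_lev h
  have e₁ : s.Has (τ.map ρ).fact ↔ s'.Has τ.fact := by
    rw [Has, Has, ← hl.lev_eq τ.fact h₁]; rfl
  rw [IDApplicable, IDApplicable, e₁]
  refine and_congr_right fun hI => and_congr_right fun _ => not_congr ⟨?_, ?_⟩
  · rintro ⟨u, hu, hui⟩
    have hP : ∀ j, u j ∈ {c | lam c ∈ T} := by
      intro j
      have e₂ := hlam (RelAtom.toEq ⟨_, u⟩) hu j (τ.dep.tgtPos ⟨0, tame.width_pos _ hI⟩)
      have e₃ := hasEq_lam hlam (hui ⟨0, tame.width_pos _ hI⟩)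
      have e : lam (u j) = _ := e₂.trans e₃.symm
      simp only [Set.mem_ofPred_eq, e]
      exact h.mapsTo _ (h₁ _)
    obtain ⟨v, hv, rfl⟩ : ∃ v : Fin (S.arity τ.dep.tgt) → Const Dom, (∀ i, v i ∈ W) ∧ ρ ∘ v = u :=
      hl.lift_args (fun j => Active.of_mem hu j) hP
    refine ⟨v, ?_, fun i => (hasEq_map h (h₁ _) (hv _)).1 (hui i)⟩
    rw [Has, ← hl.lev_eq ⟨τ.dep.tgt, v⟩ hv]
    exact hu
  · rintro ⟨u, hu, hui⟩
    exact ⟨ρ ∘ u, hl.map_ne_top hu, fun i =>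
      (hasEq_map h (h₁ _) (hl.mem_of_ne_top hu _)).2 (hui i)⟩

theorem first_ID_of_map (tame : TameDeps I K)
    (hlam : Labelled s.atomLev lam) (h : LevelEmb Q {c | lam c ∈ T} W ρ s.atomLev s'.atomLev)
    {τ : IDTrigger S Dom} (h₁ : ∀ i, τ.tup i ∈ W)
    (hτ : IDTrigger.First s.lev (s.IDApplicable I) (τ.map ρ)) :
    IDTrigger.First s'.lev (s'.IDApplicable I) τ := by
  have hl := levelEmb_lev h
  refine ⟨(idApplicable_map tame hlam h h₁).1 hτ.1, fun τ' hτ' => ?_⟩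
  have h₁' := hl.mem_of_ne_top hτ'.2.1
  exact IDTrigger.rank_le_of_map h.strictMono hl.lev_eq h₁ h₁'
    (hτ.2 _ ((idApplicable_map tame hlam h h₁').2 hτ'))

omit [LinearOrder S.Pred] in
-- A chain of equalities that starts in `ρ '' W` stays there: a present `eq` atom preserves the
-- label, hence its other end is covered, and the links added by the trigger are images of links
-- below. The chain is lifted link by link.
theorem mergedEq_map (hlam : Labelled s.atomLev lam)
    (h : LevelEmb Q {c | lam c ∈ T} W ρ s.atomLev s'.atomLev) {τ : KDTrigger S Dom}
    (h₁ : s'.Has τ.fact₁) (h₂ : s'.Has τ.fact₂) {a b : Const Dom} (ha : a ∈ W) (hb : b ∈ W) :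
    s.MergedEq (τ.map ρ) (ρ a) (ρ b) ↔ s'.MergedEq τ a b := by
  have hl := levelEmb_lev h
  have hW₁ := hl.mem_of_ne_top h₁
  have hW₂ := hl.mem_of_ne_top h₂
  constructor
  · intro hab
    have step : ∀ a ∈ W, ∀ y,
        (s.HasEq (ρ a) y ∨ ∃ i, (ρ a = (τ.map ρ).fst i ∧ y = (τ.map ρ).snd i) ∨
        (ρ a = (τ.map ρ).snd i ∧ y = (τ.map ρ).fst i)) → ∃ b ∈ W, y = ρ b ∧
        (s'.HasEq a b ∨ ∃ i, (a = τ.fst i ∧ b = τ.snd i) ∨ (a = τ.snd i ∧ b = τ.fst i)) := by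
      rintro a ha y (hy | ⟨i, ⟨hx, rfl⟩ | ⟨hx, rfl⟩⟩)
      · obtain ⟨b, hb, rfl⟩ := h.cover y (active_of_hasEq hy).2 (by
          simp only [Set.mem_ofPred_eq, ← hasEq_lam hlam hy]
          exact h.mapsTo a ha)
        exact ⟨b, hb, rfl, Or.inl ((hasEq_map h ha hb).1 hy)⟩
      · exact ⟨_, hW₂ i, rfl, Or.inr ⟨i, Or.inl ⟨h.strictMono.injOn ha (hW₁ i) hx, rfl⟩⟩⟩
      · exact ⟨_, hW₁ i, rfl, Or.inr ⟨i, Or.inr ⟨h.strictMono.injOn ha (hW₂ i) hx, rfl⟩⟩⟩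
    have key : ∀ y, s.MergedEq (τ.map ρ) (ρ a) y → ∃ b ∈ W, y = ρ b ∧ s'.MergedEq τ a b := by
      intro y hy
      induction hy with
      | single hy =>
        obtain ⟨b, hb, rfl, hab⟩ := step a ha _ hy
        exact ⟨b, hb, rfl, Relation.TransGen.single hab⟩
      | tail _ hyz ih =>
        obtain ⟨b, hb, rfl, hab⟩ := ih
        obtain ⟨c, hc, rfl, hbc⟩ := step b hb _ hyz
        exact ⟨c, hc, rfl, Relation.TransGen.tail hab hbc⟩
    obtain ⟨b', hb', e, hab'⟩ := key _ hab
    rwa [h.strictMono.injOn hb hb' e]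
  · refine Relation.TransGen.lift ρ ?_ a b
    rintro a b (hab | ⟨i, ⟨rfl, rfl⟩ | ⟨rfl, rfl⟩⟩)
    · exact Or.inl ((hasEq_map h (h.active _ (active_of_hasEq hab).1)
        (h.active _ (active_of_hasEq hab).2)).2 hab)
    · exact Or.inr ⟨i, Or.inl ⟨rfl, rfl⟩⟩
    · exact Or.inr ⟨i, Or.inr ⟨rfl, rfl⟩⟩

end Transfer

end EqChaseState

/-! ### Simulation of a step of the chase with equality -/

namespace EqChaseState

section Simulation

variable {S : RelSchema} {Dom : Type*} [LinearOrder S.Pred] [LinearOrder Dom]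
  {I : Set (InclDep S)} {K : Set (KeyDep S)} {Q : Set Dom} {W : Set (Const Dom)}
  {ρ : Const Dom → Const Dom} {Λ : Type*} {lam : Const Dom → Λ} {T : Set Λ}
  {s s' : EqChaseState S Dom}

omit [LinearOrder S.Pred] [LinearOrder Dom] in
theorem labelled_applyKD (hlam : Labelled s.atomLev lam) {τ : KDTrigger S Dom}
    (h : ∀ i, lam (τ.fst i) = lam (τ.snd i)) : Labelled (s.applyKD τ).atomLev lam := by
  classical
  rw [atomLev_applyKD]
  refine hlam.update (fun _ _ => rfl) ?_ _
  rintro _ ⟨a, b, rfl, -, hab⟩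
  exact eqAtom_lam (mergedEq_lam hlam h hab)

omit [LinearOrder S.Pred] in
theorem sim_applyKD (hlam : Labelled s.atomLev lam)
    (h : Sim Q {c | lam c ∈ T} W ρ s.atomLev s.next s'.atomLev s'.next) {τ : KDTrigger S Dom}
    (h₁ : s'.Has τ.fact₁) (h₂ : s'.Has τ.fact₂) :
    Sim Q {c | lam c ∈ T} W ρ (s.applyKD (τ.map ρ)).atomLev (s.applyKD (τ.map ρ)).next
      (s'.applyKD τ).atomLev (s'.applyKD τ).next := by
  classical
  have hl := levelEmb_lev h.toLevelEmb
  refine ⟨?_, h.lt, h.lt'⟩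
  have hlev : (τ.map ρ).level s.lev = τ.level s'.lev := by
    rw [KDTrigger.level, KDTrigger.level, ← hl.lev_eq τ.fact₁ (hl.mem_of_ne_top h₁),
      ← hl.lev_eq τ.fact₂ (hl.mem_of_ne_top h₂)]
    rfl
  rw [atomLev_applyKD, atomLev_applyKD, hlev]
  refine h.toLevelEmb.update h.toConstEmb subset_rfl (fun _ _ => rfl) h.mapsTo
    (fun _ _ hc => hc) (fun c hc hc' => absurd hc hc') ?_ ?_ ?_ _
  · intro f hf
    rcases f.withEq_cases with ⟨f, rfl⟩ | ⟨a, b, rfl⟩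
    · refine iff_of_false ?_ ?_
      · rintro ⟨a, b, hab, -⟩
        exact toEq_ne_eqAtom (f.map ρ) _ _ hab
      · rintro ⟨a, b, hab, -⟩
        exact toEq_ne_eqAtom _ _ _ hab
    · obtain ⟨ha, hb⟩ := forall_eqAtom_args.1 hf
      rw [eqAtom_map, kdNew_eqAtom, kdNew_eqAtom, hasEq_map h.toLevelEmb ha hb,
        mergedEq_map hlam h.toLevelEmb h₁ h₂ ha hb]
  · rintro _ ⟨a, b, rfl, -, hab⟩
    obtain ⟨ha, hb⟩ := mergedEq_active h₁ h₂ hab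
    exact forall_eqAtom_args.2 ⟨h.active _ ha, h.active _ hb⟩
  · rintro _ ⟨a, b, rfl, -, hab⟩
    obtain ⟨ha, hb⟩ := mergedEq_active (τ := τ.map ρ) (hl.map_ne_top h₁) (hl.map_ne_top h₂) hab
    exact forall_eqAtom_args (p := fun c => c ∈ {c | lam c ∈ T} → c ∈ ρ '' W).2
      ⟨h.cover _ ha, h.cover _ hb⟩

omit [LinearOrder S.Pred] in
-- A chain that starts at a label in `T` never uses one of the added links, since these join
-- constants with labels outside `T`. By transitivity of `eq` its ends were already equal, so no new
-- atom involves a label in `T`.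
theorem sim_applyKD_stutter {D : Finset (RelAtom S (Const Dom))} (hs : Inv D s)
    (hlam : Labelled s.atomLev lam)
    (h : Sim Q {c | lam c ∈ T} W ρ s.atomLev s.next s'.atomLev s'.next) {τ : KDTrigger S Dom}
    (h₁ : ∀ i, lam (τ.fst i) ∉ T) (h₂ : ∀ i, lam (τ.snd i) ∉ T)
    (h₁₂ : ∀ i, lam (τ.fst i) = lam (τ.snd i)) :
    Sim Q {c | lam c ∈ T} W ρ (s.applyKD τ).atomLev (s.applyKD τ).next s'.atomLev s'.next := by
  classical
  have key : ∀ a b, lam a ∈ T → s.MergedEq τ a b → s.HasEq a b := by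
    intro a b ha hab
    have step : ∀ x y, lam x ∈ T → (s.HasEq x y ∨ ∃ i, (x = τ.fst i ∧ y = τ.snd i) ∨
        (x = τ.snd i ∧ y = τ.fst i)) → s.HasEq x y := by
      rintro x y hx (hxy | ⟨i, ⟨rfl, -⟩ | ⟨rfl, -⟩⟩)
      · exact hxy
      · exact absurd hx (h₁ i)
      · exact absurd hx (h₂ i)
    induction hab with
    | single hab => exact step _ _ ha hab
    | tail _ hbc ih => exact hs.trans _ _ _ ih (step _ _ (hasEq_lam hlam ih ▸ ha) hbc)
  have := h.toLevelEmb.update (P' := {c | lam c ∈ T}) h.toConstEmb subset_rfl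
    (fun _ _ => rfl) h.mapsTo (fun _ _ hc => hc) (fun c hc hc' => absurd hc hc')
    (N := s.KDNew τ) (N' := fun _ => False) ?_ (fun _ => False.elim) ?_ (τ.level s.lev)
  · refine ⟨?_, h.lt, h.lt'⟩
    rw [atomLev_applyKD]
    simpa using this
  · intro f hf
    refine iff_false_intro ?_
    rintro ⟨a, b, hfe, hab, hm⟩
    rcases f.withEq_cases with ⟨f, rfl⟩ | ⟨a', b', rfl⟩
    · exact toEq_ne_eqAtom (f.map ρ) _ _ hfe
    · rw [eqAtom_map] at hfe
      obtain ⟨rfl, rfl⟩ := eqAtom_inj.1 hfe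
      exact hab (key _ _ (h.mapsTo _ (forall_eqAtom_args.1 hf).1) hm)
  · rintro _ ⟨a, b, rfl, hab, hm⟩
    refine forall_eqAtom_args (p := fun c => c ∈ {c | lam c ∈ T} → c ∈ ρ '' W).2 ⟨?_, ?_⟩
    · exact fun ha => absurd (key _ _ ha hm) hab
    · refine fun hb => absurd (key _ _ ?_ hm) hab
      rw [mergedEq_lam hlam h₁₂ hm]
      exact hb

omit [LinearOrder S.Pred] [LinearOrder Dom] in
theorem labelled_applyID {D : Finset (RelAtom S (Const Dom))} (hs : Inv D s)
    (hlam : Labelled s.atomLev lam) {τ : IDTrigger S Dom} (hτ : s.Has τ.fact) {ℓ : Λ}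
    (hℓ : ∀ i, lam (τ.tup i) = ℓ) :
    Labelled (s.applyID τ).atomLev (withLabel lam s.next ℓ) := by
  classical
  rw [atomLev_applyID]
  refine hlam.update (fun c hc => withLabel_of_lt fun k hk => hs.fresh_lt k (hk ▸ hc)) ?_ _
  intro f hf i j
  have hrel := fun i => withLabel_idNew hs hτ hℓ hf i
  exact (hrel i).trans (hrel j).symm

omit [LinearOrder S.Pred] in
theorem sim_applyID_stutter {D : Finset (RelAtom S (Const Dom))} (hs : Inv D s)
    (arity_pos : ∀ p, 0 < S.arity p)
    (h : Sim Q {c | lam c ∈ T} W ρ s.atomLev s.next s'.atomLev s'.next) {τ : IDTrigger S Dom}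
    (hτ : s.Has τ.fact) {ℓ : Λ} (hℓ : ∀ i, lam (τ.tup i) = ℓ) (hT : ℓ ∉ T) :
    Sim Q {c | withLabel lam s.next ℓ c ∈ T} W ρ (s.applyID τ).atomLev (s.applyID τ).next
      s'.atomLev s'.next := by
  classical
  have hold : ∀ c ∈ W, withLabel lam s.next ℓ (ρ c) = lam (ρ c) := fun c hc =>
    withLabel_of_lt (h.lt c hc)
  refine ⟨?_, fun c hc k hk => Nat.lt_add_right _ (h.lt c hc k hk), h.lt'⟩
  have := h.toLevelEmb.update (P' := {c | withLabel lam s.next ℓ c ∈ T}) h.toConstEmb subset_rfl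
    (fun _ _ => rfl) ?_ ?_ (fun c hc hc' => absurd hc hc') (N := IDNew s.next τ)
    (N' := fun _ => False) ?_ (fun _ => False.elim) ?_ (s.lev τ.fact + 1)
  · rw [atomLev_applyID]
    simpa using this
  · intro c hc
    change withLabel lam s.next ℓ (ρ c) ∈ T
    rw [hold c hc]
    exact h.mapsTo c hc
  · intro c hc hcP
    change withLabel lam s.next ℓ c ∈ T at hcP
    rwa [withLabel_of_lt fun k hk => hs.fresh_lt k (hk ▸ hc)] at hcP
  · intro f hf
    refine iff_false_intro fun hfe => hT ?_
    have j : Fin (S.withEq.arity f.pred) := ⟨0, withEq_arity_pos arity_pos _⟩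
    have e := withLabel_idNew hs hτ hℓ hfe j
    rw [← e]
    change withLabel lam s.next ℓ (ρ (f.args j)) ∈ T
    rw [hold _ (hf j)]
    exact h.mapsTo _ (hf j)
  · intro f hf i hi
    exact absurd ((withLabel_idNew hs hτ hℓ hf i) ▸ hi) hT

omit [LinearOrder S.Pred] in
theorem sim_applyID {D : Finset (RelAtom S (Const Dom))} (hs : Inv D s)
    (h : Sim Q {c | lam c ∈ T} W ρ s.atomLev s.next s'.atomLev s'.next) {τ : IDTrigger S Dom}
    (hτ : s'.Has τ.fact) {ℓ : Λ} (hT : ℓ ∈ T) :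
    Sim Q {c | withLabel lam s.next ℓ c ∈ T} (addFresh W s'.next (S.arity τ.dep.tgt))
      (extendFresh ρ s'.next s.next) (s.applyID (τ.map ρ)).atomLev (s.applyID (τ.map ρ)).next
      (s'.applyID τ).atomLev (s'.applyID τ).next := by
  classical
  have hτW : ∀ i, τ.tup i ∈ W := (levelEmb_lev h.toLevelEmb).mem_of_ne_top hτ
  have hW : ∀ c ∈ W, extendFresh ρ s'.next s.next c = ρ c := fun c hc =>
    extendFresh_of_lt fun k hk => h.lt' k (hk ▸ hc)
  have emb := h.toConstEmb.extendFresh h.lt h.lt' (S.arity τ.dep.tgt)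
  have hmap := τ.dep.newTuple_map (ρ := ρ) (m := s.next) (m' := s'.next) (t := τ.tup)
    (fun i k hk => h.lt' k (hk ▸ hτW i))
  have hnew : (τ.newFact s'.next).toEq.map (extendFresh ρ s'.next s.next) =
      ((τ.map ρ).newFact s.next).toEq :=
    congrArg (fun t => RelAtom.toEq ⟨τ.dep.tgt, t⟩) hmap
  have hnewEq : ∀ j : ℕ, (eqAtom (Const.fresh (s'.next + j)) (Const.fresh (s'.next + j)) :
      RelAtom S.withEq (Const Dom)).map (extendFresh ρ s'.next s.next) =
      eqAtom (Const.fresh (s.next + j)) (Const.fresh (s.next + j)) := fun j => by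
    rw [eqAtom_map, extendFresh_add]
  have hact : ∀ f, IDNew s'.next τ f → ∀ i, f.args i ∈ addFresh W s'.next (S.arity τ.dep.tgt) := by
    intro f hf i
    rcases idNew_args hf i with ⟨j, hj⟩ | ⟨j, hj⟩
    · rw [hj]; exact Or.inl (hτW j)
    · exact Or.inr ⟨j, j.isLt, hj⟩
  have hlift : ∀ f, IDNew s.next (τ.map ρ) f →
      ∃ g, IDNew s'.next τ g ∧ g.map (extendFresh ρ s'.next s.next) = f := by
    rintro f (rfl | ⟨j, hj, rfl⟩)
    · exact ⟨_, Or.inl rfl, hnew⟩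
    · exact ⟨_, Or.inr ⟨j, hj, rfl⟩, hnewEq j⟩
  refine ⟨?_, ?_, ?_⟩
  · have := h.toLevelEmb.update (P' := {c | withLabel lam s.next ℓ c ∈ T}) emb
      (fun c hc => Or.inl hc) hW ?_ ?_ ?_ (N := IDNew s.next (τ.map ρ))
      (N' := IDNew s'.next τ) ?_ hact ?_ (s.lev (τ.map ρ).fact + 1)
    · rw [atomLev_applyID, atomLev_applyID, ← (levelEmb_lev h.toLevelEmb).lev_eq τ.fact hτW]
      exact this
    · rintro c (hc | ⟨j, -, rfl⟩)
      · change withLabel lam s.next ℓ _ ∈ T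
        rw [hW c hc, withLabel_of_lt (h.lt c hc)]
        exact h.mapsTo c hc
      · change withLabel lam s.next ℓ _ ∈ T
        rwa [extendFresh_add, withLabel_add]
    · intro c hc hcP
      change withLabel lam s.next ℓ c ∈ T at hcP
      rwa [withLabel_of_lt fun k hk => hs.fresh_lt k (hk ▸ hc)] at hcP
    · rintro c (hc | ⟨j, -, rfl⟩) hcW
      · exact absurd hc hcW
      · rw [extendFresh_add]
        exact fun ha => (Nat.le_add_right s.next j).not_gt (hs.fresh_lt _ ha)
    · intro f hf
      constructor
      · intro hn
        obtain ⟨g, hg, hgf⟩ := hlift _ hn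
        rwa [← RelAtom.map_injOn emb.strictMono.injOn (hact g hg) hf hgf]
      · rintro (rfl | ⟨j, hj, rfl⟩)
        · exact Or.inl hnew
        · exact Or.inr ⟨j, hj, hnewEq j⟩
    · intro f hf i _
      obtain ⟨g, hg, rfl⟩ := hlift f hf
      exact ⟨_, hact g hg i, rfl⟩
  · rintro c (hc | ⟨j, hj, rfl⟩) k hk
    · rw [hW c hc] at hk
      exact Nat.lt_add_right _ (h.lt c hc k hk)
    · rw [extendFresh_add] at hk
      rw [← Const.fresh_injective hk]
      exact Nat.add_lt_add_left hj _
  · rintro k (hk | ⟨j, hj, hjk⟩)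
    · exact Nat.lt_add_right _ (h.lt' k hk)
    · rw [Const.fresh_injective hjk]
      exact Nat.add_lt_add_left hj _

/-- The reasoning is that of `ChaseState.sim_step`. Agreement on the key now holds up to `eq`, which
still forces a common label because `eq` atoms are labelled too. -/
theorem sim_step [Finite S.Pred] (tame : TameDeps I K) {D : Finset (RelAtom S (Const Dom))}
    (hs : Inv D s) (hlam : Labelled s.atomLev lam) {s₁ : EqChaseState S Dom}
    (hstep : step I K s = some s₁) :
    ∃ lam' : Const Dom → Λ, Labelled s₁.atomLev lam' ∧
      ∀ (T : Set Λ) W ρ (s' : EqChaseState S Dom),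
      Sim Q {c | lam c ∈ T} W ρ s.atomLev s.next s'.atomLev s'.next →
      ∃ W' ρ' s₁', (s₁' = s' ∨ step I K s' = some s₁') ∧
        Sim Q {c | lam' c ∈ T} W' ρ' s₁.atomLev s₁.next s₁'.atomLev s₁'.next := by
  rcases step_cases hstep with ⟨τ, hτ, hclash, rfl⟩ | ⟨hK, ⟨τ, hτ, rfl⟩ | rfl⟩
  · obtain ⟨i₀, hi₀⟩ := tame.attrs_nonempty _ hτ.1.1
    have h₁ : ∀ i, lam (τ.fst i) = lam (τ.fst i₀) := fun i => hlam τ.fact₁.toEq hτ.1.2.1 i i₀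
    have h₂ : ∀ i, lam (τ.snd i) = lam (τ.fst i₀) := fun i =>
      (hlam τ.fact₂.toEq hτ.1.2.2.1 i i₀).trans (hasEq_lam hlam (hτ.1.2.2.2.2.1 i₀ hi₀)).symm
    have h₁₂ : ∀ i, lam (τ.fst i) = lam (τ.snd i) := fun i => (h₁ i).trans (h₂ i).symm
    refine ⟨lam, labelled_applyKD hlam h₁₂, fun T W ρ s' h => ?_⟩
    have hl := levelEmb_lev h.toLevelEmb
    by_cases hT : lam (τ.fst i₀) ∈ T
    · obtain ⟨d, t, t'⟩ := τ
      obtain ⟨u, hu, rfl⟩ : ∃ u : Fin (S.arity d.rel) → Const Dom, (∀ i, u i ∈ W) ∧ ρ ∘ u = t :=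
        hl.lift_args (fun i => Active.of_mem hτ.1.2.1 i)
          (fun i => by simpa only [Set.mem_ofPred_eq, h₁] using hT)
      obtain ⟨v, hv, rfl⟩ : ∃ v : Fin (S.arity d.rel) → Const Dom, (∀ i, v i ∈ W) ∧ ρ ∘ v = t' :=
        hl.lift_args (fun i => Active.of_mem hτ.1.2.2.1 i)
          (fun i => by simpa only [Set.mem_ofPred_eq, h₂] using hT)
      have hfirst := first_KD_of_map h.toLevelEmb (τ := ⟨d, u, v⟩) hu hv hτ
      have hsim := sim_applyKD hlam h hfirst.1.2.1 hfirst.1.2.2.1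
      -- A clash in the smaller chase would be mapped to a clash in the larger one, whose step did
      -- not fail.
      exact ⟨W, ρ, _, Or.inr (step_of_first_KD hfirst
        fun hc => hclash (clash_of_clash hsim.toLevelEmb hc)), hsim⟩
    · exact ⟨W, ρ, s', Or.inl rfl, sim_applyKD_stutter hs hlam h (fun i => (h₁ i).symm ▸ hT)
        (fun i => (h₂ i).symm ▸ hT) h₁₂⟩
  · have hpos := tame.arity_pos τ.dep.src
    have hℓ : ∀ i, lam (τ.tup i) = lam (τ.tup ⟨0, hpos⟩) := fun i =>
      hlam τ.fact.toEq hτ.1.2.1 i _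
    refine ⟨_, labelled_applyID hs hlam hτ.1.2.1 hℓ, fun T W ρ s' h => ?_⟩
    have hl := levelEmb_lev h.toLevelEmb
    by_cases hT : lam (τ.tup ⟨0, hpos⟩) ∈ T
    · obtain ⟨d, t⟩ := τ
      obtain ⟨u, hu, rfl⟩ : ∃ u : Fin (S.arity d.src) → Const Dom, (∀ i, u i ∈ W) ∧ ρ ∘ u = t :=
        hl.lift_args (fun i => Active.of_mem hτ.1.2.1 i)
          (fun i => by simpa only [Set.mem_ofPred_eq, hℓ] using hT)
      have hfirst := first_ID_of_map tame hlam h.toLevelEmb (τ := ⟨d, u⟩) hu hτ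
      refine ⟨_, _, _, Or.inr (step_of_first_ID ?_ hfirst),
        sim_applyID hs h (τ := ⟨d, u⟩) hfirst.1.2.1 hT⟩
      rintro ⟨τ', hτ'⟩
      refine hK (KDTrigger.exists_first hs.finite (fun τ h => ⟨h.2.1, h.2.2.1⟩)
        (τ := τ'.map ρ) ?_)
      exact (kdApplicable_map h.toLevelEmb (hl.mem_of_ne_top hτ'.1.2.1)
        (hl.mem_of_ne_top hτ'.1.2.2.1)).2 hτ'.1
    · exact ⟨W, ρ, s', Or.inl rfl, sim_applyID_stutter hs tame.arity_pos h hτ.1.2.1 hℓ hT⟩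
  · exact ⟨lam, hlam, fun T W ρ s' h => ⟨W, ρ, s', Or.inl rfl, h⟩⟩

omit [LinearOrder S.Pred] [LinearOrder Dom] in
theorem labelled_init {D : Finset (RelAtom S (Const Dom))} (hlam : DbLabelled D lam) :
    Labelled (init D).atomLev lam := by
  intro g hg
  rcases g.withEq_cases with ⟨f, rfl⟩ | ⟨a, b, rfl⟩
  · refine hlam f (by_contra fun hf => hg ?_)
    exact if_neg hf
  · have h : (init D).HasEq a b := hg
    exact eqAtom_lam (congrArg lam (hasEq_init.1 h).1)

omit [LinearOrder S.Pred] in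
theorem sim_init {D D' : Finset (RelAtom S (Const Dom))} (hlam : DbLabelled D lam)
    (h : DbEmb Q ρ D' (labelled D lam T)) :
    Sim Q {c | lam c ∈ T} (constsOf D') ρ (init D).atomLev (init D).next
      (init D').atomLev (init D').next := by
  classical
  have h₀ := ChaseState.sim_init hlam h
  refine ⟨⟨h.toConstEmb, h₀.mapsTo, fun c hc => active_init.1 hc,
    fun c hc => h₀.cover c (ChaseState.active_init.2 (active_init.1 hc)), ?_⟩, h₀.lt, h₀.lt'⟩
  intro g hg
  rcases g.withEq_cases with ⟨f, rfl⟩ | ⟨a, b, rfl⟩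
  · exact h₀.lev_eq f hg
  · obtain ⟨ha, hb⟩ := forall_eqAtom_args.1 hg
    have hρ : ρ a ∈ constsOf D := by
      obtain ⟨f, hf, i, rfl⟩ := ha
      exact ⟨f.map ρ, ((h.image _).2 ⟨f, hf, rfl⟩).1, i, rfl⟩
    have e : ρ a = ρ b ↔ a = b := h.strictMono.injOn.eq_iff ha hb
    rw [eqAtom_map]
    have hinit : ∀ (D : Finset (RelAtom S (Const Dom))) a b, (init D).atomLev (eqAtom a b) =
        if a = b ∧ a ∈ constsOf D then (0 : ℕ∞) else ⊤ := fun D a b => by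
      change (init D).eqLev a b = _
      simp only [init]
      congr
    simp only [hinit, e, hρ, ha, and_true]

end Simulation

end EqChaseState

/-! ## Runs of levelled sets of atoms -/

universe u

section Run

variable {S S' : RelSchema} {Dom : Type u}

/-- A sequence of levelled sets of atoms over `S'` for each database over `S`. -/
abbrev LevelRun (S S' : RelSchema) (Dom : Type u) : Type u :=
  Finset (RelAtom S (Const Dom)) → ℕ → Option (RelAtom S' (Const Dom) → ℕ∞)

/-- The atoms that from some moment on are present at a fixed level which is at most `ℓ`. -/
def LevelRun.upTo (run : LevelRun S S' Dom) (D : Finset (RelAtom S (Const Dom))) (ℓ : ℕ) :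
    Set (RelAtom S' (Const Dom)) :=
  {f | ∃ k : ℕ, k ≤ ℓ ∧ ∀ᶠ n in Filter.atTop, ∃ L, run D n = some L ∧ L f = k}

/-- The properties of chases that bound the levels of answers: each step maps atoms to atoms of at
most the same level, no non-fresh constants are invented, and the run of a database simulates those
of isomorphic copies of its labelled parts. -/
structure LevelRun.Regular [LinearOrder Dom] (run : LevelRun S S' Dom) : Prop where
  push : ∀ D n L', run D (n + 1) = some L' → ∃ L, run D n = some L ∧
    ∃ σ : Const Dom → Const Dom, (∀ d, σ (Const.dom d) = Const.dom d) ∧ (∀ c, σ c ≤ c) ∧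
      ∀ f, L' (f.map σ) ≤ L f
  dom_mem : ∀ D n L, run D n = some L → ∀ d, Active L (Const.dom d) → Const.dom d ∈ constsOf D
  sim : ∀ (Q : Set Dom) (Λ : Type u) D (lam₀ : Const Dom → Λ), DbLabelled D lam₀ →
    ∀ n L, run D n = some L → ∃ lam : Const Dom → Λ, Labelled L lam ∧
      ∀ T D' ρ₀, DbEmb Q ρ₀ D' (labelled D lam₀ T) →
        ∃ n' L' W ρ, run D' n' = some L' ∧ LevelEmb Q {c | lam c ∈ T} W ρ L L'

variable [LinearOrder S.Pred] [LinearOrder Dom] {I : Set (InclDep S)} {K : Set (KeyDep S)}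

/-- The chase as a run. -/
noncomputable def chaseRun (I : Set (InclDep S)) (K : Set (KeyDep S)) : LevelRun S S Dom :=
  fun D n => (chaseSeq I K D n).map ChaseState.lev

/-- The chase with equality as a run. -/
noncomputable def eqChaseRun (I : Set (InclDep S)) (K : Set (KeyDep S)) :
    LevelRun S S.withEq Dom :=
  fun D n => (eqChaseSeq I K D n).map EqChaseState.atomLev

theorem chaseUpTo_eq (D : Finset (RelAtom S (Const Dom))) (ℓ : ℕ) :
    chaseUpTo I K D ℓ = (chaseRun I K).upTo D ℓ := by
  ext f
  simp only [chaseUpTo, LevelRun.upTo, chaseRun, Option.map_eq_some_iff, Set.mem_ofPred_eq,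
    exists_exists_and_eq_and]

theorem eqChaseUpTo_eq (D : Finset (RelAtom S (Const Dom))) (ℓ : ℕ) :
    eqChaseUpTo I K D ℓ = (eqChaseRun I K).upTo D ℓ := by
  ext f
  simp only [eqChaseUpTo, LevelRun.upTo, eqChaseRun, Option.map_eq_some_iff, Set.mem_ofPred_eq,
    exists_exists_and_eq_and]

/-! ### Invariants and simulation along whole runs -/

theorem chaseSeq_inv {D : Finset (RelAtom S (Const Dom))} :
    ∀ {n : ℕ} {s : ChaseState S Dom}, chaseSeq I K D n = some s → ChaseState.Inv D s
  | 0, s, h => by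
    obtain rfl := Option.some.inj h
    exact ChaseState.inv_init D
  | n + 1, s, h => by
    obtain ⟨s₀, h₀, h₁⟩ := Option.bind_eq_some_iff.1 h
    exact (chaseSeq_inv h₀).step h₁

theorem eqChaseSeq_inv {D : Finset (RelAtom S (Const Dom))} :
    ∀ {n : ℕ} {s : EqChaseState S Dom}, eqChaseSeq I K D n = some s → EqChaseState.Inv D s
  | 0, s, h => by
    obtain rfl := Option.some.inj h
    exact EqChaseState.inv_init D
  | n + 1, s, h => by
    obtain ⟨s₀, h₀, h₁⟩ := Option.bind_eq_some_iff.1 h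
    exact (eqChaseSeq_inv h₀).step h₁

/-- Iterates `ChaseState.sim_step`. The index `n'` depends on `T`: it does not advance at the steps
at which the smaller chase rests. -/
theorem chaseSeq_sim [Finite S.Pred] (tame : TameDeps I K) (Q : Set Dom) {Λ : Type*}
    {D : Finset (RelAtom S (Const Dom))} {lam₀ : Const Dom → Λ} (hlam : DbLabelled D lam₀) :
    ∀ (n : ℕ) (s : ChaseState S Dom), chaseSeq I K D n = some s →
      ∃ lam : Const Dom → Λ, Labelled s.lev lam ∧
      ∀ T D' ρ₀, DbEmb Q ρ₀ D' (labelled D lam₀ T) → ∃ n' s' W ρ, chaseSeq I K D' n' = some s' ∧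
        Sim Q {c | lam c ∈ T} W ρ s.lev s.next s'.lev s'.next
  | 0, s, h => by
    obtain rfl := Option.some.inj h
    refine ⟨lam₀, fun f hf => hlam f (by simpa [ChaseState.init] using hf), fun T D' ρ₀ hρ => ?_⟩
    exact ⟨0, _, _, ρ₀, rfl, ChaseState.sim_init hlam hρ⟩
  | n + 1, s, h => by
    obtain ⟨s₀, h₀, h₁⟩ := Option.bind_eq_some_iff.1 h
    obtain ⟨lam, hl, hsim⟩ := chaseSeq_sim tame Q hlam n s₀ h₀
    obtain ⟨lam', hl', hstep⟩ := ChaseState.sim_step (Q := Q) tame (chaseSeq_inv h₀) hl h₁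
    refine ⟨lam', hl', fun T D' ρ₀ hρ => ?_⟩
    obtain ⟨n', s', W, ρ, hs', hS⟩ := hsim T D' ρ₀ hρ
    obtain ⟨W', ρ', s₁', rfl | hs₁', hS'⟩ := hstep T W ρ s' hS
    · exact ⟨n', _, W', ρ', hs', hS'⟩
    · exact ⟨n' + 1, s₁', W', ρ', Option.bind_eq_some_iff.2 ⟨s', hs', hs₁'⟩, hS'⟩

theorem eqChaseSeq_sim [Finite S.Pred] (tame : TameDeps I K) (Q : Set Dom) {Λ : Type*}
    {D : Finset (RelAtom S (Const Dom))} {lam₀ : Const Dom → Λ} (hlam : DbLabelled D lam₀) :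
    ∀ (n : ℕ) (s : EqChaseState S Dom), eqChaseSeq I K D n = some s →
      ∃ lam : Const Dom → Λ, Labelled s.atomLev lam ∧
      ∀ T D' ρ₀, DbEmb Q ρ₀ D' (labelled D lam₀ T) → ∃ n' s' W ρ, eqChaseSeq I K D' n' = some s' ∧
        Sim Q {c | lam c ∈ T} W ρ s.atomLev s.next s'.atomLev s'.next
  | 0, s, h => by
    obtain rfl := Option.some.inj h
    refine ⟨lam₀, EqChaseState.labelled_init hlam, fun T D' ρ₀ hρ => ?_⟩
    exact ⟨0, _, _, ρ₀, rfl, EqChaseState.sim_init hlam hρ⟩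
  | n + 1, s, h => by
    obtain ⟨s₀, h₀, h₁⟩ := Option.bind_eq_some_iff.1 h
    obtain ⟨lam, hl, hsim⟩ := eqChaseSeq_sim tame Q hlam n s₀ h₀
    obtain ⟨lam', hl', hstep⟩ := EqChaseState.sim_step (Q := Q) tame (eqChaseSeq_inv h₀) hl h₁
    refine ⟨lam', hl', fun T D' ρ₀ hρ => ?_⟩
    obtain ⟨n', s', W, ρ, hs', hS⟩ := hsim T D' ρ₀ hρ
    obtain ⟨W', ρ', s₁', rfl | hs₁', hS'⟩ := hstep T W ρ s' hS
    · exact ⟨n', _, W', ρ', hs', hS'⟩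
    · exact ⟨n' + 1, s₁', W', ρ', Option.bind_eq_some_iff.2 ⟨s', hs', hs₁'⟩, hS'⟩

theorem chaseRun_regular [Finite S.Pred] (tame : TameDeps I K) :
    (chaseRun I K : LevelRun S S Dom).Regular where
  push D n L' h := by
    obtain ⟨s', hs', rfl⟩ := Option.map_eq_some_iff.1 h
    obtain ⟨s, hs, hstep⟩ := Option.bind_eq_some_iff.1 hs'
    exact ⟨s.lev, Option.map_eq_some_iff.2 ⟨s, hs, rfl⟩, ChaseState.step_push tame hstep⟩
  dom_mem D n L h := by
    obtain ⟨s, hs, rfl⟩ := Option.map_eq_some_iff.1 h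
    exact (chaseSeq_inv hs).dom_mem
  sim Q Λ D lam₀ hlam n L h := by
    obtain ⟨s, hs, rfl⟩ := Option.map_eq_some_iff.1 h
    obtain ⟨lam, hl, hsim⟩ := chaseSeq_sim tame Q hlam n s hs
    refine ⟨lam, hl, fun T D' ρ₀ hρ => ?_⟩
    obtain ⟨n', s', W, ρ, hs', hS⟩ := hsim T D' ρ₀ hρ
    exact ⟨n', s'.lev, W, ρ, Option.map_eq_some_iff.2 ⟨s', hs', rfl⟩, hS.toLevelEmb⟩

theorem eqChaseRun_regular [Finite S.Pred] (tame : TameDeps I K) :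
    (eqChaseRun I K : LevelRun S S.withEq Dom).Regular where
  push D n L' h := by
    obtain ⟨s', hs', rfl⟩ := Option.map_eq_some_iff.1 h
    obtain ⟨s, hs, hstep⟩ := Option.bind_eq_some_iff.1 hs'
    exact ⟨s.atomLev, Option.map_eq_some_iff.2 ⟨s, hs, rfl⟩, id, fun _ => rfl, fun _ => le_rfl,
      EqChaseState.step_push tame (eqChaseSeq_inv hs) hstep⟩
  dom_mem D n L h := by
    obtain ⟨s, hs, rfl⟩ := Option.map_eq_some_iff.1 h
    exact (eqChaseSeq_inv hs).dom_mem
  sim Q Λ D lam₀ hlam n L h := by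
    obtain ⟨s, hs, rfl⟩ := Option.map_eq_some_iff.1 h
    obtain ⟨lam, hl, hsim⟩ := eqChaseSeq_sim tame Q hlam n s hs
    refine ⟨lam, hl, fun T D' ρ₀ hρ => ?_⟩
    obtain ⟨n', s', W, ρ, hs', hS⟩ := hsim T D' ρ₀ hρ
    exact ⟨n', s'.atomLev, W, ρ, Option.map_eq_some_iff.2 ⟨s', hs', rfl⟩, hS.toLevelEmb⟩

end Run

/-! ## Finitely many types of databases -/

theorem exists_strictMonoOn_fin {α : Type*} [LinearOrder α] (X : Finset α) {N : ℕ}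
    (h : X.card ≤ N) (hN : 0 < N) : ∃ r : α → Fin N, StrictMonoOn r X := by
  classical
  refine ⟨fun c => if hc : c ∈ X then Fin.castLE h ((X.orderIsoOfFin rfl).symm ⟨c, hc⟩)
    else ⟨0, hN⟩, fun a ha b hb hab => ?_⟩
  rw [Finset.mem_coe] at ha hb
  simp only [ha, hb, dif_pos]
  rw [Fin.castLE_lt_castLE_iff, OrderIso.lt_iff_lt]
  exact hab

theorem ncard_constsOf_le {S : RelSchema} {Dom : Type*} (D : Finset (RelAtom S (Const Dom)))
    {a : ℕ} (ha : ∀ p, S.arity p ≤ a) : (constsOf_finite D).toFinset.card ≤ D.card * a := by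
  classical
  have : (constsOf_finite D).toFinset ⊆ D.biUnion fun f => Finset.univ.image f.args := by
    intro c hc
    obtain ⟨f, hf, i, rfl⟩ := (constsOf_finite D).mem_toFinset.1 hc
    exact Finset.mem_biUnion.2 ⟨f, hf, Finset.mem_image_of_mem _ (Finset.mem_univ _)⟩
  refine (Finset.card_le_card this).trans (Finset.card_biUnion_le_card_mul _ _ _ fun f _ => ?_)
  exact Finset.card_image_le.trans (by simpa using ha f.pred)

/-- The isomorphism type of a database whose constants are numbered by `r`. -/
def dbType {S : RelSchema} {Dom : Type*} (Q : Set Dom) {N : ℕ} (D : Finset (RelAtom S (Const Dom)))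
    (r : Const Dom → Fin N) : Set (RelAtom S (Fin N)) × Set (Fin N) × (Q → Set (Fin N)) :=
  ({g | ∃ f ∈ D, f.map r = g}, {j | ∃ d, Const.dom d ∈ constsOf D ∧ r (Const.dom d) = j},
    fun d => {j | Const.dom d.1 ∈ constsOf D ∧ r (Const.dom d.1) = j})

/-- The embedding is `r₁` followed by the inverse of `r₂`. Equality of the first components matches
the facts, of the second the non-fresh constants, and of the third the constants in `Q`. -/
theorem dbEmb_of_dbType_eq {S : RelSchema} {Dom : Type*} [LinearOrder Dom] {Q : Set Dom} {N : ℕ}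
    {D₁ D₂ : Finset (RelAtom S (Const Dom))} {r₁ r₂ : Const Dom → Fin N}
    (h₁ : StrictMonoOn r₁ (constsOf D₁)) (h₂ : StrictMonoOn r₂ (constsOf D₂))
    (h : dbType Q D₁ r₁ = dbType Q D₂ r₂) : ∃ ρ, DbEmb Q ρ D₁ D₂ := by
  simp only [dbType, Prod.mk.injEq, Set.ext_iff, Set.mem_ofPred_eq, funext_iff, Subtype.forall] at h
  obtain ⟨hF, hdom, hQ⟩ := h
  have hex : ∀ c ∈ constsOf D₁, ∃ c' ∈ constsOf D₂, r₂ c' = r₁ c := by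
    rintro _ ⟨f, hf, i, rfl⟩
    obtain ⟨g, hg, hgf⟩ := (hF (f.map r₁)).1 ⟨f, hf, rfl⟩
    obtain ⟨p, a⟩ := f
    obtain ⟨p', b⟩ := g
    obtain ⟨rfl, hab⟩ := (RelAtom.mk.injEq ..).mp hgf
    exact ⟨b i, ⟨_, hg, i, rfl⟩, congrFun (eq_of_heq hab) i⟩
  have hne : Nonempty (Const Dom → Const Dom) := ⟨id⟩
  choose! ρ hρ hr using hex
  refine ⟨ρ, ⟨?_, ?_, ?_⟩, ?_⟩
  · intro a ha b hb hab
    rw [← h₂.lt_iff_lt (hρ a ha) (hρ b hb), hr a ha, hr b hb]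
    exact h₁ ha hb hab
  · intro c hc
    constructor
    · rintro ⟨d, hd⟩
      obtain ⟨d', hd', e⟩ := (hdom (r₁ c)).2 ⟨d, hd ▸ hρ c hc, hd ▸ hr c hc⟩
      exact ⟨d', h₁.injOn hc hd' e.symm⟩
    · rintro ⟨d, rfl⟩
      obtain ⟨d', hd', e⟩ := (hdom (r₁ (Const.dom d))).1 ⟨d, hc, rfl⟩
      exact ⟨d', h₂.injOn (hρ _ hc) hd' ((hr _ hc).trans e.symm)⟩
  · intro d hd c hc
    constructor
    · intro hcd
      obtain ⟨hd', e⟩ := (hQ d hd (r₁ c)).2 ⟨hcd ▸ hρ c hc, hcd ▸ hr c hc⟩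
      exact h₁.injOn hc hd' e.symm
    · rintro rfl
      obtain ⟨hd', e⟩ := (hQ d hd (r₁ (Const.dom d))).1 ⟨hc, rfl⟩
      exact h₂.injOn (hρ _ hc) hd' ((hr _ hc).trans e.symm)
  · have hmap : ∀ f ∈ D₁, (f.map ρ).map r₂ = f.map r₁ := fun f hf =>
      RelAtom.map_congr (σ := r₂ ∘ ρ) fun i => hr _ ⟨f, hf, i, rfl⟩
    have huniq : ∀ f ∈ D₁, ∀ g ∈ D₂, g.map r₂ = f.map r₁ → f.map ρ = g := fun f hf g hg e =>
      RelAtom.map_injOn h₂.injOn (f := f.map ρ) (fun i => hρ _ ⟨f, hf, i, rfl⟩)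
        (fun i => ⟨g, hg, i, rfl⟩) ((hmap f hf).trans e.symm)
    intro g
    constructor
    · intro hg
      obtain ⟨f, hf, e⟩ := (hF (g.map r₂)).2 ⟨g, hg, rfl⟩
      exact ⟨f, hf, huniq f hf g hg e.symm⟩
    · rintro ⟨f, hf, rfl⟩
      obtain ⟨g, hg, e⟩ := (hF (f.map r₁)).1 ⟨f, hf, rfl⟩
      rwa [huniq f hf g hg e]

/-- Up to isomorphism there are finitely many databases of a given size. -/
theorem exists_finite_representatives {S : RelSchema} [Finite S.Pred] {Dom : Type*}
    [LinearOrder Dom] {Q : Set Dom} (hQ : Q.Finite) (M : ℕ) :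
    ∃ R : Set (Finset (RelAtom S (Const Dom))), R.Finite ∧
      ∀ D : Finset (RelAtom S (Const Dom)), D.card ≤ M → ∃ D' ∈ R, ∃ ρ, DbEmb Q ρ D' D := by
  classical
  obtain ⟨a, ha⟩ : ∃ a, ∀ p, S.arity p ≤ a := by
    obtain ⟨a, ha⟩ := (Set.finite_range S.arity).bddAbove
    exact ⟨a, fun p => ha ⟨p, rfl⟩⟩
  -- At most `M * a` constants occur; the additional one makes `Fin N` nonempty, so that constants
  -- outside the database can be given a value.
  set N := M * a + 1
  have hr : ∀ D : Finset (RelAtom S (Const Dom)), D.card ≤ M →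
      ∃ r : Const Dom → Fin N, StrictMonoOn r (constsOf D) := by
    intro D hD
    obtain ⟨r, hr⟩ := exists_strictMonoOn_fin (constsOf_finite D).toFinset (N := N)
      ((ncard_constsOf_le D ha).trans ((Nat.mul_le_mul_right a hD).trans (Nat.le_succ _)))
      (Nat.succ_pos _)
    exact ⟨r, by simpa using hr⟩
  have hne : Nonempty (Const Dom → Fin N) := ⟨fun _ => ⟨0, Nat.succ_pos _⟩⟩
  choose! r hr using hr
  have : Finite Q := hQ
  have : Finite (RelAtom S (Fin N)) := by
    refine Finite.of_injective
      (fun f : RelAtom S (Fin N) =>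
        (⟨f.pred, f.args⟩ : (p : S.Pred) × (Fin (S.arity p) → Fin N))) ?_
    rintro ⟨p, a⟩ ⟨p', b⟩ h
    simpa using h
  -- One database is selected for each type that occurs; there are finitely many types.
  obtain ⟨R, hR, hbij⟩ := Set.exists_subset_bijOn {D : Finset (RelAtom S (Const Dom)) | D.card ≤ M}
    (fun D => dbType Q D (r D))
  refine ⟨R, ?_, fun D hD => ?_⟩
  · exact Set.Finite.of_finite_image (Set.toFinite _) hbij.injOn
  · obtain ⟨D', hD', e⟩ := hbij.surjOn ⟨D, hD, rfl⟩
    exact ⟨D', hD', dbEmb_of_dbType_eq (hr D' (hR hD')) (hr D hD) e⟩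

/-! ## Components of the join graph -/

/-- Two facts that share a constant are equal or adjacent, so the component of any fact containing a
constant can be its label; `none` is left for constants that do not occur. Since arities are
positive, every fact has a label, and the facts with one label form at most one component. -/
theorem exists_labelling {S : RelSchema} {Dom : Type u} (hS : ∀ p, 0 < S.arity p)
    (D : Finset (RelAtom S (Const Dom))) : ∃ (Λ : Type u) (lam : Const Dom → Λ), DbLabelled D lam ∧
      ∀ T : Finset Λ, ∃ D' : Finset (RelAtom S (Const Dom)), (D' : Set _) = labelled D lam T ∧
        D'.card ≤ connSize D * T.card := by
  classical
  let lam : Const Dom → Option (joinGraph D).ConnectedComponent := fun c =>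
    if h : ∃ f : D, ∃ i, f.1.args i = c then some ((joinGraph D).connectedComponentMk h.choose)
    else none
  have hlam : ∀ f (hf : f ∈ D) i,
      lam (f.args i) = some ((joinGraph D).connectedComponentMk ⟨f, hf⟩) := by
    intro f hf i
    have h : ∃ g : D, ∃ j, g.1.args j = f.args i := ⟨⟨f, hf⟩, i, rfl⟩
    obtain ⟨j, hj⟩ := h.choose_spec
    simp only [lam, dif_pos h, Option.some.injEq]
    by_cases he : h.choose = ⟨f, hf⟩
    · rw [he]
    · exact SimpleGraph.ConnectedComponent.connectedComponentMk_eq_of_adj ⟨he, j, i, hj⟩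
  refine ⟨_, lam, fun f hf i j => by rw [hlam f hf, hlam f hf], fun T => ?_⟩
  refine ⟨D.filter fun f => ∀ i, lam (f.args i) ∈ T, by ext; simp [labelled], ?_⟩
  refine Finset.card_le_mul_card_image_of_maps_to (f := fun f => lam (f.args ⟨0, hS _⟩))
    ?_ _ fun b hb => ?_
  · intro f hf
    exact (Finset.mem_filter.1 (Finset.mem_coe.1 hf)).2 _
  rcases b with _ | c
  · refine (Finset.card_eq_zero.2 (Finset.filter_eq_empty_iff.2 fun f hf he => ?_)).trans_le
      (Nat.zero_le _)
    rw [hlam f (Finset.mem_filter.1 hf).1] at he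
    exact Option.some_ne_none _ he
  -- `connSize` is a supremum of natural numbers, which bounds its terms only if they are bounded;
  -- there are finitely many components.
  · have hbdd : BddAbove (Set.range fun c : (joinGraph D).ConnectedComponent => c.supp.ncard) :=
      (Set.finite_range _).bddAbove
    refine le_trans ?_ (le_ciSup hbdd c)
    rw [← Set.ncard_image_of_injective _ Subtype.val_injective, ← Set.ncard_coe_finset]
    refine Set.ncard_le_ncard ?_ (Set.toFinite _)
    intro f hf
    obtain ⟨hf, he⟩ := Finset.mem_filter.1 (Finset.mem_coe.1 hf)
    have hfD := (Finset.mem_filter.1 hf).1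
    rw [hlam f hfD] at he
    exact ⟨⟨f, hfD⟩, Option.some.inj he, rfl⟩

/-! ## Homomorphisms -/

theorem QTerm.eval_comp {Dom V : Type*} {σ : Const Dom → Const Dom} {μ : V → Const Dom}
    {u : QTerm Dom V} (h : ∀ d, u = QTerm.const d → σ (Const.dom d) = Const.dom d) :
    u.eval (σ ∘ μ) = σ (u.eval μ) := by
  cases u with
  | var x => rfl
  | const d => exact (h d rfl).symm

theorem RelAtom.map_eval_comp {S : RelSchema} {Dom V : Type*} {σ : Const Dom → Const Dom}
    {μ : V → Const Dom} {A : RelAtom S (QTerm Dom V)}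
    (h : ∀ i d, A.args i = QTerm.const d → σ (Const.dom d) = Const.dom d) :
    A.map (QTerm.eval (σ ∘ μ)) = (A.map (QTerm.eval μ)).map σ :=
  RelAtom.map_congr (σ := QTerm.eval (σ ∘ μ)) (τ := σ ∘ QTerm.eval μ) fun i =>
    QTerm.eval_comp (h i)

theorem Antitone.eventually_eq {α : Type*} [PartialOrder α] [WellFoundedLT α] {f : ℕ → α}
    (hf : Antitone f) : ∃ n, ∀ m, n ≤ m → f m = f n := by
  obtain ⟨_, ⟨n, rfl⟩, hn⟩ := WellFounded.has_min (wellFounded_lt (α := α)) (Set.range f)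
    ⟨_, 0, rfl⟩
  exact ⟨n, fun m hm => (hf hm).eq_of_not_lt (hn _ ⟨m, rfl⟩)⟩

/-! ### Limits of homomorphisms along a run -/

section Stabilise

variable {S : RelSchema} {Dom V : Type*} [LinearOrder Dom]

/-- The composition of the first `k` maps. -/
def orbit {α : Type*} (σ : ℕ → α → α) : ℕ → α → α
  | 0 => id
  | k + 1 => σ k ∘ orbit σ k

omit [LinearOrder Dom] in
theorem orbit_dom {σ : ℕ → Const Dom → Const Dom} (hd : ∀ k d, σ k (Const.dom d) = Const.dom d)
    (d : Dom) : ∀ k, orbit σ k (Const.dom d) = Const.dom d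
  | 0 => rfl
  | k + 1 => by rw [orbit, Function.comp, orbit_dom hd d k, hd]

/-- The order of all constants need not be well-founded. An orbit that reaches a non-fresh constant
stays there; otherwise its fresh indices descend in `ℕ` and become constant. -/
theorem orbit_eventually_eq {σ : ℕ → Const Dom → Const Dom}
    (hd : ∀ k d, σ k (Const.dom d) = Const.dom d) (hle : ∀ k c, σ k c ≤ c) (c : Const Dom) :
    ∃ c', ∀ᶠ k in Filter.atTop, orbit σ k c = c' := by
  by_cases h : ∃ k d, orbit σ k c = Const.dom d
  · obtain ⟨k, d, hkd⟩ := h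
    refine ⟨Const.dom d, Filter.eventually_atTop.2 ⟨k, fun m hm => ?_⟩⟩
    induction m, hm using Nat.le_induction with
    | base => exact hkd
    | succ m _ ih => rw [orbit, Function.comp, ih, hd]
  · have hf : ∀ k, ∃ j, orbit σ k c = Const.fresh j := fun k =>
      (orbit σ k c).eq_dom_or_eq_fresh.resolve_left fun ⟨d, hd⟩ => h ⟨k, d, hd⟩
    choose j hj using hf
    have hanti : Antitone j := antitone_nat_of_succ_le fun k => by
      rw [← Const.fresh_le_fresh (Dom := Dom), ← hj, ← hj]
      exact hle _ _
    obtain ⟨n, hn⟩ := hanti.eventually_eq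
    exact ⟨Const.fresh (j n), Filter.eventually_atTop.2 ⟨n, fun m hm => by rw [hj, hn m hm]⟩⟩

/-- A homomorphism that is pushed along a run finally becomes stable. -/
theorem exists_stable {σ : ℕ → Const Dom → Const Dom}
    (hd : ∀ k d, σ k (Const.dom d) = Const.dom d) (hle : ∀ k c, σ k c ≤ c)
    {L : ℕ → RelAtom S (Const Dom) → ℕ∞} (hL : ∀ k f, L (k + 1) (f.map (σ k)) ≤ L k f)
    (μ : V → Const Dom) : ∃ μ' : V → Const Dom, (∀ x d, μ x = Const.dom d → μ' x = Const.dom d) ∧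
      ∀ (A : RelAtom S (QTerm Dom V)) (B : ℕ), L 0 (A.map (QTerm.eval μ)) ≤ B →
        ∃ j : ℕ, j ≤ B ∧ ∀ᶠ k in Filter.atTop, L k (A.map (QTerm.eval μ')) = j := by
  choose lim hlim using orbit_eventually_eq hd hle
  have hlim_dom : ∀ d, lim (Const.dom d) = Const.dom d := fun d => by
    obtain ⟨k, hk⟩ := (hlim (Const.dom d)).exists
    rw [← hk, orbit_dom hd]
  refine ⟨lim ∘ μ, fun x d hx => by rw [Function.comp, hx, hlim_dom], fun A B hB => ?_⟩
  rw [RelAtom.map_eval_comp fun _ d _ => hlim_dom d]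
  set f := A.map (QTerm.eval μ)
  -- Levels fall along the orbit of the atom, hence become constant in the well-founded order `ℕ∞`.
  have hanti : Antitone fun k => L k (f.map (orbit σ k)) :=
    antitone_nat_of_succ_le fun k => hL k (f.map (orbit σ k))
  obtain ⟨n, hn⟩ := hanti.eventually_eq
  have hle' : L n (f.map (orbit σ n)) ≤ B := (hanti (Nat.zero_le n)).trans hB
  obtain ⟨j, hj⟩ := ENat.ne_top_iff_exists.1 (ne_top_of_le_ne_top (ENat.natCast_ne_top B) hle')
  refine ⟨j, by rwa [← hj, Nat.cast_le] at hle', ?_⟩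
  -- An atom has finitely many arguments, so from some moment on its orbit is the limit atom itself.
  have hev : ∀ᶠ k in Filter.atTop, ∀ i, orbit σ k (f.args i) = lim (f.args i) :=
    Filter.eventually_all.2 fun i => hlim _
  filter_upwards [hev, Filter.eventually_ge_atTop n] with k hk hkn
  rw [← RelAtom.map_congr (f := f) hk, hn k hkn, hj]

end Stabilise

/-! ## Bounds for the levels of answers -/

section Bound

variable {S S' : RelSchema} {Dom : Type u} [LinearOrder Dom] {V : Type*} {m : ℕ}
  {run : LevelRun S S' Dom}

omit [LinearOrder Dom] in
theorem ConjQuery.head_mem (q : ConjQuery S' Dom V m) {μ : V → Const Dom}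
    {L : RelAtom S' (Const Dom) → ℕ∞} {t : Fin m → Const Dom}
    (h : q.Sends μ {f | L f ≠ ⊤} t) (i : Fin m) : Active L (t i) := by
  obtain ⟨A, hA, j, hj⟩ := q.range_restricted i
  have ha := Active.of_mem (h.1 A hA) j
  rw [← h.2 i]
  change Active L (QTerm.eval μ (A.args j)) at ha
  rwa [hj] at ha

omit [LinearOrder Dom] in
theorem ConjQuery.exists_level_le (q : ConjQuery S' Dom V m) {μ : V → Const Dom}
    {L : RelAtom S' (Const Dom) → ℕ∞} {t : Fin m → Const Dom}
    (h : q.Sends μ {f | L f ≠ ⊤} t) : ∃ B : ℕ, q.Sends μ {f | L f ≤ B} t := by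
  suffices H : ∀ l : List (RelAtom S' (QTerm Dom V)), (∀ A ∈ l, L (A.map (QTerm.eval μ)) ≠ ⊤) →
      ∃ B : ℕ, ∀ A ∈ l, L (A.map (QTerm.eval μ)) ≤ B by
    obtain ⟨B, hB⟩ := H q.body h.1
    exact ⟨B, hB, h.2⟩
  intro l
  induction l with
  | nil => exact fun _ => ⟨0, by simp⟩
  | cons A l ih =>
    intro hl
    obtain ⟨B, hB⟩ := ih fun A' hA' => hl A' (List.mem_cons_of_mem _ hA')
    obtain ⟨j, hj⟩ := ENat.ne_top_iff_exists.1 (hl A List.mem_cons_self)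
    refine ⟨max j B, fun A' hA' => ?_⟩
    rcases List.mem_cons.1 hA' with rfl | hA'
    · rw [← hj]; exact Nat.cast_le.2 (le_max_left _ _)
    · exact (hB A' hA').trans (Nat.cast_le.2 (le_max_right _ _))

omit [LinearOrder Dom] in
theorem ConjQuery.Sends.comp {q : ConjQuery S' Dom V m} {μ : V → Const Dom}
    {F F' : Set (RelAtom S' (Const Dom))} {t : Fin m → Dom} (h : q.Sends μ F (Const.dom ∘ t))
    {σ : Const Dom → Const Dom} (hd : ∀ d, σ (Const.dom d) = Const.dom d)
    (hF : ∀ f ∈ F, f.map σ ∈ F') : q.Sends (σ ∘ μ) F' (Const.dom ∘ t) := by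
  refine ⟨fun A hA => ?_, fun i => ?_⟩
  · rw [RelAtom.map_eval_comp fun _ d _ => hd d]
    exact hF _ (h.1 A hA)
  · rw [Function.comp, h.2 i]
    exact hd _

/-- All answers that occur during the run of a database occur at a bounded level. -/
theorem LevelRun.Regular.exists_bound (hrun : run.Regular) (q : ConjQuery S' Dom V m)
    (D : Finset (RelAtom S (Const Dom))) : ∃ B : ℕ, ∀ n L, run D n = some L → ∀ t : Fin m → Dom,
      (∃ μ, q.Sends μ {f | L f ≠ ⊤} (Const.dom ∘ t)) →
      ∃ μ, q.Sends μ {f | L f ≤ B} (Const.dom ∘ t) := by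
  have one : ∀ t : Fin m → Dom, ∃ B : ℕ, ∀ n L, run D n = some L →
      (∃ μ, q.Sends μ {f | L f ≠ ⊤} (Const.dom ∘ t)) →
      ∃ μ, q.Sends μ {f | L f ≤ B} (Const.dom ∘ t) := by
    intro t
    classical
    by_cases h : ∃ n L, run D n = some L ∧ ∃ μ, q.Sends μ {f | L f ≠ ⊤} (Const.dom ∘ t)
    -- Take the first state in which `t` is an answer. The levels used there bound all later states,
    -- because this one homomorphism can be pushed forward to each of them.
    · obtain ⟨L₀, hL₀, μ₀, hμ₀⟩ := Nat.find_spec h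
      obtain ⟨B, hB⟩ := q.exists_level_le hμ₀
      refine ⟨B, fun n L hL hex => ?_⟩
      have hn : Nat.find h ≤ n := Nat.find_min' h ⟨L, hL, hex⟩
      clear hex
      induction n, hn using Nat.le_induction generalizing L with
      | base =>
        rw [hL₀] at hL
        obtain rfl := Option.some.inj hL
        exact ⟨μ₀, hB⟩
      | succ n _ ih =>
        obtain ⟨L', hL', σ, hd, -, hσ⟩ := hrun.push D n L hL
        obtain ⟨μ, hμ⟩ := ih L' hL'
        exact ⟨σ ∘ μ, hμ.comp hd fun f hf => (hσ f).trans hf⟩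
    · exact ⟨0, fun n L hL hex => absurd ⟨n, L, hL, hex⟩ h⟩
  choose B hB using one
  -- Non-fresh constants are never invented, so only the finitely many tuples over the constants of
  -- `D` matter.
  have hfin : {t : Fin m → Dom | ∀ i, t i ∈ {d | Const.dom d ∈ constsOf D}}.Finite := by
    have h := (constsOf_finite D).preimage (Const.dom_injective.injOn)
    exact (Set.Finite.pi' fun _ => h)
  refine ⟨hfin.toFinset.sup B, fun n L hL t hex => ?_⟩
  obtain ⟨μ, hμ⟩ := hB t n L hL hex
  refine ⟨μ, fun A hA => le_trans (α := ℕ∞) (hμ.1 A hA)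
    (Nat.cast_le.2 (Finset.le_sup (f := B) ?_)), hμ.2⟩
  obtain ⟨μ', hμ'⟩ := hex
  exact hfin.mem_toFinset.2 fun i => hrun.dom_mem D n L hL _ (q.head_mem hμ' i)

/-- An answer at a bounded level of one state yields an answer at that level of the limit. -/
theorem LevelRun.Regular.sends_upTo (hrun : run.Regular) {q : ConjQuery S' Dom V m}
    {D : Finset (RelAtom S (Const Dom))} {n₀ : ℕ} {L : ℕ → RelAtom S' (Const Dom) → ℕ∞}
    (hL : ∀ k, run D (n₀ + k) = some (L k)) {B : ℕ} {t : Fin m → Dom} {μ : V → Const Dom}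
    (h : q.Sends μ {f | L 0 f ≤ B} (Const.dom ∘ t)) :
    ∃ μ, q.Sends μ (run.upTo D B) (Const.dom ∘ t) := by
  have hpush : ∀ k, ∃ σ : Const Dom → Const Dom, (∀ d, σ (Const.dom d) = Const.dom d) ∧
      (∀ c, σ c ≤ c) ∧ ∀ f, L (k + 1) (f.map σ) ≤ L k f := by
    intro k
    obtain ⟨L', hL', h⟩ := hrun.push D (n₀ + k) _ (hL (k + 1))
    rw [hL k] at hL'
    obtain rfl := Option.some.inj hL'
    exact h
  choose σ hd hle hσ using hpush
  obtain ⟨μ', hμ', hlev⟩ := exists_stable hd hle hσ μ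
  refine ⟨μ', fun A hA => ?_, fun i => hμ' _ _ (h.2 i)⟩
  obtain ⟨j, hj, hev⟩ := hlev A B (h.1 A hA)
  refine ⟨j, hj, ?_⟩
  obtain ⟨k₀, hk₀⟩ := Filter.eventually_atTop.1 hev
  refine Filter.eventually_atTop.2 ⟨n₀ + k₀, fun n hn => ⟨L (n - n₀), ?_, hk₀ _ (by omega)⟩⟩
  rw [← hL]
  congr 1
  omega

/-- The non-fresh constants of a query. -/
def ConjQuery.constants (q : ConjQuery S' Dom V m) : Set Dom :=
  {d | ∃ A ∈ q.body, ∃ i, A.args i = QTerm.const d}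

omit [LinearOrder Dom] in
theorem ConjQuery.constants_finite (q : ConjQuery S' Dom V m) : q.constants.Finite := by
  have h : (⋃ A ∈ {A | A ∈ q.body}, Set.range A.args).Finite :=
    (List.finite_toSet q.body).biUnion fun A _ => Set.finite_range _
  refine Set.Finite.of_finite_image (f := QTerm.const (V := V)) (h.subset ?_) ?_
  · rintro _ ⟨d, ⟨A, hA, i, hi⟩, rfl⟩
    exact Set.mem_biUnion hA ⟨i, hi⟩
  · intro d _ d' _ h
    exact QTerm.const.inj h

/-- Transfer of answers along a level embedding that fixes the constants of the query. -/
theorem LevelEmb.sends {q : ConjQuery S' Dom V m} {P W : Set (Const Dom)}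
    {ρ : Const Dom → Const Dom} {L L' : RelAtom S' (Const Dom) → ℕ∞}
    (h : LevelEmb q.constants P W ρ L L') {B : ℕ} {μ : V → Const Dom} {t : Fin m → Dom}
    (hμ : q.Sends μ {f | L f ≠ ⊤} (Const.dom ∘ t))
    (hP : ∀ A ∈ q.body, ∀ i, (A.args i).eval μ ∈ P)
    (hB : ∀ t : Fin m → Dom, (∃ μ, q.Sends μ {f | L' f ≠ ⊤} (Const.dom ∘ t)) →
      ∃ μ, q.Sends μ {f | L' f ≤ B} (Const.dom ∘ t)) :
    ∃ μ, q.Sends μ {f | L f ≤ B} (Const.dom ∘ t) := by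
  have hne : Nonempty (Const Dom → Const Dom) := ⟨id⟩
  have hinv : ∀ c ∈ ρ '' W, ∃ c' ∈ W, ρ c' = c := fun c hc => hc
  -- `π` is the inverse of `ρ` on its image; the homomorphism is pulled back along `π`, replaced by
  -- one of bounded level, and sent forward along `ρ`.
  choose! π hπ hρπ using hinv
  have hπρ : ∀ c ∈ W, π (ρ c) = c := fun c hc =>
    h.strictMono.injOn (hπ _ ⟨c, hc, rfl⟩) hc (hρπ _ ⟨c, hc, rfl⟩)
  have hcov : ∀ A ∈ q.body, ∀ i, (A.args i).eval μ ∈ ρ '' W := fun A hA i =>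
    h.cover _ (Active.of_mem (hμ.1 A hA) i) (hP A hA i)
  have hhead : ∀ i, μ (q.head i) ∈ ρ '' W := by
    intro i
    obtain ⟨A, hA, j, hj⟩ := q.range_restricted i
    have := hcov A hA j
    rwa [hj] at this
  have hdom : ∀ i, ∃ d, π (μ (q.head i)) = Const.dom d := fun i =>
    (h.isDom _ (hπ _ (hhead i))).1 ⟨t i, by rw [hρπ _ (hhead i), hμ.2 i]; rfl⟩
  -- The preimage of `t` may be another tuple, which is why the bound `hB` is required for all
  -- tuples.
  choose t' ht' using hdom
  have hsends : q.Sends (π ∘ μ) {f | L' f ≠ ⊤} (Const.dom ∘ t') := by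
    refine ⟨fun A hA => ?_, ht'⟩
    -- The constants of the query are fixed by `ρ`, hence by `π`, so composition with `π` is again a
    -- homomorphism.
    have hmap : A.map (QTerm.eval (π ∘ μ)) = (A.map (QTerm.eval μ)).map π := by
      refine RelAtom.map_eval_comp fun i d hi => ?_
      obtain ⟨w, hw, hwd⟩ := hcov A hA i
      rw [hi] at hwd
      change ρ w = Const.dom d at hwd
      rw [← hwd, hπρ w hw, hwd]
      exact (h.fix d ⟨A, hA, i, hi⟩ w hw).1 hwd
    have hargs : ∀ i, ((A.map (QTerm.eval μ)).map π).args i ∈ W := fun i => hπ _ (hcov A hA i)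
    change L' (A.map (QTerm.eval (π ∘ μ))) ≠ ⊤
    rw [hmap, ← h.lev_eq _ hargs]
    have hback : ((A.map (QTerm.eval μ)).map π).map ρ = A.map (QTerm.eval μ) :=
      RelAtom.map_eq_self (f := A.map (QTerm.eval μ)) (σ := ρ ∘ π) fun i => hρπ _ (hcov A hA i)
    rw [hback]
    exact hμ.1 A hA
  obtain ⟨ν, hν⟩ := hB t' ⟨_, hsends⟩
  refine ⟨ρ ∘ ν, fun A hA => ?_, fun i => ?_⟩
  · have hW : ∀ i, (A.args i).eval ν ∈ W := fun i =>
      h.active _ (Active.of_mem (f := A.map (QTerm.eval ν))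
        (ne_top_of_le_ne_top (ENat.natCast_ne_top B) (hν.1 A hA)) i)
    have hmap : A.map (QTerm.eval (ρ ∘ ν)) = (A.map (QTerm.eval ν)).map ρ := by
      refine RelAtom.map_eval_comp fun i d hi => ?_
      have hw := hW i
      rw [hi] at hw
      exact (h.fix d ⟨A, hA, i, hi⟩ _ hw).2 rfl
    change L _ ≤ _
    rw [hmap, h.lev_eq _ hW]
    exact hν.1 A hA
  · rw [Function.comp, hν.2 i, Function.comp, ← ht' i, hρπ _ (hhead i), hμ.2 i]

/-- For each regular run, the levels of the answers to a query are bounded in terms of the size of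
the largest connected part of the join graph of the database. -/
theorem LevelRun.Regular.exists_level_bound [Finite S.Pred] (hS : ∀ p, 0 < S.arity p)
    (hS' : ∀ p, 0 < S'.arity p) (hrun : run.Regular) (q : ConjQuery S' Dom V m) :
    ∃ δ : ℕ → ℕ, ∀ (D : Finset (RelAtom S (Const Dom))) (ℓ : ℕ), δ (connSize D) ≤ ℓ →
      ∀ t ∈ q.freshFreeAnswers (⋃ k, run.upTo D k), ∃ μ, q.Sends μ (run.upTo D ℓ) t := by
  classical
  choose B hB using hrun.exists_bound q
  -- With components of at most `k` facts and one label for each body atom, at most `k *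
  -- q.body.length` facts are relevant.
  have hδ : ∀ k, ∃ b : ℕ, ∀ D : Finset (RelAtom S (Const Dom)), D.card ≤ k * q.body.length →
      ∃ D' ρ, DbEmb q.constants ρ D' D ∧ B D' ≤ b := by
    intro k
    obtain ⟨R, hR, hrep⟩ := exists_finite_representatives (S := S) q.constants_finite
      (k * q.body.length)
    refine ⟨hR.toFinset.sup B, fun D hD => ?_⟩
    obtain ⟨D', hD', ρ, hρ⟩ := hrep D hD
    exact ⟨D', ρ, hρ, Finset.le_sup (hR.mem_toFinset.2 hD')⟩
  choose δ hδ using hδ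
  refine ⟨δ, fun D ℓ hℓ t ht => ?_⟩
  obtain ⟨⟨μ, hμ⟩, htd⟩ := ht
  choose t' ht' using htd
  obtain rfl : t = Const.dom ∘ t' := funext ht'
  -- An empty body imposes no condition on the chase. Otherwise the eventual presence of a body atom
  -- shows that the run never fails.
  by_cases hbody : q.body = []
  · exact ⟨μ, by simp [hbody], hμ.2⟩
  have hev : ∀ᶠ n in Filter.atTop, ∀ A ∈ {A | A ∈ q.body}, ∃ L, run D n = some L ∧
      L (A.map (QTerm.eval μ)) ≠ ⊤ := by
    refine ((List.finite_toSet q.body).eventually_all).2 fun A hA => ?_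
    obtain ⟨k, j, -, hj⟩ := Set.mem_iUnion.1 (hμ.1 A hA)
    filter_upwards [hj] with n ⟨L, hL, hLj⟩
    exact ⟨L, hL, hLj ▸ ENat.natCast_ne_top j⟩
  obtain ⟨n₀, hn₀⟩ := Filter.eventually_atTop.1 hev
  obtain ⟨A₀, hA₀⟩ := List.exists_mem_of_ne_nil _ hbody
  have hsome : ∀ k, ∃ L, run D (n₀ + k) = some L := fun k =>
    let ⟨L, hL, _⟩ := hn₀ (n₀ + k) (Nat.le_add_right _ _) A₀ hA₀
    ⟨L, hL⟩
  choose L hL using hsome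
  have hsends : q.Sends μ {f | L 0 f ≠ ⊤} (Const.dom ∘ t') := by
    refine ⟨fun A hA => ?_, hμ.2⟩
    obtain ⟨L', hL', hne⟩ := hn₀ n₀ le_rfl A hA
    obtain rfl : L 0 = L' := Option.some.inj ((hL 0).symm.trans hL')
    exact hne
  obtain ⟨Λ, lam₀, hlam₀, hcard⟩ := exists_labelling hS D
  obtain ⟨lam, hlam, hsim⟩ := hrun.sim q.constants Λ D lam₀ hlam₀ n₀ (L 0) (hL 0)
  -- The labels that the homomorphism meets at stage `n₀`. They may be labels of invented constants,
  -- so the labelling `lam` of this stage had to be available before `T`.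
  let T : Finset Λ := (q.body.map fun A => lam ((A.args ⟨0, hS' _⟩).eval μ)).toFinset
  have hTcard : T.card ≤ q.body.length := (List.toFinset_card_le _).trans (by simp)
  obtain ⟨D₁, hD₁, hD₁card⟩ := hcard T
  obtain ⟨D₂, ρ₀, hρ₀, hBD₂⟩ := hδ (connSize D) D₁ (hD₁card.trans (Nat.mul_le_mul_left _ hTcard))
  rw [hD₁] at hρ₀
  obtain ⟨n', L', W, ρ, hL', hemb⟩ := hsim T D₂ ρ₀ hρ₀
  obtain ⟨ν, hν⟩ := hemb.sends hsends (fun A hA i => by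
    have e : lam ((A.args i).eval μ) = lam ((A.args ⟨0, hS' _⟩).eval μ) :=
      hlam _ (hsends.1 A hA) i ⟨0, hS' _⟩
    simp only [Set.mem_ofPred_eq, e, Finset.mem_coe, T, List.mem_toFinset, List.mem_map]
    exact ⟨A, hA, rfl⟩) (hB D₂ n' L' hL')
  -- The bounded homomorphism found so far only belongs to stage `n₀`; it is now carried to the
  -- limit.
  obtain ⟨ν', hν'⟩ := hrun.sends_upTo hL hν
  refine ⟨ν', fun A hA => ?_, hν'.2⟩
  obtain ⟨j, hj, hev⟩ := hν'.1 A hA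
  exact ⟨j, hj.trans (hBD₂.trans hℓ), hev⟩

end Bound

/-! ## Conceptual dependencies -/

namespace EERSchema

variable (C : EERSchema)

theorem baseArity_pos : ∀ x, 0 < C.baseArity x
  | Sum.inl _ => Nat.one_pos
  | Sum.inr R => Nat.two_pos.trans_le (C.two_le_relArity R)

theorem arity_pos : ∀ p, 0 < C.schema.arity p
  | Sum.inl x => C.baseArity_pos x
  | Sum.inr _ => Nat.succ_pos _

theorem tameDeps : TameDeps C.inclDeps C.keyDeps where
  arity_pos := C.arity_pos
  width_pos := by
    rintro _ (A | ⟨R, i⟩ | ⟨A, h⟩ | ⟨E₁, E₂, h⟩ | ⟨R₁, R₂, j, h⟩ | ⟨E, R, c, h⟩)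
    · exact C.arity_pos (C.ownerPred A)
    · exact Nat.one_pos
    · exact C.arity_pos (C.ownerPred A)
    · exact Nat.one_pos
    · exact C.arity_pos (C.rel R₁)
    · exact Nat.one_pos
  tgtPos_injective := by
    rintro _ (A | ⟨R, i⟩ | ⟨A, h⟩ | ⟨E₁, E₂, h⟩ | ⟨R₁, R₂, j, h⟩ | ⟨E, R, c, h⟩)
    · exact Function.injective_id
    · exact Function.injective_of_subsingleton (α := Fin 1) _
    · exact Fin.castSucc_injective _
    · exact Function.injective_of_subsingleton (α := Fin 1) _
    · exact j.injective
    · exact Function.injective_of_subsingleton (α := Fin 1) _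
  attrs_nonempty := by
    rintro _ (⟨A, h⟩ | ⟨E, R, c, h⟩)
    · exact ⟨_, Finset.mem_image_of_mem _ (Finset.mem_univ ⟨0, C.arity_pos _⟩)⟩
    · exact Finset.singleton_nonempty _

end EERSchema

theorem mainTheorem7 {Dom : Type*} [Infinite Dom] [LinearOrder Dom]
    (C : EERSchema) [Finite C.Ent] [Finite C.Rel] [Finite C.Att] [LinearOrder C.schema.Pred]
    {V : Type*} {n : ℕ} (q : ConjQuery C.schema Dom V n) :
    ∃ δM : ℕ → ℕ, ∀ D : Finset (RelAtom C.schema (Const Dom)),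
      ChaseExists C.inclDeps C.keyDeps D →
        (∀ t ∈ q.freshFreeAnswers (chase C.inclDeps C.keyDeps D),
          ∃ μ, q.Sends μ (chaseUpTo C.inclDeps C.keyDeps D (δM (connSize D))) t) ∧
        (∀ t ∈ q.toEq.freshFreeAnswers (eqChase C.inclDeps C.keyDeps D),
          ∃ μ, q.toEq.Sends μ (eqChaseUpTo C.inclDeps C.keyDeps D (δM (connSize D))) t) ∧
        (∀ t ∈ q.maquillage.freshFreeAnswers (eqChase C.inclDeps C.keyDeps D),
          ∃ μ, q.maquillage.Sends μ
            (eqChaseUpTo C.inclDeps C.keyDeps D (δM (connSize D))) t) := by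
  have : Finite C.schema.Pred := inferInstanceAs (Finite ((C.Ent ⊕ C.Rel) ⊕ C.Att))
  have hS := C.arity_pos
  have hS' := withEq_arity_pos hS
  obtain ⟨δ₁, h₁⟩ := (chaseRun_regular C.tameDeps).exists_level_bound hS hS q
  obtain ⟨δ₂, h₂⟩ := (eqChaseRun_regular C.tameDeps).exists_level_bound hS hS' q.toEq
  obtain ⟨δ₃, h₃⟩ := (eqChaseRun_regular C.tameDeps).exists_level_bound hS hS' q.maquillage
  -- Each bound may be enlarged, so the maximum serves all three items.
  refine ⟨fun k => max (δ₁ k) (max (δ₂ k) (δ₃ k)), fun D _ => ?_⟩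
  simp only [chase, eqChase, chaseUpTo_eq, eqChaseUpTo_eq]
  exact ⟨h₁ D _ (le_max_left _ _), h₂ D _ ((le_max_left _ _).trans (le_max_right _ _)),
    h₃ D _ ((le_max_right _ _).trans (le_max_right _ _))⟩
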